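/- Let $d,k,\ell\ge 2$ be integers with $k$ and $\ell$ relatively prime, and let $r_0=z^k+t^\ell\in\mathbb{C}[z,t]$. For $g\in\mathbb{C}[x,z,t]$ let $X(g)\subset\mathbb{A}^4=\mathrm{Spec}(\mathbb{C}[x,y,z,t])$ be the hypersurface with equation $x^dy+r_0(z,t)+x\,g(x,z,t)=0$. Let $B=\mathbb{C}[a_{i,j}]$ be the polynomial ring in the $(k-1)(\ell-1)$ indeterminates $a_{i,j}$, $0\le i\le k-2$, $0\le j\le \ell-2$, let $\mathfrak{m}_0\subset B$ be the ideal generated by the $a_{i,j}$, and let $$F=r_0+\sum_{0\le i\le k-2,\ 0\le j\le \ell-2}a_{i,j}z^it^j\in B[z,t].$$ For a homomorphism of $\mathbb{C}$-algebras $\alpha:B\to\mathbb{C}[x]$ with $\alpha(\mathfrak{m}_0)\subset x\mathbb{C}[x]$, let $F_\alpha=r_0+\sum\alpha(a_{i,j})z^it^j$ be the image of $F$ in $\mathbb{C}[x]\otimes_B B[z,t]\simeq\mathbb{C}[x,z,t]$, and let $\mathfrak{X}_\alpha\subset\mathbb{A}^4$ be the hypersurface with equation $x^dy+F_\alpha=0$;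 thus $\mathfrak{X}_\alpha=X(g_\alpha)$, where $F_\alpha=r_0+xg_\alpha$. Then the following hold, where isomorphisms are isomorphisms of schemes over $\mathbb{C}$. 1) For every $g\in\mathbb{C}[x,z,t]$ there exists a homomorphism of $\mathbb{C}$-algebras $\alpha:B\to\mathbb{C}[x]$ with $\alpha(\mathfrak{m}_0)\subset x\mathbb{C}[x]$ such that $X(g)$ is isomorphic to $\mathfrak{X}_\alpha$. 2) Let $\alpha,\beta:B\to\mathbb{C}[x]$ be homomorphisms of $\mathbb{C}$-algebras with $\alpha(\mathfrak{m}_0)\subset x\mathbb{C}[x]$ and $\beta(\mathfrak{m}_0)\subset x\mathbb{C}[x]$. Then $\mathfrak{X}_\alpha$ and $\mathfrak{X}_\beta$ are isomorphic if and only if there exist constants $\lambda,\mu\in\mathbb{C}^*$ such that $$\sigma_\mu\circ\pi_d\circ\alpha=\pi_d\circ\beta\circ\zeta_\lambda,$$ where $\pi_d:\mathbb{C}[x]\to\mathbb{C}[x]/(x^d)$ is the natural projection, $\sigma_\mu$ is the automorphism of $\mathbb{C}[x]/(x^d)$ induced by $x\mapsto\mu x$, and $\zeta_\lambda:B\to B$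 is the automorphism of $\mathbb{C}$-algebras defined by $a_{i,j}\mapsto\lambda^{\ell i+kj-k\ell}a_{i,j}$. -/

import Mathlib

open CategoryTheory AlgebraicGeometry

noncomputable section

namespace DefKR

/-- The hypersurface `x ^ d * y + f(x, z, t) = 0` of affine four-space, for `f ∈ ℂ[x, z, t]`:
its equation. The variables of `ℂ[x, y, z, t]` are `x = X 0`, `y = X 1`, `z = X 2`, `t = X 3`,
and those of `ℂ[x, z, t]` are `x = X 0`, `z = X 1`, `t = X 2`. -/
def equation (d : ℕ) (f : MvPolynomial (Fin 3) ℂ) : MvPolynomial (Fin 4) ℂ :=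
  MvPolynomial.X 0 ^ d * MvPolynomial.X 1 + MvPolynomial.rename ![0, 2, 3] f

/-- The coordinate ring `ℂ[x, y, z, t] / (x ^ d * y + f)`. -/
abbrev CoordinateRing (d : ℕ) (f : MvPolynomial (Fin 3) ℂ) : Type :=
  MvPolynomial (Fin 4) ℂ ⧸ Ideal.span {equation d f}

/-- The hypersurface `x ^ d * y + f(x, z, t) = 0`, as a scheme over `ℂ`. -/
def hypersurface (d : ℕ) (f : MvPolynomial (Fin 3) ℂ) : Over (Spec (CommRingCat.of ℂ)) :=
  Over.mk (Spec.map (CommRingCat.ofHom (algebraMap ℂ (CoordinateRing d f))))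

/-- `z ^ k + t ^ ℓ` in `R[z, t]`, where `z = X 0` and `t = X 1`. -/
def curvePoly (R : Type) [CommRing R] (k ℓ : ℕ) : MvPolynomial (Fin 2) R :=
  MvPolynomial.X 0 ^ k + MvPolynomial.X 1 ^ ℓ

/-- The threefold `X(g)` with equation `x ^ d * y + r₀(z, t) + x * g(x, z, t) = 0`, where
`r₀ = z ^ k + t ^ ℓ`. -/
def threefold (d k ℓ : ℕ) (g : MvPolynomial (Fin 3) ℂ) : Over (Spec (CommRingCat.of ℂ)) :=
  hypersurface d
    (MvPolynomial.rename ![1, 2] (curvePoly ℂ k ℓ) + MvPolynomial.X 0 * g)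

/-- The polynomial ring `B = ℂ[a i j]`, `0 ≤ i ≤ k - 2`, `0 ≤ j ≤ ℓ - 2`. -/
abbrev ParamRing (k ℓ : ℕ) : Type := MvPolynomial (Fin (k - 1) × Fin (ℓ - 1)) ℂ

/-- The maximal ideal `𝔪₀` of `B` generated by the `a i j`. -/
def originIdeal (k ℓ : ℕ) : Ideal (ParamRing k ℓ) :=
  Ideal.span (Set.range MvPolynomial.X)

/-- The polynomial `F = r₀ + ∑ a i j * z ^ i * t ^ j` of `B[z, t]`. -/
def versalPoly (k ℓ : ℕ) : MvPolynomial (Fin 2) (ParamRing k ℓ) :=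
  curvePoly (ParamRing k ℓ) k ℓ +
    ∑ p : Fin (k - 1) × Fin (ℓ - 1),
      MvPolynomial.C (MvPolynomial.X p) *
        (MvPolynomial.X 0 ^ (p.1 : ℕ) * MvPolynomial.X 1 ^ (p.2 : ℕ))

/-- The canonical identification of `ℂ[x][z, t]` with `ℂ[x, z, t]`. -/
def flatten : MvPolynomial (Fin 2) (Polynomial ℂ) →+* MvPolynomial (Fin 3) ℂ :=
  MvPolynomial.eval₂Hom
    (Polynomial.aeval (MvPolynomial.X 0 : MvPolynomial (Fin 3) ℂ) :
      Polynomial ℂ →ₐ[ℂ] MvPolynomial (Fin 3) ℂ).toRingHom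
    ![MvPolynomial.X 1, MvPolynomial.X 2]

/-- The image of `F` in `ℂ[x] ⊗[B] B[z, t] = ℂ[x, z, t]` under `α : B → ℂ[x]`. -/
def pullbackPoly (k ℓ : ℕ) (α : ParamRing k ℓ →ₐ[ℂ] Polynomial ℂ) : MvPolynomial (Fin 3) ℂ :=
  flatten (MvPolynomial.map α.toRingHom (versalPoly k ℓ))

/-- The condition `α(𝔪₀) ⊆ x ℂ[x]`. -/
def IsPointed {k ℓ : ℕ} (α : ParamRing k ℓ →ₐ[ℂ] Polynomial ℂ) : Prop :=
  ∀ b ∈ originIdeal k ℓ, α b ∈ Ideal.span {(Polynomial.X : Polynomial ℂ)}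

/-- The threefold `𝔛_α`, whose equation is `x ^ d * y + F_α(x, z, t) = 0` with `F_α` the image of
`F` under `α`. -/
def versalThreefold (d : ℕ) {k ℓ : ℕ} (α : ParamRing k ℓ →ₐ[ℂ] Polynomial ℂ) :
    Over (Spec (CommRingCat.of ℂ)) :=
  hypersurface d (pullbackPoly k ℓ α)

/-- The ring `ℂ[x] / (x ^ d)`. -/
abbrev Truncated (d : ℕ) : Type :=
  Polynomial ℂ ⧸ Ideal.span {(Polynomial.X ^ d : Polynomial ℂ)}

/-- The natural projection `π_d : ℂ[x] → ℂ[x] / (x ^ d)`. -/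
def truncate (d : ℕ) : Polynomial ℂ →ₐ[ℂ] Truncated d :=
  Ideal.Quotient.mkₐ ℂ (Ideal.span {(Polynomial.X ^ d : Polynomial ℂ)})

/-- The substitution `x ↦ μ * x` of `ℂ[x]`. -/
def dilate (μ : ℂˣ) : Polynomial ℂ →ₐ[ℂ] Polynomial ℂ :=
  Polynomial.aeval (Polynomial.C (μ : ℂ) * Polynomial.X)

theorem span_le_comap_dilate (d : ℕ) (μ : ℂˣ) :
    Ideal.span {(Polynomial.X ^ d : Polynomial ℂ)} ≤
      (Ideal.span {(Polynomial.X ^ d : Polynomial ℂ)}).comap (dilate μ) := by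
  rw [Ideal.span_singleton_le_iff_mem, Ideal.mem_comap, Ideal.mem_span_singleton]
  simp only [dilate, map_pow, Polynomial.aeval_X, mul_pow]
  exact Dvd.intro_left _ rfl

/-- The endomorphism `x ↦ μ * x` of `ℂ[x] / (x ^ d)`. -/
def dilateTruncated (d : ℕ) (μ : ℂˣ) : Truncated d →ₐ[ℂ] Truncated d :=
  Ideal.quotientMapₐ _ (dilate μ) (span_le_comap_dilate d μ)

/-- The map `ζ_c : B → B`, `a i j ↦ c ^ (ℓ * i + k * j - k * ℓ) * a i j` (the exponent is an
integer, possibly negative). -/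
def weightScaling (k ℓ : ℕ) (c : ℂˣ) : ParamRing k ℓ →ₐ[ℂ] ParamRing k ℓ :=
  MvPolynomial.aeval fun p : Fin (k - 1) × Fin (ℓ - 1) =>
    MvPolynomial.C ((c ^ ((ℓ : ℤ) * (p.1 : ℕ) + (k : ℤ) * (p.2 : ℕ) - (k : ℤ) * ℓ) : ℂˣ) : ℂ) *
      MvPolynomial.X p

end DefKR

end

open DefKR

namespace KRThreefold

section LND

variable {R : Type*} [CommRing R] [Algebra ℂ R] (D : Derivation ℂ R R)

/-- The element `a` is killed by some iterate of the derivation `D`. -/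
def IsNilp (a : R) : Prop := ∃ n, D^[n] a = 0

/-- The element `a` has degree exactly `n` with respect to the derivation `D`. -/
def HasDeg (a : R) (n : ℕ) : Prop := D^[n] a ≠ 0 ∧ D^[n + 1] a = 0

variable {D}

theorem iterate_derivation_add (n : ℕ) (a b : R) : D^[n] (a + b) = D^[n] a + D^[n] b := by
  induction n generalizing a b with
  | zero => rfl
  | succ n ih => simp

theorem iterate_derivation_zero (n : ℕ) : D^[n] 0 = 0 :=
  Function.iterate_fixed (map_zero D) n

theorem iterate_derivation_eq_zero_of_le {a : R} {m n : ℕ} (h : m ≤ n) (ha : D^[m] a = 0) :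
    D^[n] a = 0 := by
  obtain ⟨k, rfl⟩ := Nat.exists_eq_add_of_le' h
  rw [Function.iterate_add_apply, ha, iterate_derivation_zero]

theorem iterate_derivation_mul_left {a : R} (ha : D a = 0) (n : ℕ) (b : R) :
    D^[n] (a * b) = a * D^[n] b := by
  induction n generalizing b with
  | zero => rfl
  | succ n ih => simp [ha, ih]

theorem iterate_derivation_mul (N : ℕ) : ∀ (m n : ℕ) (a b : R), m + n = N → D^[m + 1] a = 0 →
    D^[n + 1] b = 0 → D^[N] (a * b) = (N.choose m : R) * (D^[m] a * D^[n] b) ∧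
      D^[N + 1] (a * b) = 0 := by
  induction N with
  | zero =>
    intro m n a b h ha hb
    obtain ⟨rfl, rfl⟩ : m = 0 ∧ n = 0 := by omega
    simp only [zero_add, Function.iterate_one] at ha hb
    simp [ha, hb]
  | succ N ih =>
    intro m n a b h ha hb
    rw [Function.iterate_succ_apply] at ha hb
    have hD : D (a * b) = D a * b + a * D b := by simp; ring
    rw [Function.iterate_succ_apply, Function.iterate_succ_apply, hD, iterate_derivation_add,
      iterate_derivation_add]
    rcases m with _ | m
    · obtain rfl : n = N + 1 := by omega
      simp only [Function.iterate_zero, id_eq] at ha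
      obtain ⟨h1, h2⟩ := ih 0 N a (D b) (by omega) (by simpa using ha) hb
      rw [h1, h2]
      simp [ha]
    · rcases n with _ | n
      · obtain rfl : m = N := by omega
        simp only [Function.iterate_zero, id_eq] at hb
        obtain ⟨h1, h2⟩ := ih m 0 (D a) b (by omega) ha (by simpa using hb)
        rw [h1, h2]
        simp [hb]
      · obtain ⟨h1, h2⟩ := ih m (n + 1) (D a) b (by omega) ha (by
          rwa [Function.iterate_succ_apply])
        obtain ⟨h3, h4⟩ := ih (m + 1) n a (D b) (by omega) (by
          rwa [Function.iterate_succ_apply]) hb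
        rw [h1, h2, h3, h4]
        simp only [Function.iterate_succ_apply, Nat.choose_succ_succ, Nat.cast_add]
        constructor <;> ring

theorem IsNilp.exists_hasDeg {a : R} (h : IsNilp D a) (ha : a ≠ 0) : ∃ n, HasDeg D a n := by
  classical
  rcases hn : Nat.find h with _ | n
  · have := Nat.find_spec h
    rw [hn] at this
    exact absurd this ha
  · refine ⟨n, Nat.find_min h (by omega), ?_⟩
    rw [← hn]
    exact Nat.find_spec h

theorem HasDeg.isNilp {a : R} {n : ℕ} (h : HasDeg D a n) : IsNilp D a := ⟨_, h.2⟩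

theorem HasDeg.ne_zero {a : R} {n : ℕ} (h : HasDeg D a n) : a ≠ 0 := by
  rintro rfl
  exact h.1 (iterate_derivation_zero n)

theorem HasDeg.unique {a : R} {m n : ℕ} (hm : HasDeg D a m) (hn : HasDeg D a n) : m = n := by
  by_contra h
  rcases Nat.lt_or_gt_of_ne h with h | h
  · exact hn.1 (iterate_derivation_eq_zero_of_le h hm.2)
  · exact hm.1 (iterate_derivation_eq_zero_of_le h hn.2)

theorem HasDeg.le_of_iterate_eq_zero {a : R} {m n : ℕ} (hm : HasDeg D a m)
    (h : D^[n] a = 0) : m < n := by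
  by_contra hlt
  exact hm.1 (iterate_derivation_eq_zero_of_le (not_lt.mp hlt) h)

theorem hasDeg_zero_iff {a : R} : HasDeg D a 0 ↔ a ≠ 0 ∧ D a = 0 := by
  simp [HasDeg]

theorem HasDeg.apply {a : R} {n : ℕ} (h : HasDeg D a (n + 1)) : HasDeg D (D a) n := h

theorem HasDeg.mul [IsDomain R] {a b : R} {m n : ℕ} (ha : HasDeg D a m) (hb : HasDeg D b n) :
    HasDeg D (a * b) (m + n) := by
  have := charZero_of_injective_algebraMap (algebraMap ℂ R).injective
  obtain ⟨h1, h2⟩ := iterate_derivation_mul (D := D) (m + n) m n a b rfl ha.2 hb.2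
  refine ⟨?_, h2⟩
  rw [h1]
  exact mul_ne_zero (Nat.cast_ne_zero.mpr (Nat.choose_pos (Nat.le_add_right m n)).ne')
    (mul_ne_zero ha.1 hb.1)

theorem HasDeg.pow [IsDomain R] {a : R} {m : ℕ} (ha : HasDeg D a m) (n : ℕ) :
    HasDeg D (a ^ n) (n * m) := by
  induction n with
  | zero => simp [hasDeg_zero_iff]
  | succ n ih =>
    rw [pow_succ, Nat.succ_mul]
    exact ih.mul ha

theorem IsNilp.of_apply_eq_zero {a : R} (h : D a = 0) : IsNilp D a := ⟨1, h⟩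

theorem IsNilp.add {a b : R} (ha : IsNilp D a) (hb : IsNilp D b) : IsNilp D (a + b) := by
  obtain ⟨m, hm⟩ := ha
  obtain ⟨n, hn⟩ := hb
  refine ⟨max m n, ?_⟩
  rw [iterate_derivation_add, iterate_derivation_eq_zero_of_le (le_max_left m n) hm,
    iterate_derivation_eq_zero_of_le (le_max_right m n) hn, add_zero]

theorem IsNilp.mul {a b : R} (ha : IsNilp D a) (hb : IsNilp D b) : IsNilp D (a * b) := by
  obtain ⟨m, hm⟩ := ha
  obtain ⟨n, hn⟩ := hb
  exact ⟨_, (iterate_derivation_mul (D := D) (m + n) m n a b rfl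
    (iterate_derivation_eq_zero_of_le (Nat.le_succ m) hm)
    (iterate_derivation_eq_zero_of_le (Nat.le_succ n) hn)).2⟩

variable (D) in
/-- The subalgebra of elements on which a derivation is locally nilpotent. -/
def nilpSubalgebra : Subalgebra ℂ R where
  carrier := {a | IsNilp D a}
  mul_mem' := IsNilp.mul
  add_mem' := IsNilp.add
  algebraMap_mem' r := .of_apply_eq_zero (D.map_algebraMap r)

theorem mem_nilpSubalgebra {a : R} : a ∈ nilpSubalgebra D ↔ IsNilp D a := Iff.rfl

/-- The kernel of a locally nilpotent derivation of a domain is factorially closed. -/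
theorem IsNilp.apply_eq_zero_of_mul [IsDomain R] {a b : R} (ha : IsNilp D a) (hb : IsNilp D b)
    (hab : a * b ≠ 0) (h : D (a * b) = 0) : D a = 0 ∧ D b = 0 := by
  obtain ⟨m, hm⟩ := ha.exists_hasDeg (left_ne_zero_of_mul hab)
  obtain ⟨n, hn⟩ := hb.exists_hasDeg (right_ne_zero_of_mul hab)
  have := (hm.mul hn).unique (hasDeg_zero_iff.mpr ⟨hab, h⟩)
  obtain ⟨rfl, rfl⟩ : m = 0 ∧ n = 0 := by omega
  exact ⟨(hasDeg_zero_iff.mp hm).2, (hasDeg_zero_iff.mp hn).2⟩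

theorem apply_eq_zero_of_pow [IsDomain R] {a : R} {n : ℕ} (hn : n ≠ 0) (h0 : a ≠ 0)
    (h : D (a ^ n) = 0) : D a = 0 := by
  have := charZero_of_injective_algebraMap (algebraMap ℂ R).injective
  rw [D.leibniz_pow] at h
  simpa [hn, h0] using h

/-- If `e * a ^ k + c * b ^ l` is a nonzero element of the kernel of a locally nilpotent
derivation, with `k, l ≥ 2` and `e, c` in the kernel, then so are `a` and `b`. -/
theorem apply_eq_zero_of_sum_pow [IsDomain R] {a b c e : R} {k l : ℕ} (hk : 2 ≤ k) (hl : 2 ≤ l)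
    (ha : IsNilp D a) (hb : IsNilp D b) (hc : D c = 0) (he : D e = 0) (hc0 : c ≠ 0) (he0 : e ≠ 0)
    (hp0 : e * a ^ k + c * b ^ l ≠ 0) (hp : D (e * a ^ k + c * b ^ l) = 0) :
    D a = 0 ∧ D b = 0 := by
  have := charZero_of_injective_algebraMap (algebraMap ℂ R).injective
  obtain ⟨k, rfl⟩ := Nat.exists_eq_add_of_le hk
  obtain ⟨l, rfl⟩ := Nat.exists_eq_add_of_le hl
  have hp' : e * ((2 + k : ℕ) * a ^ (1 + k) * D a) + c * ((2 + l : ℕ) * b ^ (1 + l) * D b) = 0 := by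
    have h1 : 2 + k - 1 = 1 + k := by omega
    have h2 : 2 + l - 1 = 1 + l := by omega
    rw [← hp]
    simp [D.leibniz, D.leibniz_pow, hc, he, h1, h2]
    ring
  have key : D a ≠ 0 ↔ D b ≠ 0 := by
    have hk' : ((2 + k : ℕ) : R) ≠ 0 := Nat.cast_ne_zero.mpr (by omega)
    have hl' : ((2 + l : ℕ) : R) ≠ 0 := Nat.cast_ne_zero.mpr (by omega)
    constructor
    · intro h h'
      rw [h'] at hp'
      simp only [mul_zero, add_zero, mul_eq_zero, he0, hk', false_or, h, or_false] at hp'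
      have ha0 : a = 0 := by simpa using hp'
      simp [ha0] at h
    · intro h h'
      rw [h'] at hp'
      simp only [mul_zero, zero_add, mul_eq_zero, hc0, hl', false_or, h, or_false] at hp'
      have hb0 : b = 0 := by simpa using hp'
      simp [hb0] at h
  by_contra hcon
  have hDa : D a ≠ 0 := by tauto
  have hDb : D b ≠ 0 := key.mp hDa
  have ha0 : a ≠ 0 := by rintro rfl; simp at hDa
  have hb0 : b ≠ 0 := by rintro rfl; simp at hDb
  obtain ⟨m, hm⟩ := ha.exists_hasDeg ha0
  obtain ⟨n, hn⟩ := hb.exists_hasDeg hb0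
  obtain ⟨m, rfl⟩ : ∃ m', m = m' + 1 := Nat.exists_eq_succ_of_ne_zero (by
    rintro rfl; exact hDa (hasDeg_zero_iff.mp hm).2)
  obtain ⟨n, rfl⟩ : ∃ n', n = n' + 1 := Nat.exists_eq_succ_of_ne_zero (by
    rintro rfl; exact hDb (hasDeg_zero_iff.mp hn).2)
  have hpd := hasDeg_zero_iff.mpr ⟨hp0, hp⟩
  set W : R := (2 + k : ℕ) * b * D a - (2 + l : ℕ) * a * D b with hW
  have hnat : ∀ n : ℕ, IsNilp D (n : R) := fun n => .of_apply_eq_zero (D.map_natCast n)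
  have hDa' : IsNilp D (D a) := hm.apply.isNilp
  have hDb' : IsNilp D (D b) := hn.apply.isNilp
  have hWn : IsNilp D W := by
    rw [← mem_nilpSubalgebra] at *
    exact sub_mem (mul_mem (mul_mem (hnat _) hb) hDa') (mul_mem (mul_mem (hnat _) ha) hDb')
  have e1 : (e * a ^ (2 + k) + c * b ^ (2 + l)) * ((2 + k : ℕ) * D a) = c * b ^ (1 + l) * W := by
    rw [hW]
    linear_combination a * hp'
  have e2 : (e * a ^ (2 + k) + c * b ^ (2 + l)) * ((2 + l : ℕ) * D b) =
      - e * a ^ (1 + k) * W := by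
    rw [hW]
    linear_combination b * hp'
  have hcast : ∀ n : ℕ, HasDeg D ((2 + n : ℕ) : R) 0 := fun n =>
    hasDeg_zero_iff.mpr ⟨Nat.cast_ne_zero.mpr (by omega), D.map_natCast _⟩
  have d1 := hpd.mul ((hcast k).mul hm.apply)
  have d2 := hpd.mul ((hcast l).mul hn.apply)
  have hW0 : W ≠ 0 := by
    intro h
    rw [e1, h, mul_zero] at d1
    exact d1.ne_zero rfl
  obtain ⟨w, hw⟩ := hWn.exists_hasDeg hW0
  have d1' := ((hasDeg_zero_iff.mpr ⟨hc0, hc⟩).mul (hn.pow (1 + l))).mul hw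
  have d2' := ((hasDeg_zero_iff.mpr ⟨neg_ne_zero.mpr he0, by simp [he]⟩ :
    HasDeg D (-e) 0).mul (hm.pow (1 + k))).mul hw
  rw [e1] at d1
  rw [e2] at d2
  have u1 := d1.unique d1'
  have u2 := d2.unique d2'
  nlinarith [Nat.zero_le (l * (n + 1)), Nat.zero_le (k * (m + 1))]

end LND

section Graded

open DirectSum

variable {L : Type*} [CommRing L] [Algebra ℂ L] {Γ : Type*} [AddCommGroup Γ] [LinearOrder Γ]
  (𝒜 : Γ → Submodule ℂ L) [GradedAlgebra 𝒜]

/-- The projection on a homogeneous component. -/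
def gproj (γ : Γ) : L →ₗ[ℂ] L :=
  (𝒜 γ).subtype ∘ₗ DirectSum.component ℂ Γ (fun i => 𝒜 i) γ ∘ₗ
    (DirectSum.decomposeLinearEquiv 𝒜).toLinearMap

theorem gproj_apply (γ : Γ) (a : L) : gproj 𝒜 γ a = (decompose 𝒜 a γ : L) := rfl

theorem gproj_mem (γ : Γ) (a : L) : gproj 𝒜 γ a ∈ 𝒜 γ := (decompose 𝒜 a γ).2

variable {𝒜}

theorem gproj_same {γ : Γ} {a : L} (h : a ∈ 𝒜 γ) : gproj 𝒜 γ a = a :=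
  decompose_of_mem_same 𝒜 h

theorem gproj_ne {γ δ : Γ} {a : L} (h : a ∈ 𝒜 γ) (hne : γ ≠ δ) : gproj 𝒜 δ a = 0 :=
  decompose_of_mem_ne 𝒜 h hne

theorem gproj_mul_left {γ δ : Γ} {a b : L} (h : a ∈ 𝒜 γ) :
    gproj 𝒜 (γ + δ) (a * b) = a * gproj 𝒜 δ b :=
  coe_decompose_mul_add_of_left_mem 𝒜 h

theorem sum_gproj (a : L) : ∃ s : Finset Γ, ∑ γ ∈ s, gproj 𝒜 γ a = a := by
  classical
  exact ⟨_, sum_support_decompose 𝒜 a⟩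

theorem exists_finset_gproj_eq_zero (a : L) : ∃ s : Finset Γ, ∀ γ, γ ∉ s → gproj 𝒜 γ a = 0 := by
  classical
  refine ⟨(decompose 𝒜 a).support, fun γ h => ?_⟩
  simpa [gproj_apply] using h

theorem eq_zero_of_gproj {a : L} (h : ∀ γ, gproj 𝒜 γ a = 0) : a = 0 := by
  obtain ⟨s, hs⟩ := sum_gproj (𝒜 := 𝒜) a
  rw [← hs]
  exact Finset.sum_eq_zero fun γ _ => h γ

variable (𝒜) in
/-- All homogeneous components of `a` have degree at most `γ`. -/
def DegLE (γ : Γ) (a : L) : Prop := ∀ δ, γ < δ → gproj 𝒜 δ a = 0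

theorem DegLE.of_mem {γ : Γ} {a : L} (h : a ∈ 𝒜 γ) : DegLE 𝒜 γ a :=
  fun _ hδ => gproj_ne h hδ.ne

theorem exists_top {a : L} (ha : a ≠ 0) : ∃ γ, gproj 𝒜 γ a ≠ 0 ∧ DegLE 𝒜 γ a := by
  classical
  obtain ⟨s, hs⟩ := exists_finset_gproj_eq_zero (𝒜 := 𝒜) a
  have hne : (s.filter fun γ => gproj 𝒜 γ a ≠ 0).Nonempty := by
    by_contra h
    apply ha
    apply eq_zero_of_gproj (𝒜 := 𝒜)
    intro γ
    by_contra hγ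
    apply h
    refine ⟨γ, Finset.mem_filter.mpr ⟨?_, hγ⟩⟩
    by_contra hs'
    exact hγ (hs γ hs')
  obtain ⟨γ, hγ, hmax⟩ := Finset.exists_max_image _ id hne
  refine ⟨γ, (Finset.mem_filter.mp hγ).2, fun δ hδ => ?_⟩
  by_contra h
  have := hmax δ (Finset.mem_filter.mpr ⟨by by_contra hs'; exact h (hs δ hs'), h⟩)
  exact absurd hδ (not_lt.mpr this)

variable (𝒜) in
/-- The homogeneous component of degree `ε` of a linear endomorphism. -/
def compLin (ε : Γ) (E : L →ₗ[ℂ] L) : L →ₗ[ℂ] L :=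
  (DirectSum.toModule ℂ Γ L fun δ => gproj 𝒜 (δ + ε) ∘ₗ E ∘ₗ (𝒜 δ).subtype) ∘ₗ
    (DirectSum.decomposeLinearEquiv 𝒜).toLinearMap

theorem compLin_of_mem (ε : Γ) (E : L →ₗ[ℂ] L) {δ : Γ} {a : L} (h : a ∈ 𝒜 δ) :
    compLin 𝒜 ε E a = gproj 𝒜 (δ + ε) (E a) := by
  simp only [compLin, LinearMap.comp_apply, LinearEquiv.coe_coe, decomposeLinearEquiv_apply]
  lift a to 𝒜 δ using h
  rw [decompose_coe]
  exact DirectSum.toModule_lof ℂ (M := fun i => 𝒜 i) δ a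

variable (𝒜) in
/-- The homogeneous component of degree `ε` of a derivation. -/
def gcomp (ε : Γ) (E : Derivation ℂ L L) : Derivation ℂ L L :=
  Derivation.mk' (compLin 𝒜 ε E) (by
    intro a b
    induction a using DirectSum.Decomposition.inductionOn 𝒜 with
    | zero => simp
    | add a a' ha ha' =>
      rw [add_mul, map_add, ha, ha']
      simp only [smul_eq_mul, map_add]
      ring
    | @homogeneous i a =>
      induction b using DirectSum.Decomposition.inductionOn 𝒜 with
      | zero => simp
      | add b b' hb hb' =>
        rw [mul_add, map_add, hb, hb']
        simp only [smul_eq_mul, map_add]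
        ring
      | @homogeneous j b =>
        rw [compLin_of_mem ε _ (SetLike.mul_mem_graded a.2 b.2), compLin_of_mem ε _ a.2,
          compLin_of_mem ε _ b.2]
        simp only [Derivation.coeFn_coe, Derivation.leibniz, smul_eq_mul, map_add]
        rw [add_assoc, gproj_mul_left a.2, show i + (j + ε) = j + (i + ε) by abel,
          gproj_mul_left b.2])

theorem gcomp_of_mem (ε : Γ) (E : Derivation ℂ L L) {δ : Γ} {a : L} (h : a ∈ 𝒜 δ) :
    gcomp 𝒜 ε E a = gproj 𝒜 (δ + ε) (E a) := compLin_of_mem ε _ h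

theorem gcomp_mem (ε : Γ) (E : Derivation ℂ L L) {δ : Γ} {a : L} (h : a ∈ 𝒜 δ) :
    gcomp 𝒜 ε E a ∈ 𝒜 (δ + ε) := by
  rw [gcomp_of_mem ε E h]
  exact gproj_mem 𝒜 _ _

variable (𝒜) in
/-- The derivation `E` has no component of degree greater than `ε`. -/
def DerDegLE (ε : Γ) (E : Derivation ℂ L L) : Prop := ∀ ε', ε < ε' → gcomp 𝒜 ε' E = 0

/-- A nonzero derivation which is determined by finitely many homogeneous elements has a nonzero
component of highest degree. -/
theorem exists_top_gcomp {ι : Type*} [Fintype ι] (g : ι → L) (γ : ι → Γ) (hg : ∀ i, g i ∈ 𝒜 (γ i))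
    (hgen : ∀ E : Derivation ℂ L L, (∀ i, E (g i) = 0) → E = 0) (E : Derivation ℂ L L)
    (hE : E ≠ 0) : ∃ ε, DerDegLE 𝒜 ε E ∧ gcomp 𝒜 ε E ≠ 0 := by
  classical
  have hex : ∃ i, E (g i) ≠ 0 := by
    by_contra! h
    exact hE (hgen E h)
  choose s hs using fun i => exists_finset_gproj_eq_zero (𝒜 := 𝒜) (E (g i))
  set S : Finset Γ := (Finset.univ.biUnion fun i => (s i).image fun δ => δ - γ i) with hS
  have hfin : ∀ ε, gcomp 𝒜 ε E ≠ 0 → ε ∈ S := by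
    intro ε hε
    by_contra h
    apply hε
    apply hgen
    intro i
    rw [gcomp_of_mem ε E (hg i)]
    apply hs
    intro hi
    apply h
    rw [hS, Finset.mem_biUnion]
    exact ⟨i, Finset.mem_univ i, Finset.mem_image.mpr ⟨_, hi, by abel⟩⟩
  have hne : (S.filter fun ε => gcomp 𝒜 ε E ≠ 0).Nonempty := by
    obtain ⟨i, hi⟩ := hex
    obtain ⟨δ, hδ, -⟩ := exists_top (𝒜 := 𝒜) hi
    have : gcomp 𝒜 (δ - γ i) E ≠ 0 := by
      intro h
      apply hδ
      have := gcomp_of_mem (δ - γ i) E (hg i)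
      rw [h, show γ i + (δ - γ i) = δ by abel] at this
      exact this.symm
    exact ⟨_, Finset.mem_filter.mpr ⟨hfin _ this, this⟩⟩
  obtain ⟨ε, hε, hmax⟩ := Finset.exists_max_image _ id hne
  refine ⟨ε, fun ε' hε' => ?_, (Finset.mem_filter.mp hε).2⟩
  by_contra h
  exact absurd hε' (not_lt.mpr (hmax ε' (Finset.mem_filter.mpr ⟨hfin _ h, h⟩)))

variable [IsOrderedAddMonoid Γ]

theorem gproj_apply_of_degLE {E : Derivation ℂ L L} {ε : Γ} (hE : DerDegLE 𝒜 ε E) {γ : Γ} {a : L}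
    (ha : DegLE 𝒜 γ a) : DegLE 𝒜 (γ + ε) (E a) ∧
      gproj 𝒜 (γ + ε) (E a) = gcomp 𝒜 ε E (gproj 𝒜 γ a) := by
  classical
  obtain ⟨s, hs⟩ := sum_gproj (𝒜 := 𝒜) a
  have key : ∀ δ, gproj 𝒜 δ (E a) = ∑ i ∈ s, gcomp 𝒜 (δ - i) E (gproj 𝒜 i a) := by
    intro δ
    conv_lhs => rw [← hs]
    rw [map_sum, map_sum]
    refine Finset.sum_congr rfl fun i _ => ?_
    rw [gcomp_of_mem _ E (gproj_mem 𝒜 i a)]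
    congr 2
    abel
  constructor
  · intro δ hδ
    rw [key]
    refine Finset.sum_eq_zero fun i _ => ?_
    rcases le_or_gt i γ with h | h
    · rw [hE (δ - i)]
      · rfl
      · rw [lt_sub_iff_add_lt, add_comm]
        exact lt_of_le_of_lt (by gcongr) hδ
    · rw [ha i h, map_zero]
  · rw [key]
    have : ∀ i ∈ s, i ≠ γ → gcomp 𝒜 (γ + ε - i) E (gproj 𝒜 i a) = 0 := by
      intro i _ hi
      rcases lt_or_gt_of_ne hi with h | h
      · rw [hE]
        · rfl
        · rw [lt_sub_iff_add_lt, add_comm]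
          gcongr
      · rw [ha i h, map_zero]
    by_cases hγ : γ ∈ s
    · rw [Finset.sum_eq_single_of_mem γ hγ this, add_sub_cancel_left]
    · rw [Finset.sum_eq_zero fun i hi => this i hi (by rintro rfl; exact hγ hi)]
      have : gproj 𝒜 γ a = 0 := by
        rw [← hs, map_sum]
        refine Finset.sum_eq_zero fun i hi => gproj_ne (gproj_mem 𝒜 i a) ?_
        rintro rfl
        exact hγ hi
      rw [this, map_zero]

theorem gproj_iterate {E : Derivation ℂ L L} {ε : Γ} (hE : DerDegLE 𝒜 ε E) {γ : Γ} {a : L}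
    (ha : DegLE 𝒜 γ a) (n : ℕ) : DegLE 𝒜 (γ + n • ε) (E^[n] a) ∧
      gproj 𝒜 (γ + n • ε) (E^[n] a) = (gcomp 𝒜 ε E)^[n] (gproj 𝒜 γ a) := by
  induction n with
  | zero => simpa using ha
  | succ n ih =>
    obtain ⟨h1, h2⟩ := gproj_apply_of_degLE hE ih.1
    rw [Function.iterate_succ_apply', Function.iterate_succ_apply', succ_nsmul, ← add_assoc, ← ih.2]
    exact ⟨h1, h2⟩

theorem IsNilp.gcomp_gproj {E : Derivation ℂ L L} {ε : Γ} (hE : DerDegLE 𝒜 ε E) {γ : Γ} {a : L}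
    (ha : DegLE 𝒜 γ a) (hn : IsNilp E a) : IsNilp (gcomp 𝒜 ε E) (gproj 𝒜 γ a) := by
  obtain ⟨n, hn⟩ := hn
  refine ⟨n, ?_⟩
  rw [← (gproj_iterate hE ha n).2, hn, map_zero]

end Graded

section Base

open MvPolynomial

/-- The polynomial ring `ℂ[x, z, t]`. -/
abbrev Poly3 : Type := MvPolynomial (Fin 3) ℂ

/-- The polynomial ring `ℂ[z, t]`. -/
abbrev Poly2 : Type := MvPolynomial (Fin 2) ℂ

/-- The restriction of polynomials to the plane `x = 0`. -/
noncomputable def ev0 : Poly3 →ₐ[ℂ] Poly2 := aeval ![0, X 0, X 1]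

/-- The inclusion of `ℂ[z, t]` in `ℂ[x, z, t]`. -/
noncomputable def emb : Poly2 →ₐ[ℂ] Poly3 := rename ![1, 2]

@[simp] theorem ev0_X0 : ev0 (X 0) = 0 := by simp [ev0]
@[simp] theorem ev0_X1 : ev0 (X 1) = X 0 := by simp [ev0]
@[simp] theorem ev0_X2 : ev0 (X 2) = X 1 := by simp [ev0]
@[simp] theorem emb_X0 : emb (X 0) = X 1 := by simp [emb]
@[simp] theorem emb_X1 : emb (X 1) = X 2 := by simp [emb]

@[simp] theorem ev0_emb (h : Poly2) : ev0 (emb h) = h := by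
  have : ev0.comp emb = AlgHom.id ℂ Poly2 := by
    ext i
    fin_cases i <;> simp
  exact DFunLike.congr_fun this h

theorem exists_eq_emb_add (p : Poly3) : ∃ q, p = emb (ev0 p) + X 0 * q := by
  induction p using MvPolynomial.induction_on with
  | C a => exact ⟨0, by simp [← algebraMap_eq]⟩
  | add p q hp hq =>
    obtain ⟨p', hp⟩ := hp
    obtain ⟨q', hq⟩ := hq
    exact ⟨p' + q', by simp only [map_add]; linear_combination hp + hq⟩
  | mul_X p i hp =>
    obtain ⟨p', hp⟩ := hp
    have h : ∀ i : Fin 3, ∃ q : Poly3, X i = emb (ev0 (X i)) + X 0 * q := by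
      intro i
      fin_cases i
      · exact ⟨1, by simp⟩
      · exact ⟨0, by simp⟩
      · exact ⟨0, by simp⟩
    obtain ⟨q, hq⟩ := h i
    refine ⟨p' * X i + emb (ev0 p) * q, ?_⟩
    rw [map_mul, map_mul]
    linear_combination X i * hp + emb (ev0 p) * hq

theorem ev0_eq_zero_iff {p : Poly3} : ev0 p = 0 ↔ X 0 ∣ p := by
  constructor
  · intro h
    obtain ⟨q, hq⟩ := exists_eq_emb_add p
    rw [h, map_zero, zero_add] at hq
    exact ⟨q, hq⟩
  · rintro ⟨q, rfl⟩
    simp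

theorem exists_X0_pow_mul {p : Poly3} (hp : p ≠ 0) : ∃ n q, p = X 0 ^ n * q ∧ ev0 q ≠ 0 := by
  obtain ⟨n, q, hq, h⟩ := WfDvdMonoid.max_power_factor hp (X_prime (i := (0 : Fin 3))).irreducible
  exact ⟨n, q, h, fun h' => hq (ev0_eq_zero_iff.mp h')⟩

variable (d : ℕ) (f : Poly3)

/-- The inclusion of `ℂ[x, z, t]` in the coordinate ring. -/
noncomputable def incl : Poly3 →ₐ[ℂ] CoordinateRing d f :=
  (Ideal.Quotient.mkₐ ℂ _).comp (rename ![0, 2, 3])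

/-- The coordinate function `y`. -/
noncomputable def yCoord : CoordinateRing d f := Ideal.Quotient.mk _ (X 1)

variable {d f}

theorem incl_apply (p : Poly3) :
    incl d f p = Ideal.Quotient.mk (Ideal.span {equation d f}) (rename ![0, 2, 3] p) := rfl

theorem incl_X0_pow_mul_yCoord : incl d f (X 0) ^ d * yCoord d f = - incl d f f := by
  rw [eq_neg_iff_add_eq_zero]
  have : (Ideal.Quotient.mk (Ideal.span {equation d f})) 
      (X 0 ^ d * X 1 + rename ![0, 2, 3] f) = 0 :=
    Ideal.Quotient.eq_zero_iff_mem.mpr (Ideal.mem_span_singleton_self _)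
  rw [← this]
  rw [map_add, map_mul, map_pow, incl_apply, incl_apply, rename_X]
  rfl

theorem coordinateRing_induction {P : CoordinateRing d f → Prop} (hincl : ∀ p, P (incl d f p))
    (hy : P (yCoord d f)) (hadd : ∀ a b, P a → P b → P (a + b))
    (hmul : ∀ a b, P a → P b → P (a * b)) (a : CoordinateRing d f) : P a := by
  obtain ⟨a, rfl⟩ := Ideal.Quotient.mk_surjective a
  induction a using MvPolynomial.induction_on with
  | C c =>
    have := hincl (C c)
    rwa [incl_apply, rename_C] at this
  | add p q hp hq => rw [map_add]; exact hadd _ _ hp hq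
  | mul_X p i hp =>
    rw [map_mul]
    refine hmul _ _ hp ?_
    fin_cases i
    · convert hincl (X 0); simp [incl_apply]
    · exact hy
    · convert hincl (X 1); simp [incl_apply]
    · convert hincl (X 2); simp [incl_apply]

theorem coordinateRing_algHom_ext {B : Type*} [CommRing B] [Algebra ℂ B]
    {φ ψ : CoordinateRing d f →ₐ[ℂ] B} (hincl : ∀ p, φ (incl d f p) = ψ (incl d f p))
    (hy : φ (yCoord d f) = ψ (yCoord d f)) : φ = ψ := by
  ext a
  induction a using coordinateRing_induction with
  | hincl p => exact hincl p
  | hy => exact hy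
  | hadd a b ha hb => rw [map_add, map_add, ha, hb]
  | hmul a b ha hb => rw [map_mul, map_mul, ha, hb]

/-- Homomorphisms out of the coordinate ring. -/
noncomputable def coordinateRingLift {B : Type*} [CommRing B] [Algebra ℂ B] (φ : Poly3 →ₐ[ℂ] B)
    (y : B) (h : φ (X 0) ^ d * y + φ f = 0) : CoordinateRing d f →ₐ[ℂ] B :=
  Ideal.Quotient.liftₐ _ (aeval ![φ (X 0), y, φ (X 1), φ (X 2)]) (by
    have key : (aeval ![φ (X 0), y, φ (X 1), φ (X 2)]).comp (rename ![0, 2, 3]) = φ := by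
      ext i
      fin_cases i <;> simp
    intro a ha
    rw [Ideal.mem_span_singleton] at ha
    obtain ⟨b, rfl⟩ := ha
    have h2 : aeval ![φ (X 0), y, φ (X 1), φ (X 2)] (rename ![0, 2, 3] f) = φ f :=
      DFunLike.congr_fun key f
    rw [map_mul, equation, map_add, map_mul, map_pow, h2]
    simp [h])

theorem coordinateRingLift_mk {B : Type*} [CommRing B] [Algebra ℂ B] (φ : Poly3 →ₐ[ℂ] B)
    (y : B) (h : φ (X 0) ^ d * y + φ f = 0) (q : MvPolynomial (Fin 4) ℂ) :
    coordinateRingLift φ y h (Ideal.Quotient.mk (Ideal.span {equation d f}) q) =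
      aeval ![φ (X 0), y, φ (X 1), φ (X 2)] q := rfl

@[simp] theorem coordinateRingLift_incl {B : Type*} [CommRing B] [Algebra ℂ B] (φ : Poly3 →ₐ[ℂ] B)
    (y : B) (h : φ (X 0) ^ d * y + φ f = 0) (p : Poly3) :
    coordinateRingLift φ y h (incl d f p) = φ p := by
  have : (coordinateRingLift φ y h).comp (incl d f) = φ := by
    ext i
    fin_cases i <;> simp [incl_apply, coordinateRingLift_mk]
  exact DFunLike.congr_fun this p

@[simp] theorem coordinateRingLift_yCoord {B : Type*} [CommRing B] [Algebra ℂ B]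
    (φ : Poly3 →ₐ[ℂ] B) (y : B) (h : φ (X 0) ^ d * y + φ f = 0) :
    coordinateRingLift φ y h (yCoord d f) = y := by
  simp [yCoord, coordinateRingLift_mk]

theorem X0_dvd_of_dvd_equation_mul (hd : d ≠ 0) (hf : ev0 f ≠ 0) {h : MvPolynomial (Fin 4) ℂ}
    (hdvd : X 0 ∣ equation d f * h) : X 0 ∣ h := by
  refine ((X_prime (i := (0 : Fin 4)) (R := ℂ)).dvd_or_dvd hdvd).resolve_left ?_
  rintro ⟨q, hq⟩
  apply hf
  have h1 := congrArg (aeval ![(0 : Poly2), 0, X 0, X 1]) hq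
  have key : (aeval ![(0 : Poly2), 0, X 0, X 1]).comp (rename ![0, 2, 3]) = ev0 := by
    ext i
    fin_cases i <;> simp
  have h2 : aeval ![(0 : Poly2), 0, X 0, X 1] (rename ![0, 2, 3] f) = ev0 f :=
    DFunLike.congr_fun key f
  rw [equation, map_add, h2] at h1
  simpa [hd] using h1

theorem eq_zero_of_X0_mul (hd : d ≠ 0) (hf : ev0 f ≠ 0) {a : CoordinateRing d f}
    (h : incl d f (X 0) * a = 0) : a = 0 := by
  obtain ⟨a, rfl⟩ := Ideal.Quotient.mk_surjective a
  have h1 : incl d f (X 0) = Ideal.Quotient.mk _ (X 0) := by simp [incl_apply]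
  rw [h1, ← map_mul, Ideal.Quotient.eq_zero_iff_mem, Ideal.mem_span_singleton] at h
  obtain ⟨b, hb⟩ := h
  obtain ⟨b', rfl⟩ := X0_dvd_of_dvd_equation_mul hd hf ⟨a, hb.symm⟩
  rw [Ideal.Quotient.eq_zero_iff_mem, Ideal.mem_span_singleton]
  refine ⟨b', mul_left_cancel₀ (X_ne_zero 0) (hb.trans ?_)⟩
  ring

theorem eq_zero_of_X0_pow_mul (hd : d ≠ 0) (hf : ev0 f ≠ 0) (n : ℕ) {a : CoordinateRing d f}
    (h : incl d f (X 0) ^ n * a = 0) : a = 0 := by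
  induction n with
  | zero => simpa using h
  | succ n ih =>
    apply ih
    apply eq_zero_of_X0_mul hd hf
    rw [← h]
    ring

/-- The ideal `(x ^ d, f)`. -/
noncomputable def centerIdeal (d : ℕ) (f : Poly3) : Ideal Poly3 := Ideal.span {X 0 ^ d, f}

theorem X0_pow_mem_centerIdeal : (X 0 ^ d : Poly3) ∈ centerIdeal d f :=
  Ideal.subset_span (by simp)

theorem self_mem_centerIdeal : f ∈ centerIdeal d f :=
  Ideal.subset_span (by simp)

theorem mem_centerIdeal {p : Poly3} : p ∈ centerIdeal d f ↔ ∃ a b, p = a * X 0 ^ d + b * f := by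
  simp only [centerIdeal, Ideal.mem_span_pair, eq_comm]

theorem mem_centerIdeal_pow_succ {B : ℕ} : ∀ {u : Poly3}, u ∈ centerIdeal d f ^ (B + 1) →
    ∃ q, ∃ v ∈ centerIdeal d f ^ B, u = f ^ (B + 1) * q + X 0 ^ d * v := by
  induction B with
  | zero =>
    intro u hu
    rw [zero_add, pow_one, mem_centerIdeal] at hu
    obtain ⟨a, b, rfl⟩ := hu
    exact ⟨b, a, by simp, by ring⟩
  | succ B ih =>
    intro u hu
    rw [pow_succ'] at hu
    refine Submodule.mul_induction_on hu ?_ ?_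
    · intro m hm n hn
      obtain ⟨a, b, rfl⟩ := mem_centerIdeal.mp hm
      obtain ⟨q, v, hv, rfl⟩ := ih hn
      refine ⟨b * q, a * (f ^ (B + 1) * q + X 0 ^ d * v) + b * f * v, ?_, by ring⟩
      refine add_mem (Ideal.mul_mem_left _ _ hn) ?_
      rw [mul_assoc, pow_succ']
      exact Ideal.mul_mem_left _ _ (Ideal.mul_mem_mul self_mem_centerIdeal hv)
    · rintro x y ⟨q, v, hv, rfl⟩ ⟨q', v', hv', rfl⟩
      exact ⟨q + q', v + v', add_mem hv hv', by ring⟩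

theorem exists_pow_mul_eq_incl (a : CoordinateRing d f) :
    ∃ B, ∃ u ∈ centerIdeal d f ^ B, incl d f (X 0) ^ (d * B) * a = incl d f u := by
  induction a using coordinateRing_induction with
  | hincl p => exact ⟨0, p, by simp, by simp⟩
  | hy => exact ⟨1, -f, by simpa using self_mem_centerIdeal, by simp [incl_X0_pow_mul_yCoord]⟩
  | hadd a b ha hb =>
    obtain ⟨B, u, hu, h⟩ := ha
    obtain ⟨B', u', hu', h'⟩ := hb
    refine ⟨B + B', (X 0 ^ d) ^ B' * u + (X 0 ^ d) ^ B * u', ?_, ?_⟩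
    · refine add_mem ?_ ?_
      · rw [add_comm, pow_add]
        exact Ideal.mul_mem_mul (Ideal.pow_mem_pow X0_pow_mem_centerIdeal _) hu
      · rw [pow_add]
        exact Ideal.mul_mem_mul (Ideal.pow_mem_pow X0_pow_mem_centerIdeal _) hu'
    · simp only [map_add, map_mul, map_pow, ← h, ← h']
      ring
  | hmul a b ha hb =>
    obtain ⟨B, u, hu, h⟩ := ha
    obtain ⟨B', u', hu', h'⟩ := hb
    refine ⟨B + B', u * u', ?_, ?_⟩
    · rw [pow_add]
      exact Ideal.mul_mem_mul hu hu'
    · simp only [map_mul, ← h, ← h']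
      ring

/-- Divisibility by powers of `ev0 f` of the leading terms of elements of `(x ^ d, f) ^ B`. -/
theorem pow_dvd_ev0 (hd : d ≠ 0) (hf : ev0 f ≠ 0) (c : ℕ) : ∀ (B i m : ℕ) (q v p : Poly3), i < d →
    v ∈ centerIdeal d f ^ B → X 0 ^ c * p = f ^ (B + 1) * q + X 0 ^ (d - i) * v →
    d * m + c + i < d * (B + 1) + d → ev0 f ^ m ∣ ev0 p := by
  induction c with
  | zero =>
    intro B i m q v p hi hv h hm
    have hmB : m < B + 2 := by
      by_contra hcon
      have := Nat.mul_le_mul_left d (not_lt.mp hcon)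
      nlinarith
    have h1 := congrArg ev0 h
    have h2 : d - i ≠ 0 := by omega
    simp only [pow_zero, one_mul, map_add, map_mul, map_pow, ev0_X0, zero_pow h2, zero_mul,
      add_zero] at h1
    rw [h1]
    exact (pow_dvd_pow _ (by omega)).mul_right _
  | succ c ih =>
    intro B i m q v p hi hv h hm
    have h1 := congrArg ev0 h
    have h2 : d - i ≠ 0 := by omega
    simp only [map_add, map_mul, map_pow, ev0_X0, zero_pow h2, zero_mul, add_zero, ne_eq,
      Nat.succ_ne_zero, not_false_eq_true, zero_pow] at h1
    have h3 : ev0 q = 0 := (mul_eq_zero.mp h1.symm).resolve_left (pow_ne_zero _ hf)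
    obtain ⟨q, rfl⟩ := ev0_eq_zero_iff.mp h3
    have h4 : X 0 ^ c * p = f ^ (B + 1) * q + X 0 ^ (d - (i + 1)) * v := by
      apply mul_left_cancel₀ (X_ne_zero (R := ℂ) (0 : Fin 3))
      have : X 0 ^ (d - i) = X 0 * (X 0 ^ (d - (i + 1)) : Poly3) := by
        rw [← pow_succ']
        congr 1
        omega
      rw [this] at h
      linear_combination h
    rcases Nat.lt_or_ge (i + 1) d with hi' | hi'
    · exact ih B (i + 1) m q v p hi' hv h4 (by omega)
    · obtain rfl : d = i + 1 := by omega
      rw [Nat.sub_self, pow_zero, one_mul] at h4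
      rcases B with _ | B
      · obtain rfl : m = 0 := by
          by_contra hm0
          have := Nat.mul_le_mul_left (i + 1) (Nat.one_le_iff_ne_zero.mpr hm0)
          omega
        simp
      · have hmem : f ^ (B + 1 + 1) * q + v ∈ centerIdeal (i + 1) f ^ (B + 1) := by
          refine add_mem ?_ hv
          rw [pow_succ f, mul_assoc]
          exact Ideal.mul_mem_right _ _ (Ideal.pow_mem_pow self_mem_centerIdeal _)
        obtain ⟨q', v', hv', h5⟩ := mem_centerIdeal_pow_succ hmem
        refine ih B 0 m q' v' p (by omega) hv' (by rw [h4, h5]; simp) ?_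
        nlinarith

/-- If `x ^ N * a` is a polynomial `p`, with `N > 0`, then the restriction of `p` to `x = 0` is
divisible by `(ev0 f) ^ ⌈N / d⌉`. -/
theorem pow_dvd_ev0_of_eq_incl (hd : d ≠ 0) (hf : ev0 f ≠ 0)
    (hinj : Function.Injective (incl d f)) {a : CoordinateRing d f} {N : ℕ} {p : Poly3}
    (h : incl d f (X 0) ^ N * a = incl d f p) {m : ℕ} (hm : d * m < N + d) :
    ev0 f ^ m ∣ ev0 p := by
  obtain ⟨B, u, hu, hB⟩ := exists_pow_mul_eq_incl a
  obtain ⟨B, u, hu, hB, hN⟩ : ∃ B, ∃ u ∈ centerIdeal d f ^ (B + 1),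
      incl d f (X 0) ^ (d * (B + 1)) * a = incl d f u ∧ N ≤ d * (B + 1) := by
    refine ⟨B + N, (X 0 ^ d) ^ (N + 1) * u, ?_, ?_, ?_⟩
    · rw [show B + N + 1 = N + 1 + B by ring, pow_add]
      exact Ideal.mul_mem_mul (Ideal.pow_mem_pow X0_pow_mem_centerIdeal _) hu
    · rw [map_mul, ← hB, map_pow, map_pow]
      ring
    · have := Nat.one_le_iff_ne_zero.mpr hd
      nlinarith
  obtain ⟨q, v, hv, rfl⟩ := mem_centerIdeal_pow_succ hu
  refine pow_dvd_ev0 hd hf (d * (B + 1) - N) B 0 m q v p (by omega) hv ?_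
    (by have := Nat.sub_add_cancel hN; omega)
  apply hinj
  rw [Nat.sub_zero, ← hB, map_mul, ← h, ← mul_assoc, map_pow, ← pow_add,
    Nat.sub_add_cancel hN]

end Base

section Laurent

open MvPolynomial

/-- The ring `ℂ[x, x⁻¹, z, t]`. -/
abbrev Laur : Type := AddMonoidAlgebra ℂ (ℤ × ℕ × ℕ)

/-- The monomial `x ^ n * z ^ i * t ^ j`. -/
noncomputable def lmon (n : ℤ) (i j : ℕ) : Laur := AddMonoidAlgebra.single (n, i, j) 1

theorem lmon_mul (n n' : ℤ) (i i' j j' : ℕ) :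
    lmon n i j * lmon n' i' j' = lmon (n + n') (i + i') (j + j') := by
  simp [lmon, AddMonoidAlgebra.single_mul_single]

theorem lmon_zero : lmon 0 0 0 = 1 := rfl

theorem lmon_pow (n : ℤ) (i j m : ℕ) : lmon n i j ^ m = lmon (m * n) (m * i) (m * j) := by
  simp [lmon, AddMonoidAlgebra.single_pow]

theorem lmon_eq (n : ℤ) (i j : ℕ) : lmon n i j = lmon n 0 0 * lmon 0 1 0 ^ i * lmon 0 0 1 ^ j := by
  simp [lmon_pow, lmon_mul]

theorem smul_lmon (n : ℤ) (i j : ℕ) (c : ℂ) :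
    (AddMonoidAlgebra.single (n, i, j) c : Laur) = c • lmon n i j := by
  simp [lmon]

theorem laur_induction {P : Laur → Prop} (a : Laur) (hadd : ∀ a b, P a → P b → P (a + b))
    (hmon : ∀ (c : ℂ) n i j, P (c • lmon n i j)) : P a := by
  induction a using AddMonoidAlgebra.induction_linear with
  | zero => simpa using hmon 0 0 0 0
  | add x y hx hy => exact hadd x y hx hy
  | single m r => exact smul_lmon m.1 m.2.1 m.2.2 r ▸ hmon r m.1 m.2.1 m.2.2

theorem lmon_ne_zero (n : ℤ) (i j : ℕ) : lmon n i j ≠ 0 := by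
  intro h
  have := congrArg AddMonoidAlgebra.coeff h
  simp [lmon] at this

/-- The inclusion of `ℂ[x, z, t]` in `ℂ[x, x⁻¹, z, t]`. -/
noncomputable def toL : Poly3 →ₐ[ℂ] Laur := aeval ![lmon 1 0 0, lmon 0 1 0, lmon 0 0 1]

@[simp] theorem toL_X0 : toL (X 0) = lmon 1 0 0 := by simp [toL]
@[simp] theorem toL_X1 : toL (X 1) = lmon 0 1 0 := by simp [toL]
@[simp] theorem toL_X2 : toL (X 2) = lmon 0 0 1 := by simp [toL]

theorem toL_monomial (m : Fin 3 →₀ ℕ) (c : ℂ) : toL (monomial m c) = c • lmon (m 0) (m 1) (m 2) := by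
  rw [monomial_eq, Finsupp.prod_fintype _ _ (by simp), Fin.prod_univ_three]
  simp only [map_mul, map_pow, toL_X0, toL_X1, toL_X2, lmon_pow, lmon_mul]
  rw [← algebraMap_eq, AlgHom.commutes, ← Algebra.smul_def]
  simp

theorem toL_injective : Function.Injective toL := by
  rw [injective_iff_map_eq_zero]
  intro p hp
  ext m
  have key : ∀ q : Poly3, (toL q).coeff ((m 0 : ℤ), m 1, m 2) = q.coeff m := by
    intro q
    induction q using MvPolynomial.induction_on' with
    | monomial u a =>
      rw [toL_monomial, ← smul_lmon, AddMonoidAlgebra.coeff_single, coeff_monomial,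
        Finsupp.single_apply]
      congr 1
      simp only [Prod.mk.injEq, Nat.cast_inj, eq_iff_iff]
      constructor
      · rintro ⟨h0, h1, h2⟩
        ext i
        fin_cases i <;> assumption
      · rintro rfl
        simp
    | add p q hp hq => simp [hp, hq]
  rw [← key p, hp]
  simp

theorem derivation_laur_eq_zero {E : Derivation ℂ Laur Laur} (hx : E (lmon 1 0 0) = 0)
    (hz : E (lmon 0 1 0) = 0) (ht : E (lmon 0 0 1) = 0) : E = 0 := by
  have hx' : ∀ n : ℤ, E (lmon n 0 0) = 0 := by
    have hpos : ∀ n : ℕ, E (lmon n 0 0) = 0 := by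
      intro n
      have : lmon n 0 0 = lmon 1 0 0 ^ n := by simp [lmon_pow]
      rw [this, E.leibniz_pow, hx]
      simp
    intro n
    obtain ⟨n, rfl | rfl⟩ := n.eq_nat_or_neg
    · exact hpos n
    · have h1 : lmon n 0 0 * lmon (-n) 0 0 = 1 := by rw [lmon_mul, ← lmon_zero]; simp
      have h2 := congrArg E h1
      rw [E.leibniz, hpos, E.map_one_eq_zero, smul_zero, add_zero, smul_eq_mul] at h2
      exact (mul_eq_zero.mp h2).resolve_left (lmon_ne_zero _ _ _)
  refine Derivation.ext fun a => ?_
  rw [Derivation.zero_apply]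
  induction a using laur_induction with
  | hadd a b ha hb => rw [map_add, ha, hb, add_zero]
  | hmon c n i j =>
    rw [lmon_eq]
    simp [E.leibniz_pow, hx', hz, ht]

variable (d : ℕ) (f : Poly3)

/-- The embedding of the coordinate ring in `ℂ[x, x⁻¹, z, t]`. -/
noncomputable def toLaur : CoordinateRing d f →ₐ[ℂ] Laur :=
  coordinateRingLift toL (-(lmon (-d) 0 0 * toL f)) (by
    rw [toL_X0, lmon_pow]
    have : lmon (d * 1 : ℤ) (d * 0) (d * 0) * lmon (-d) 0 0 = 1 := by
      rw [lmon_mul, ← lmon_zero]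
      simp
    linear_combination -toL f * this)

variable {d f}

@[simp] theorem toLaur_incl (p : Poly3) : toLaur d f (incl d f p) = toL p := by
  simp [toLaur]

@[simp] theorem toLaur_yCoord : toLaur d f (yCoord d f) = -(lmon (-d) 0 0 * toL f) := by
  simp [toLaur]

theorem incl_injective : Function.Injective (incl d f) := by
  have : Function.Injective (toLaur d f ∘ incl d f) := by
    intro a b h
    simp only [Function.comp_apply, toLaur_incl] at h
    exact toL_injective h
  exact this.of_comp

theorem toLaur_injective (hd : d ≠ 0) (hf : ev0 f ≠ 0) : Function.Injective (toLaur d f) := by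
  rw [injective_iff_map_eq_zero]
  intro a ha
  obtain ⟨B, u, -, h⟩ := exists_pow_mul_eq_incl a
  have h1 := congrArg (toLaur d f) h
  rw [map_mul, ha, mul_zero, toLaur_incl] at h1
  have h2 : u = 0 := toL_injective (by rw [← h1, map_zero])
  rw [h2, map_zero] at h
  exact eq_zero_of_X0_pow_mul hd hf _ h

end Laurent

section LaurentGrading

open MvPolynomial

variable (k l : ℕ)

/-- The bidegree of monomials: `x` has bidegree `(-1, 0)`, `z` has bidegree `(0, l)` and `t` has
bidegree `(0, k)`. Bidegrees are ordered lexicographically. -/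
def bideg : ℤ × ℕ × ℕ →+ ℤ ×ₗ ℤ where
  toFun g := toLex (-g.1, (l * g.2.1 + k * g.2.2 : ℕ))
  map_zero' := by simp
  map_add' a b := by
    rw [← toLex_add]
    congr 1
    ext
    · simp; ring
    · simp; ring_nf

/-- The grading of `ℂ[x, x⁻¹, z, t]` by bidegrees. -/
abbrev bigrading : ℤ ×ₗ ℤ → Submodule ℂ Laur := AddMonoidAlgebra.gradeBy ℂ (bideg k l)

variable {k l}

theorem lmon_mem (n : ℤ) (i j : ℕ) :
    lmon n i j ∈ bigrading k l (toLex (-n, (l * i + k * j : ℕ))) :=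
  AddMonoidAlgebra.single_mem_gradeBy (R := ℂ) (bideg k l) (n, i, j) 1

theorem toL_emb_monomial (m : Fin 2 →₀ ℕ) (c : ℂ) :
    toL (emb (monomial m c)) = c • lmon 0 (m 0) (m 1) := by
  rw [monomial_eq, Finsupp.prod_fintype _ _ (by simp), Fin.prod_univ_two]
  simp only [map_mul, map_pow, emb_X0, emb_X1, toL_X1, toL_X2, lmon_pow, lmon_mul]
  rw [← algebraMap_eq, AlgHom.commutes, AlgHom.commutes, ← Algebra.smul_def]
  simp

theorem weight_fin_two (m : Fin 2 →₀ ℕ) : Finsupp.weight ![l, k] m = l * m 0 + k * m 1 := by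
  rw [Finsupp.weight_apply, Finsupp.sum_fintype _ _ (by simp)]
  simp [mul_comm]

theorem toL_emb_mem {H : Poly2} {g : ℕ} (hH : IsWeightedHomogeneous ![l, k] H g) :
    toL (emb H) ∈ bigrading k l (toLex (0, g)) := by
  induction hH using IsWeightedHomogeneous.induction_on with
  | zero => simp
  | add p q hp hq h1 h2 => rw [map_add, map_add]; exact add_mem h1 h2
  | monomial m r hr =>
    rw [toL_emb_monomial]
    refine Submodule.smul_mem _ _ ?_
    have := lmon_mem (k := k) (l := l) 0 (m 0) (m 1)
    rwa [← weight_fin_two, hr, neg_zero] at this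

theorem gproj_toL_emb (h : Poly2) (δ : ℤ ×ₗ ℤ) :
    (∃ g : ℕ, δ = toLex (0, (g : ℤ)) ∧ gproj (bigrading k l) δ (toL (emb h)) =
      toL (emb (weightedHomogeneousComponent ![l, k] g h))) ∨
    gproj (bigrading k l) δ (toL (emb h)) = 0 := by
  classical
  by_cases hδ : ∃ g : ℕ, δ = toLex (0, (g : ℤ))
  · obtain ⟨g, rfl⟩ := hδ
    refine .inl ⟨g, rfl, ?_⟩
    induction h using MvPolynomial.induction_on' with
    | monomial m c =>
      have hm := isWeightedHomogeneous_monomial ![l, k] m c rfl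
      by_cases hg : Finsupp.weight ![l, k] m = g
      · rw [hg] at hm
        rw [gproj_same (toL_emb_mem hm), hm.weightedHomogeneousComponent_same]
      · rw [hm.weightedHomogeneousComponent_ne _ (Ne.symm hg), map_zero, map_zero]
        refine gproj_ne (toL_emb_mem hm) ?_
        intro h
        apply hg
        simpa using h
    | add p q hp hq => simp only [map_add, hp, hq]
  · right
    induction h using MvPolynomial.induction_on' with
    | monomial m c =>
      have hm := isWeightedHomogeneous_monomial ![l, k] m c rfl
      refine gproj_ne (toL_emb_mem hm) ?_
      rintro rfl
      exact hδ ⟨_, rfl⟩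
    | add p q hp hq => simp only [map_add, hp, hq, add_zero]

theorem gproj_toL_eq_zero (p : Poly3) {δ : ℤ ×ₗ ℤ} (hδ : 0 < (ofLex δ).1) :
    gproj (bigrading k l) δ (toL p) = 0 := by
  induction p using MvPolynomial.induction_on' with
  | monomial m c =>
    rw [toL_monomial, map_smul, gproj_ne (lmon_mem _ _ _), smul_zero]
    rintro rfl
    simp only [ofLex_toLex, Left.neg_pos_iff] at hδ
    omega
  | add p q hp hq => simp only [map_add, hp, hq, add_zero]

theorem gproj_lmon_mul (n : ℤ) (a : Laur) (δ : ℤ ×ₗ ℤ) :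
    gproj (bigrading k l) δ (lmon n 0 0 * a) =
      lmon n 0 0 * gproj (bigrading k l) (δ - toLex (-n, 0)) a := by
  have h := lmon_mem (k := k) (l := l) n 0 0
  simp only [mul_zero, add_zero, Nat.cast_zero] at h
  conv_lhs => rw [← add_sub_cancel (toLex (-n, (0 : ℤ))) δ]
  rw [gproj_mul_left h]

theorem isWeightedHomogeneous_curvePoly : 
    IsWeightedHomogeneous ![l, k] (curvePoly ℂ k l) (k * l) := by
  have h0 := (isWeightedHomogeneous_X ℂ ![l, k] 0).pow k
  have h1 := (isWeightedHomogeneous_X ℂ ![l, k] 1).pow l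
  simp only [Matrix.cons_val_zero, Matrix.cons_val_one, smul_eq_mul] at h0 h1
  rw [mul_comm] at h1
  exact h0.add h1

variable (k l) in
/-- The initial form of the coordinate function `y`, up to sign. -/
noncomputable def yTop (d : ℕ) : Laur := lmon (-d) 0 0 * toL (emb (curvePoly ℂ k l))

theorem yTop_mem (d : ℕ) : yTop k l d ∈ bigrading k l (toLex ((d : ℤ), (k * l : ℕ))) := by
  have h1 := lmon_mem (k := k) (l := l) (-d) 0 0
  have h2 := SetLike.mul_mem_graded h1 (toL_emb_mem (isWeightedHomogeneous_curvePoly (k := k) (l := l)))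
  rw [← yTop, ← toLex_add] at h2
  simpa using h2

theorem curvePoly_ne_zero : curvePoly ℂ k l ≠ 0 := by
  intro h
  by_cases hl : l = 0
  · have := congrArg (aeval ![(1 : ℂ), 0]) h
    simp [curvePoly, hl] at this
  · have := congrArg (aeval ![(1 : ℂ), 0]) h
    simp [curvePoly, hl] at this

theorem emb_injective : Function.Injective emb :=
  Function.LeftInverse.injective ev0_emb

theorem yTop_ne_zero (d : ℕ) : yTop k l d ≠ 0 := by
  refine mul_ne_zero (lmon_ne_zero _ _ _) ?_
  rw [map_ne_zero_iff _ toL_injective, map_ne_zero_iff _ emb_injective]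
  exact curvePoly_ne_zero

/-- Every element of the coordinate ring is, up to terms of lower degree in `x⁻¹`, of the form
`x ^ j * y ^ m * h(z, t)`. -/
theorem exists_leading {d : ℕ} (hd : d ≠ 0) {f : Poly3} (hf : ev0 f = curvePoly ℂ k l)
    {a : CoordinateRing d f} (ha : a ≠ 0) : ∃ (m j : ℕ) (h : Poly2) (q : Poly3), h ≠ 0 ∧
      toLaur d f a = lmon j 0 0 * yTop k l d ^ m * toL (emb h) +
        lmon ((j : ℤ) - d * m + 1) 0 0 * toL q ∧ (a ∉ Set.range (incl d f) → m ≠ 0) := by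
  have hf0 : ev0 f ≠ 0 := hf ▸ curvePoly_ne_zero
  obtain ⟨B, u, -, hu⟩ := exists_pow_mul_eq_incl a
  generalize d * B = N at hu
  have hu0 : u ≠ 0 := by
    rintro rfl
    rw [map_zero] at hu
    exact ha (eq_zero_of_X0_pow_mul hd hf0 _ hu)
  obtain ⟨e, p, rfl, hp⟩ := exists_X0_pow_mul hu0
  obtain ⟨q, hq⟩ := exists_eq_emb_add p
  rw [map_mul, map_pow] at hu
  rcases le_total N e with h | h
  · obtain ⟨e, rfl⟩ := Nat.exists_eq_add_of_le h
    have ha' : a = incl d f (X 0 ^ e * p) := by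
      rw [← sub_eq_zero]
      apply eq_zero_of_X0_pow_mul hd hf0 N
      rw [mul_sub, hu, map_mul, map_pow]
      ring
    refine ⟨0, e, ev0 p, q, hp, ?_, fun h => absurd ⟨_, ha'.symm⟩ h⟩
    rw [ha', toLaur_incl]
    conv_lhs => rw [hq]
    have : lmon ((e : ℤ) - d * (0 : ℕ) + 1) 0 0 = lmon e 0 0 * lmon 1 0 0 := by
      rw [lmon_mul]
      simp
    rw [this]
    simp only [map_mul, map_pow, map_add, toL_X0, lmon_pow]
    simp
    ring
  · obtain ⟨M, rfl⟩ := Nat.exists_eq_add_of_le h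
    have ha' : incl d f (X 0) ^ M * a = incl d f p := by
      rw [← sub_eq_zero]
      apply eq_zero_of_X0_pow_mul hd hf0 e
      rw [mul_sub, ← hu]
      ring
    set m := (M + d - 1) / d with hm
    have hd' : 0 < d := Nat.pos_of_ne_zero hd
    have hmod := Nat.div_add_mod (M + d - 1) d
    have hmlt := Nat.mod_lt (M + d - 1) hd'
    rw [← hm] at hmod
    obtain ⟨h0, hh0⟩ := pow_dvd_ev0_of_eq_incl hd hf0 incl_injective ha' (m := m) (by omega)
    have hMm : M ≤ d * m := by omega
    refine ⟨m, d * m - M, h0, q, ?_, ?_, ?_⟩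
    · rintro rfl
      exact hp (by rw [hh0, mul_zero])
    · have h1 := congrArg (toLaur d f) ha'
      rw [map_mul, map_pow, toLaur_incl, toLaur_incl, toL_X0, lmon_pow] at h1
      simp only [mul_one, mul_zero] at h1
      have h2 : toLaur d f a = lmon (-M) 0 0 * toL p := by
        rw [← h1, ← mul_assoc, lmon_mul]
        simp [lmon_zero]
      rw [h2, hq, hh0, hf]
      have e1 : lmon (((d * m - M : ℕ) : ℤ) - d * m + 1) 0 0 = lmon (-M) 0 0 * lmon 1 0 0 := by
        rw [lmon_mul]
        congr 1
        push_cast [hMm]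
        ring
      have e2 : lmon ((d * m - M : ℕ) : ℤ) 0 0 * yTop k l d ^ m =
          lmon (-M) 0 0 * toL (emb (curvePoly ℂ k l)) ^ m := by
        rw [yTop, mul_pow, ← mul_assoc, lmon_pow, lmon_mul]
        congr 2
        · push_cast [hMm]
          ring
      rw [e1, e2]
      simp only [map_add, map_mul, map_pow, toL_X0]
      ring
    · intro hrange hm0
      rw [hm0] at hMm
      obtain rfl : M = 0 := by omega
      apply hrange
      exact ⟨p, by rw [← ha']; simp⟩

/-- The initial form of an element of the coordinate ring. -/
theorem exists_initial_form {d : ℕ} (hd : d ≠ 0) {f : Poly3}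
    (hf : ev0 f = curvePoly ℂ k l) {a : CoordinateRing d f} {γ : ℤ ×ₗ ℤ}
    (h0 : gproj (bigrading k l) γ (toLaur d f a) ≠ 0)
    (hγ : DegLE (bigrading k l) γ (toLaur d f a)) : ∃ (m j : ℕ) (H : Poly2) (g : ℕ),
      IsWeightedHomogeneous ![l, k] H g ∧ gproj (bigrading k l) γ (toLaur d f a) =
        lmon j 0 0 * yTop k l d ^ m * toL (emb H) ∧ (a ∉ Set.range (incl d f) → m ≠ 0) := by
  classical
  have ha : a ≠ 0 := by
    rintro rfl
    simp at h0
  obtain ⟨m, j, h, q, hh, hah, hm⟩ := exists_leading hd hf ha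
  set n : ℤ := (j : ℤ) - d * m with hn
  set u : Laur := lmon j 0 0 * yTop k l d ^ m with hu
  obtain ⟨v, huv⟩ : ∃ v : ℤ, u ∈ bigrading k l (toLex (-n, v)) := by
    refine ⟨(m * (k * l) : ℕ), ?_⟩
    have h1 := lmon_mem (k := k) (l := l) j 0 0
    have h2 := SetLike.pow_mem_graded m (yTop_mem (k := k) (l := l) d)
    convert SetLike.mul_mem_graded h1 h2 using 2
    change _ = toLex _ + toLex (m • ((d : ℤ), ((k * l : ℕ) : ℤ)))
    rw [← toLex_add]
    congr 1
    ext
    · simp [hn]; ring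
    · simp
  have hu0 : u ≠ 0 := mul_ne_zero (lmon_ne_zero _ _ _) (pow_ne_zero _ (yTop_ne_zero d))
  have hproj : ∀ δ : ℤ ×ₗ ℤ, -n ≤ (ofLex δ).1 → gproj (bigrading k l) δ (toLaur d f a) =
      u * gproj (bigrading k l) (δ - toLex (-n, v)) (toL (emb h)) := by
    intro δ hδ
    rw [hah, map_add, gproj_lmon_mul, gproj_toL_eq_zero q, mul_zero, add_zero]
    · conv_lhs => rw [← add_sub_cancel (toLex (-n, v)) δ]
      rw [gproj_mul_left huv]
    · have : (ofLex (δ - toLex (-(n + 1), (0 : ℤ)))).1 = (ofLex δ).1 + (n + 1) := by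
        simp only [ofLex_sub, ofLex_toLex, Prod.fst_sub]
        ring
      rw [this]
      omega
  refine ⟨m, j, ?_⟩
  rcases le_or_gt (-n) (ofLex γ).1 with hle | hlt
  · rw [hproj γ hle] at h0 ⊢
    rcases gproj_toL_emb (k := k) (l := l) h (γ - toLex (-n, v)) with ⟨g, -, hg⟩ | hz
    · exact ⟨_, g, weightedHomogeneousComponent_isWeightedHomogeneous _ _, by rw [hg], hm⟩
    · rw [hz, mul_zero] at h0
      exact absurd rfl h0
  · exfalso
    have hex : ∃ δ, gproj (bigrading k l) δ (toL (emb h)) ≠ 0 := by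
      by_contra! hcon
      have := eq_zero_of_gproj hcon
      rw [map_eq_zero_iff _ toL_injective, map_eq_zero_iff _ emb_injective] at this
      exact hh this
    obtain ⟨δ, hδ⟩ := hex
    rcases gproj_toL_emb (k := k) (l := l) h δ with ⟨g, rfl, -⟩ | hz
    · have h3 := hproj (toLex (-n, v) + toLex (0, (g : ℤ))) (by simp)
      rw [add_sub_cancel_left] at h3
      refine mul_ne_zero hu0 hδ (h3.symm.trans (hγ _ ?_))
      rw [Prod.Lex.lt_iff]
      left
      simpa using hlt
    · exact hδ hz

end LaurentGrading

section Factor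

open MvPolynomial

theorem X_dvd_of_forall_mem_support {σ : Type*} {H : MvPolynomial σ ℂ} {i : σ}
    (h : ∀ m ∈ H.support, m i ≠ 0) : X i ∣ H := by
  rw [H.as_sum]
  exact Finset.dvd_sum fun m hm => X_dvd_monomial.mpr (.inr (h m hm))

theorem monomial_fin_two (m : Fin 2 →₀ ℕ) (c : ℂ) :
    (monomial m c : Poly2) = C c * (X 0 ^ m 0 * X 1 ^ m 1) := by
  rw [monomial_eq, Finsupp.prod_fintype _ _ (by simp), Fin.prod_univ_two]

/-- Quasi-homogeneous polynomials in two variables have a factor `z`, `t` or `z ^ k - c * t ^ l`. -/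
theorem exists_factor {k l g : ℕ} (hk : 0 < k) (hl : 0 < l) (hkl : Nat.Coprime k l) {H : Poly2}
    (hH : IsWeightedHomogeneous ![l, k] H g) (hc : ∀ c, H ≠ C c) :
    X 0 ∣ H ∨ X 1 ∣ H ∨ ∃ c : ℂ, c ≠ 0 ∧ X 0 ^ k - C c * X 1 ^ l ∣ H := by
  by_contra! hcon
  obtain ⟨hz, ht, hcon⟩ := hcon
  have hwt : ∀ m ∈ H.support, l * m 0 + k * m 1 = g := fun m hm => by
    rw [← weight_fin_two]
    exact hH (mem_support_iff.mp hm)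
  obtain ⟨m0, hm0, hm0z⟩ : ∃ m ∈ H.support, m 0 = 0 := by
    by_contra! h
    exact hz (X_dvd_of_forall_mem_support h)
  obtain ⟨m1, hm1, hm1t⟩ : ∃ m ∈ H.support, m 1 = 0 := by
    by_contra! h
    exact ht (X_dvd_of_forall_mem_support h)
  have e0 := hwt m0 hm0
  have e1 := hwt m1 hm1
  rw [hm0z, mul_zero, zero_add] at e0
  rw [hm1t, mul_zero, add_zero] at e1
  obtain ⟨s, hs⟩ : l ∣ m0 1 := by
    refine hkl.symm.dvd_of_dvd_mul_left (m := k) ⟨m1 0, ?_⟩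
    rw [e0, e1]
  have hgs : g = k * l * s := by rw [← e0, hs]; ring
  have hdiv : ∀ m ∈ H.support, ∃ r, r ≤ s ∧ m 0 = k * r ∧ m 1 = l * (s - r) := by
    intro m hm
    have e := hwt m hm
    obtain ⟨r, hr⟩ : k ∣ m 0 := by
      refine hkl.dvd_of_dvd_mul_left (m := l) ?_
      rw [← Nat.dvd_add_left (dvd_mul_right k (m 1)), e, hgs, mul_assoc]
      exact dvd_mul_right _ _
    have e' : k * (l * r + m 1) = k * (l * s) := by
      rw [← mul_assoc, ← hgs, ← e, hr]
      ring
    have e'' := Nat.eq_of_mul_eq_mul_left hk e'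
    have hrs : r ≤ s := by
      refine Nat.le_of_mul_le_mul_left ?_ hl
      omega
    refine ⟨r, hrs, hr, ?_⟩
    rw [Nat.mul_sub]
    omega
  have hinj : ∀ m ∈ H.support, ∀ m' ∈ H.support, m 0 = m' 0 → m = m' := by
    intro m hm m' hm' h
    have e := hwt m hm
    rw [← hwt m' hm', h] at e
    ext i
    fin_cases i
    · exact h
    · exact Nat.eq_of_mul_eq_mul_left hk (by simpa using e)
  set G : Polynomial ℂ := ∑ m ∈ H.support, Polynomial.monomial (m 0) (H.coeff m) with hG
  have hGc : ∀ m ∈ H.support, G.coeff (m 0) = H.coeff m := by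
    intro m hm
    rw [hG, Polynomial.finsetSum_coeff, Finset.sum_eq_single_of_mem m hm]
    · simp
    · intro m' hm' hne
      rw [Polynomial.coeff_monomial, if_neg]
      exact fun h => hne (hinj m' hm' m hm h)
  have hm1z : m1 0 ≠ 0 := by
    intro h
    have hg0 : g = 0 := by rw [← e1, h, mul_zero]
    apply hc (H.coeff 0)
    ext m
    rw [coeff_C]
    split_ifs with hm
    · rw [hm]
    · by_contra hne
      have e := hwt m (mem_support_iff.mpr hne)
      rw [hg0] at e
      apply hm
      ext i
      have h0 : m 0 = 0 := by
        by_contra h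
        have := Nat.mul_pos hl (Nat.pos_of_ne_zero h)
        omega
      have h1 : m 1 = 0 := by
        by_contra h
        have := Nat.mul_pos hk (Nat.pos_of_ne_zero h)
        omega
      fin_cases i
      · exact h0.symm
      · exact h1.symm
  have hdeg : G.degree ≠ 0 := by
    intro h
    have := Polynomial.coeff_eq_zero_of_degree_lt (p := G) (n := m1 0) (by
      rw [h]
      exact_mod_cast Nat.pos_of_ne_zero hm1z)
    rw [hGc m1 hm1] at this
    exact mem_support_iff.mp hm1 this
  obtain ⟨ζ, hζ⟩ := IsAlgClosed.exists_root G hdeg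
  have hζ0 : ζ ≠ 0 := by
    rintro rfl
    rw [Polynomial.IsRoot, ← Polynomial.coeff_zero_eq_eval_zero, ← hm0z, hGc m0 hm0] at hζ
    exact mem_support_iff.mp hm0 hζ
  apply hcon (ζ ^ k) (pow_ne_zero _ hζ0)
  have hmod : ∀ m ∈ H.support, X 0 ^ k - C (ζ ^ k) * X 1 ^ l ∣
      monomial m (H.coeff m) - C (H.coeff m * ζ ^ m 0) * (X 1 : Poly2) ^ (l * s) := by
    intro m hm
    obtain ⟨r, hr, hr0, hr1⟩ := hdiv m hm
    have h1 : (X 1 : Poly2) ^ (l * s) = (X 1 ^ l) ^ r * X 1 ^ m 1 := by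
      rw [hr1, ← pow_mul, ← pow_add, ← Nat.mul_add, Nat.add_sub_cancel' hr]
    have h2 : monomial m (H.coeff m) - C (H.coeff m * ζ ^ m 0) * (X 1 : Poly2) ^ (l * s) =
        C (H.coeff m) * X 1 ^ m 1 * ((X 0 ^ k) ^ r - (C (ζ ^ k) * X 1 ^ l) ^ r) := by
      rw [monomial_fin_two, h1, hr0, C_mul, pow_mul, pow_mul, mul_pow]
      simp only [C_pow]
      ring
    rw [h2]
    exact (sub_dvd_pow_sub_pow _ _ _).mul_left _
  have hsum := Finset.dvd_sum hmod
  rw [Finset.sum_sub_distrib, ← H.as_sum, ← Finset.sum_mul, ← map_sum] at hsum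
  have hev : ∑ m ∈ H.support, H.coeff m * ζ ^ m 0 = 0 := by
    rw [← hζ.eq_zero, hG, Polynomial.eval_finsetSum]
    simp
  rwa [hev, map_zero, zero_mul, sub_zero] at hsum

end Factor

section HomogeneousDerivation

open MvPolynomial

variable {d k l : ℕ}

theorem lmon_X0_pow_mul_yTop : lmon 1 0 0 ^ d * yTop k l d = lmon 0 1 0 ^ k + lmon 0 0 1 ^ l := by
  rw [yTop, ← mul_assoc, lmon_pow, lmon_mul]
  have : lmon ((d : ℤ) * 1 + -d) (d * 0 + 0) (d * 0 + 0) = 1 := by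
    rw [← lmon_zero]
    simp
  rw [this, one_mul]
  simp [curvePoly]

theorem lmon_one_pow (n : ℕ) : lmon 1 0 0 ^ n = lmon n 0 0 := by
  simp [lmon_pow]

/-- The quasi-homogeneous coordinate ring `ℂ[x, y, z, t] / (x ^ d * y + z ^ k + t ^ l)`. -/
abbrev HomRing (d k l : ℕ) : Type := CoordinateRing d (emb (curvePoly ℂ k l))

theorem yTop_eq : yTop k l d = toLaur d (emb (curvePoly ℂ k l)) (-yCoord d _) := by
  simp [yTop]

/-- The point `x = z = 1`, `t = 0`. -/
noncomputable def evalPt : Laur →ₐ[ℂ] ℂ :=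
  AddMonoidAlgebra.lift ℂ ℂ (ℤ × ℕ × ℕ)
    { toFun := fun g => 0 ^ g.toAdd.2.2
      map_one' := by simp
      map_mul' := fun a b => by simp [pow_add] }

theorem evalPt_lmon (n : ℤ) (i j : ℕ) : evalPt (lmon n i j) = 0 ^ j := by
  simp [evalPt, lmon]

theorem evalPt_yTop (hl : l ≠ 0) : evalPt (yTop k l d) = 1 := by
  simp [yTop, curvePoly, evalPt_lmon, hl]

theorem homogeneousDerivation_eq_zero (hd : 2 ≤ d) (hk : 2 ≤ k) (hl : 2 ≤ l)
    (hkl : Nat.Coprime k l) {E : Derivation ℂ Laur Laur} {ε : ℤ ×ₗ ℤ}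
    (hE : ∀ γ a, a ∈ bigrading k l γ → E a ∈ bigrading k l (γ + ε))
    (hx : IsNilp E (lmon 1 0 0)) (hz : IsNilp E (lmon 0 1 0)) (ht : IsNilp E (lmon 0 0 1))
    (hy : E (yTop k l d) = 0)
    (hA : ∀ a : HomRing d k l, ∃ b : HomRing d k l, E (toLaur d _ a) = toLaur d _ b) : E = 0 := by
  have hy0 : yTop k l d ≠ 0 := yTop_ne_zero d
  have hx0 := lmon_ne_zero 1 0 0
  have hz0 := lmon_ne_zero 0 1 0
  have ht0 := lmon_ne_zero 0 0 1
  have hxy := lmon_X0_pow_mul_yTop (d := d) (k := k) (l := l)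
  by_contra hE0
  have kill_zt : ¬(E (lmon 0 1 0) = 0 ∧ E (lmon 0 0 1) = 0) := by
    rintro ⟨h1, h2⟩
    apply hE0
    refine derivation_laur_eq_zero ?_ h1 h2
    have h3 := congrArg E hxy
    rw [map_add, E.leibniz, E.leibniz_pow, E.leibniz_pow, E.leibniz_pow, hy, h1, h2] at h3
    have hd' : ((d : ℕ) : Laur) ≠ 0 := by
      have := charZero_of_injective_algebraMap (algebraMap ℂ Laur).injective
      exact Nat.cast_ne_zero.mpr (by omega)
    simpa [hd', hx0, hy0] using h3
  have kill_curve : ∀ c : ℂ, c ≠ 0 → E (1 * lmon 0 1 0 ^ k + algebraMap ℂ Laur c * lmon 0 0 1 ^ l)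
      = 0 → False := by
    intro c hc h
    have hc' : algebraMap ℂ Laur c ≠ 0 := by
      rwa [map_ne_zero_iff _ (algebraMap ℂ Laur).injective]
    refine kill_zt (apply_eq_zero_of_sum_pow hk hl hz ht (E.map_algebraMap c) E.map_one_eq_zero hc'
      one_ne_zero ?_ h)
    intro h'
    have := congrArg evalPt h'
    simp [evalPt_lmon, show l ≠ 0 by omega] at this
  have kill_x : E (lmon 1 0 0) ≠ 0 := by
    intro h
    apply kill_curve 1 one_ne_zero
    rw [map_one, one_mul, one_mul, ← hxy, E.leibniz, E.leibniz_pow, hy, h]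
    simp
  have kill_z : E (lmon 0 1 0) ≠ 0 := by
    intro h
    have h1 : yTop k l d * lmon 1 0 0 ^ d + (-1) * lmon 0 0 1 ^ l = lmon 0 1 0 ^ k := by
      linear_combination hxy
    refine kill_x (apply_eq_zero_of_sum_pow hd hl hx ht (by rw [map_neg, E.map_one_eq_zero, neg_zero]) hy (by simp) hy0 ?_ ?_).1
    · rw [h1]
      exact pow_ne_zero _ hz0
    · rw [h1, E.leibniz_pow, h]
      simp
  have kill_t : E (lmon 0 0 1) ≠ 0 := by
    intro h
    have h1 : yTop k l d * lmon 1 0 0 ^ d + (-1) * lmon 0 1 0 ^ k = lmon 0 0 1 ^ l := by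
      linear_combination hxy
    refine kill_x (apply_eq_zero_of_sum_pow hd hk hx hz (by rw [map_neg, E.map_one_eq_zero, neg_zero]) hy (by simp) hy0 ?_ ?_).1
    · rw [h1]
      exact pow_ne_zero _ ht0
    · rw [h1, E.leibniz_pow, h]
      simp
  have hynil : IsNilp E (yTop k l d) := .of_apply_eq_zero hy
  have hnilp : ∀ p : Poly3, IsNilp E (toL p) := by
    intro p
    rw [← mem_nilpSubalgebra]
    induction p using MvPolynomial.induction_on with
    | C a => rw [← algebraMap_eq, AlgHom.commutes]; exact algebraMap_mem _ _
    | add p q hp hq => rw [map_add]; exact add_mem hp hq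
    | mul_X p i hp =>
      rw [map_mul]
      refine mul_mem hp ?_
      fin_cases i
      · simpa [mem_nilpSubalgebra] using hx
      · simpa [mem_nilpSubalgebra] using hz
      · simpa [mem_nilpSubalgebra] using ht
  have hnilpA : ∀ a : HomRing d k l, IsNilp E (toLaur d _ a) := by
    intro a
    rw [← mem_nilpSubalgebra]
    induction a using coordinateRing_induction with
    | hincl p => rw [toLaur_incl]; exact hnilp p
    | hy =>
      rw [← neg_neg (yCoord _ _), map_neg, ← yTop_eq]
      exact neg_mem hynil
    | hadd a b ha hb => rw [map_add]; exact add_mem ha hb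
    | hmul a b ha hb => rw [map_mul]; exact mul_mem ha hb
  have hker : ∀ (a : HomRing d k l) (γ : ℤ ×ₗ ℤ), toLaur d _ a ∈ bigrading k l γ →
      toLaur d _ a ≠ 0 → E (toLaur d _ a) = 0 → ∃ (c : ℂ) (m : ℕ), c ≠ 0 ∧
        toLaur d _ a = c • yTop k l d ^ m := by
    intro a γ hγ h0 hker
    obtain ⟨m, j, H, g, hH, heq, -⟩ := exists_initial_form (k := k) (l := l) (by omega)
      (ev0_emb _) (by rwa [gproj_same hγ]) (DegLE.of_mem hγ)
    rw [gproj_same hγ] at heq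
    rw [heq] at h0 hker ⊢
    rw [← lmon_one_pow] at h0 hker ⊢
    have hxj : IsNilp E (lmon 1 0 0 ^ j) := by
      rw [← mem_nilpSubalgebra] at hx ⊢; exact pow_mem hx j
    have hym : IsNilp E (yTop k l d ^ m) := by
      rw [← mem_nilpSubalgebra] at hynil ⊢; exact pow_mem hynil m
    obtain ⟨h1, h2⟩ := (hxj.mul hym).apply_eq_zero_of_mul (hnilp _) h0 hker
    obtain ⟨h3, -⟩ := hxj.apply_eq_zero_of_mul hym (left_ne_zero_of_mul h0) h1
    obtain rfl : j = 0 := by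
      by_contra hj
      exact kill_x (apply_eq_zero_of_pow hj hx0 h3)
    have hH0 : H ≠ 0 := by
      rintro rfl
      simp at h0
    by_cases hc : ∃ c, H = C c
    · obtain ⟨c, rfl⟩ := hc
      refine ⟨c, m, ?_, ?_⟩
      · rintro rfl
        simp at hH0
      · rw [← algebraMap_eq, AlgHom.commutes, AlgHom.commutes, pow_zero, one_mul, Algebra.smul_def,
          mul_comm]
    · push Not at hc
      exfalso
      have hdvd : ∀ q : Poly2, q ∣ H → E (toL (emb q)) = 0 := by
        rintro q ⟨q', rfl⟩
        rw [map_mul, map_mul] at h2 h0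
        exact ((hnilp _).apply_eq_zero_of_mul (hnilp _) (right_ne_zero_of_mul h0) h2).1
      rcases exists_factor (by omega) (by omega) hkl hH hc with h | h | ⟨c, hc0, h⟩
      · exact kill_z (by simpa using hdvd _ h)
      · exact kill_t (by simpa using hdvd _ h)
      · refine kill_curve (-c) (neg_ne_zero.mpr hc0) ?_
        have := hdvd _ h
        rw [map_sub, map_sub, map_mul, map_mul, ← algebraMap_eq, AlgHom.commutes,
          AlgHom.commutes] at this
        rw [← this]
        congr 1
        simp
        ring
  have hiterA : ∀ (n : ℕ) (a : HomRing d k l), ∃ b : HomRing d k l,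
      E^[n] (toLaur d _ a) = toLaur d _ b := by
    intro n
    induction n with
    | zero => exact fun a => ⟨a, rfl⟩
    | succ n ih =>
      intro a
      obtain ⟨b, hb⟩ := ih a
      rw [Function.iterate_succ_apply', hb]
      exact hA b
  have hiterG : ∀ (n : ℕ) γ a, a ∈ bigrading k l γ → E^[n] a ∈ bigrading k l (γ + n • ε) := by
    intro n γ a ha
    induction n with
    | zero => simpa using ha
    | succ n ih =>
      rw [Function.iterate_succ_apply', succ_nsmul, ← add_assoc]
      exact hE _ _ ih
  obtain ⟨w, hw⟩ : ∃ w : ℤ ×ₗ ℤ →+ ℤ, ∀ a b : ℤ, w (toLex (a, b)) = k * l * a - d * b :=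
    ⟨{ toFun := fun γ => k * l * (ofLex γ).1 - d * (ofLex γ).2
       map_zero' := by simp
       map_add' := fun a b => by simp only [ofLex_add, Prod.fst_add, Prod.snd_add]; ring },
      fun a b => rfl⟩
  have hdegY : ∀ m : ℕ, yTop k l d ^ m ∈ bigrading k l (m • toLex ((d : ℤ), ((k * l : ℕ) : ℤ))) :=
    fun m => SetLike.pow_mem_graded m (yTop_mem d)
  have hmain : ∀ (a : HomRing d k l) (γ : ℤ ×ₗ ℤ), toLaur d _ a ∈ bigrading k l γ →
      toLaur d _ a ≠ 0 → ∃ (n m : ℕ) (c : ℂ), HasDeg E (toLaur d _ a) n ∧ c ≠ 0 ∧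
        E^[n] (toLaur d _ a) = c • yTop k l d ^ m ∧
        γ + n • ε = m • toLex ((d : ℤ), ((k * l : ℕ) : ℤ)) ∧ w γ + n * w ε = 0 := by
    intro a γ hγ h0
    obtain ⟨n, hn⟩ := (hnilpA a).exists_hasDeg h0
    obtain ⟨b, hb⟩ := hiterA n a
    have hbγ := hiterG n γ _ hγ
    have hn1 := hn.1
    have hn2 := hn.2
    rw [Function.iterate_succ_apply', hb] at hn2
    rw [hb] at hbγ hn1
    obtain ⟨c, m, hc, hcm⟩ := hker b _ hbγ hn1 hn2
    have hdeg : γ + n • ε = m • toLex ((d : ℤ), ((k * l : ℕ) : ℤ)) := by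
      by_contra hne
      have h1 := gproj_ne hbγ hne
      rw [gproj_same] at h1
      · exact hn1 h1
      · rw [hcm]
        exact Submodule.smul_mem _ _ (hdegY m)
    refine ⟨n, m, c, hn, hc, by rw [hb, hcm], hdeg, ?_⟩
    have e1 := congrArg w hdeg
    rw [map_add, map_nsmul, map_nsmul, hw] at e1
    simp only [nsmul_eq_mul] at e1
    push_cast at e1
    linear_combination e1
  have hxA : toLaur d _ (incl d (emb (curvePoly ℂ k l)) (X 0)) = lmon 1 0 0 := by simp
  have htA : toLaur d _ (incl d (emb (curvePoly ℂ k l)) (X 2)) = lmon 0 0 1 := by simp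
  have hxG : lmon 1 0 0 ∈ bigrading k l (toLex (-1, 0)) := by
    simpa using lmon_mem (k := k) (l := l) 1 0 0
  have htG : lmon 0 0 1 ∈ bigrading k l (toLex (0, (k : ℤ))) := by
    simpa using lmon_mem (k := k) (l := l) 0 0 1
  obtain ⟨nx, -, -, hnx, -, -, -, hwx⟩ := hmain _ _ (hxA ▸ hxG) (hxA ▸ hx0)
  obtain ⟨nt, -, -, hnt, -, -, -, hwt⟩ := hmain _ _ (htA ▸ htG) (htA ▸ ht0)
  rw [hxA] at hnx
  rw [htA] at hnt
  obtain ⟨n1, m1, c1, hn1, hc1, he1, hd1, -⟩ := hmain (incl d _ (X 0) ^ nt) _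
    (by rw [map_pow, hxA]; exact SetLike.pow_mem_graded nt hxG)
    (by rw [map_pow, hxA]; exact pow_ne_zero _ hx0)
  obtain ⟨n2, m2, c2, hn2, hc2, he2, hd2, -⟩ := hmain (incl d _ (X 2) ^ nx) _
    (by rw [map_pow, htA]; exact SetLike.pow_mem_graded nx htG)
    (by rw [map_pow, htA]; exact pow_ne_zero _ ht0)
  rw [map_pow, hxA] at hn1 he1
  rw [map_pow, htA] at hn2 he2
  obtain rfl := hn1.unique (hnx.pow nt)
  obtain rfl := hn2.unique (hnt.pow nx)
  have hker_pow : ∀ (c : ℂ) m, E (c • yTop k l d ^ m) = 0 := by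
    intro c m
    rw [Algebra.smul_def, E.leibniz, E.leibniz_pow, hy, E.map_algebraMap]
    simp
  set δ := toLex ((d : ℤ), ((k * l : ℕ) : ℤ)) with hδ
  obtain ⟨h, hh⟩ : ∃ h : HomRing d k l, toLaur d _ h = (c2 • yTop k l d ^ m2) * lmon 1 0 0 ^ nt -
      (c1 • yTop k l d ^ m1) * lmon 0 0 1 ^ nx := by
    refine ⟨(c2 • (-yCoord d _) ^ m2) * incl d _ (X 0) ^ nt -
      (c1 • (-yCoord d _) ^ m1) * incl d _ (X 2) ^ nx, ?_⟩
    simp only [map_sub, map_mul, map_smul, map_pow, ← yTop_eq, hxA, htA]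
  have hnx0 : nx ≠ 0 := by
    rintro rfl
    exact kill_x hnx.2
  have hh0 : toLaur d _ h ≠ 0 := by
    rw [hh]
    intro h0
    have := congrArg evalPt h0
    simp [evalPt_lmon, evalPt_yTop (d := d) (k := k) (show l ≠ 0 by omega), hnx0, hc2] at this
  have hhG : toLaur d _ h ∈ bigrading k l (m2 • δ + nt • toLex (-1, 0)) := by
    rw [hh]
    refine sub_mem (SetLike.mul_mem_graded (Submodule.smul_mem _ _ (hdegY m2))
      (SetLike.pow_mem_graded nt hxG)) ?_
    have e : m2 • δ + nt • toLex (-1, 0) = m1 • δ + nx • toLex (0, (k : ℤ)) := by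
      rw [← hd1, ← hd2, mul_comm nx nt]
      abel
    rw [e]
    exact SetLike.mul_mem_graded (Submodule.smul_mem _ _ (hdegY m1)) (SetLike.pow_mem_graded nx htG)
  have hhit : E^[nt * nx] (toLaur d _ h) = 0 := by
    rw [hh, sub_eq_add_neg, iterate_derivation_add, ← neg_mul, iterate_derivation_mul_left
      (hker_pow _ _), iterate_derivation_mul_left (by rw [map_neg, hker_pow, neg_zero]), he1,
      mul_comm nt nx, he2]
    simp only [Algebra.smul_def]
    ring
  obtain ⟨nh, -, -, hnh, -, -, -, hwh⟩ := hmain h _ hhG hh0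
  have hlt := hnh.le_of_iterate_eq_zero hhit
  rw [map_add, map_nsmul, map_nsmul, hδ, hw, hw] at hwh
  rw [hw] at hwx
  simp only [nsmul_eq_mul] at hwh
  push_cast at hwh hwx
  generalize w ε = W at hwh hwx
  have hkl0 : (k * l : ℤ) ≠ 0 := by
    have : k * l ≠ 0 := Nat.mul_ne_zero (by omega) (by omega)
    exact_mod_cast this
  have hW0 : W ≠ 0 := by
    intro h
    rw [h] at hwx
    apply hkl0
    linarith
  have hfin : ((nh : ℤ) - nt * nx) * W = 0 := by
    linear_combination hwh - nt * hwx
  rcases mul_eq_zero.mp hfin with h | h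
  · have : (nh : ℤ) < (nt * nx : ℕ) := by exact_mod_cast hlt
    push_cast at this
    linarith
  · exact hW0 h

end HomogeneousDerivation

section LaurDerivation

open MvPolynomial

/-- The value on a monomial of the derivation with prescribed values on `x`, `z`, `t`. -/
noncomputable def laurDerivationMon (u v w : Laur) (g : ℤ × ℕ × ℕ) : Laur :=
  (g.1 : Laur) * lmon (g.1 - 1) g.2.1 g.2.2 * u + (g.2.1 : Laur) * lmon g.1 (g.2.1 - 1) g.2.2 * v +
    (g.2.2 : Laur) * lmon g.1 g.2.1 (g.2.2 - 1) * w

theorem laurDerivationMon_add (u v w : Laur) (g h : ℤ × ℕ × ℕ) :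
    laurDerivationMon u v w (g + h) = lmon g.1 g.2.1 g.2.2 * laurDerivationMon u v w h +
      lmon h.1 h.2.1 h.2.2 * laurDerivationMon u v w g := by
  obtain ⟨n, i, j⟩ := g
  obtain ⟨n', i', j'⟩ := h
  have e1 : lmon (n + n' - 1) (i + i') (j + j') = lmon n i j * lmon (n' - 1) i' j' := by
    rw [lmon_mul, add_sub_assoc]
  have e1' : lmon (n + n' - 1) (i + i') (j + j') = lmon (n - 1) i j * lmon n' i' j' := by
    rw [lmon_mul]
    congr 1
    ring
  have e2 : (i' : Laur) * lmon (n + n') (i + i' - 1) (j + j') =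
      i' * (lmon n i j * lmon n' (i' - 1) j') := by
    rcases i' with _ | i'
    · simp
    · rw [lmon_mul]
      rfl
  have e2' : (i : Laur) * lmon (n + n') (i + i' - 1) (j + j') =
      i * (lmon n (i - 1) j * lmon n' i' j') := by
    rcases i with _ | i
    · simp
    · rw [lmon_mul]
      congr 3
      omega
  have e3 : (j' : Laur) * lmon (n + n') (i + i') (j + j' - 1) =
      j' * (lmon n i j * lmon n' i' (j' - 1)) := by
    rcases j' with _ | j'
    · simp
    · rw [lmon_mul]
      rfl
  have e3' : (j : Laur) * lmon (n + n') (i + i') (j + j' - 1) =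
      j * (lmon n i (j - 1) * lmon n' i' j') := by
    rcases j with _ | j
    · simp
    · rw [lmon_mul]
      congr 3
      omega
  simp only [laurDerivationMon, Prod.mk_add_mk]
  push_cast
  linear_combination (n' : Laur) * u * e1 + (n : Laur) * u * e1' + v * e2 + v * e2' + w * e3 +
    w * e3'

/-- The derivation with prescribed values on `x`, `z`, `t`. -/
noncomputable def laurDerivation (u v w : Laur) : Derivation ℂ Laur Laur :=
  Derivation.mk' (Finsupp.linearCombination ℂ (laurDerivationMon u v w) ∘ₗ
      (AddMonoidAlgebra.coeffLinearEquiv ℂ).toLinearMap) (by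
    have hs : ∀ (c : ℂ) g, (Finsupp.linearCombination ℂ (laurDerivationMon u v w) ∘ₗ
      (AddMonoidAlgebra.coeffLinearEquiv ℂ).toLinearMap) (AddMonoidAlgebra.single g c) =
        c • laurDerivationMon u v w g := by
      intro c g
      simp [AddMonoidAlgebra.coeffLinearEquiv]
    intro a b
    induction a using AddMonoidAlgebra.induction_linear with
    | zero => simp
    | add a a' ha ha' =>
      rw [add_mul, map_add, ha, ha', map_add]
      simp only [smul_eq_mul]
      ring
    | single g c =>
      induction b using AddMonoidAlgebra.induction_linear with
      | zero => simp
      | add b b' hb hb' =>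
        rw [mul_add, map_add, hb, hb', map_add]
        simp only [smul_eq_mul]
        ring
      | single h c' =>
        rw [AddMonoidAlgebra.single_mul_single, hs, hs, hs, laurDerivationMon_add]
        obtain ⟨n, i, j⟩ := g
        obtain ⟨n', i', j'⟩ := h
        rw [smul_eq_mul, smul_eq_mul]
        simp only [smul_lmon, Algebra.smul_def, map_mul]
        ring)

theorem laurDerivation_lmon (u v w : Laur) (n : ℤ) (i j : ℕ) :
    laurDerivation u v w (lmon n i j) = laurDerivationMon u v w (n, i, j) := by
  simp [laurDerivation, lmon, AddMonoidAlgebra.coeffLinearEquiv]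

end LaurDerivation

section Derksen

open MvPolynomial

variable {d : ℕ} {f : Poly3}

/-- Every derivation of the coordinate ring extends to `ℂ[x, x⁻¹, z, t]`. -/
theorem exists_extension (D : Derivation ℂ (CoordinateRing d f) (CoordinateRing d f)) :
    ∃ E : Derivation ℂ Laur Laur, ∀ a, E (toLaur d f a) = toLaur d f (D a) := by
  set E := laurDerivation (toLaur d f (D (incl d f (X 0)))) (toLaur d f (D (incl d f (X 1))))
    (toLaur d f (D (incl d f (X 2)))) with hE
  have hX : ∀ i : Fin 3, E (toLaur d f (incl d f (X i))) = toLaur d f (D (incl d f (X i))) := by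
    intro i
    fin_cases i <;> simp [hE, laurDerivation_lmon, laurDerivationMon, lmon_zero]
  have hp : ∀ p, E (toLaur d f (incl d f p)) = toLaur d f (D (incl d f p)) := by
    intro p
    induction p using MvPolynomial.induction_on with
    | C c =>
      rw [← algebraMap_eq, AlgHom.commutes, AlgHom.commutes, E.map_algebraMap, D.map_algebraMap,
        map_zero]
    | add p q hp hq => simp only [map_add, hp, hq]
    | mul_X p i hp => simp only [map_mul, Derivation.leibniz, smul_eq_mul, map_add, hp, hX]
  refine ⟨E, fun a => ?_⟩
  induction a using coordinateRing_induction with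
  | hincl p => exact hp p
  | hy =>
    have h0 : incl d f (X 0) ^ d * yCoord d f = incl d f (-f) := by
      rw [incl_X0_pow_mul_yCoord, map_neg]
    have h1 : E (toLaur d f (incl d f (X 0) ^ d * yCoord d f)) = E (toLaur d f (incl d f (-f))) := by
      rw [h0]
    have h2 : toLaur d f (D (incl d f (X 0) ^ d * yCoord d f)) = toLaur d f (D (incl d f (-f))) := by
      rw [h0]
    rw [hp, ← h2, map_mul, ← map_pow, E.leibniz, D.leibniz, hp, map_add] at h1
    simp only [smul_eq_mul, map_mul] at h1
    rw [mul_comm (toLaur d f (yCoord d f))] at h1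
    have h3 : toLaur d f (incl d f (X 0 ^ d)) ≠ 0 := by
      rw [toLaur_incl, map_ne_zero_iff _ toL_injective]
      exact pow_ne_zero _ (X_ne_zero _)
    apply mul_left_cancel₀ h3
    linear_combination h1
  | hadd a b ha hb => simp only [map_add, ha, hb]
  | hmul a b ha hb => simp only [map_mul, Derivation.leibniz, smul_eq_mul, map_add, ha, hb]

/-- The kernel of every nonzero locally nilpotent derivation of the coordinate ring is contained
in `ℂ[x, z, t]`. -/
theorem mem_range_incl_of_apply_eq_zero {k l : ℕ} (hd : 2 ≤ d) (hk : 2 ≤ k) (hl : 2 ≤ l)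
    (hkl : Nat.Coprime k l) (hf : ev0 f = curvePoly ℂ k l)
    {D : Derivation ℂ (CoordinateRing d f) (CoordinateRing d f)} (hD : ∀ a, IsNilp D a)
    (hD0 : D ≠ 0) {a : CoordinateRing d f} (ha : D a = 0) : a ∈ Set.range (incl d f) := by
  by_contra hcon
  have hd0 : d ≠ 0 := by omega
  have hf0 : ev0 f ≠ 0 := hf ▸ curvePoly_ne_zero
  have hinj := toLaur_injective hd0 hf0
  obtain ⟨E, hE⟩ := exists_extension D
  have hE0 : E ≠ 0 := by
    rintro rfl
    apply hD0
    refine Derivation.ext fun b => hinj ?_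
    rw [← hE]
    simp
  have hEit : ∀ n b, E^[n] (toLaur d f b) = toLaur d f (D^[n] b) := by
    intro n b
    induction n with
    | zero => rfl
    | succ n ih => rw [Function.iterate_succ_apply', ih, hE, Function.iterate_succ_apply']
  have hEnil : ∀ b, IsNilp E (toLaur d f b) := by
    intro b
    obtain ⟨n, hn⟩ := hD b
    exact ⟨n, by rw [hEit, hn, map_zero]⟩
  have hxG : lmon 1 0 0 ∈ bigrading k l (toLex (-1, 0)) := by
    simpa using lmon_mem (k := k) (l := l) 1 0 0
  have hzG : lmon 0 1 0 ∈ bigrading k l (toLex (0, (l : ℤ))) := by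
    simpa using lmon_mem (k := k) (l := l) 0 1 0
  have htG : lmon 0 0 1 ∈ bigrading k l (toLex (0, (k : ℤ))) := by
    simpa using lmon_mem (k := k) (l := l) 0 0 1
  obtain ⟨ε, hε, hε0⟩ := exists_top_gcomp (𝒜 := bigrading k l)
    ![lmon 1 0 0, lmon 0 1 0, lmon 0 0 1] ![toLex (-1, 0), toLex (0, (l : ℤ)), toLex (0, (k : ℤ))]
    (by intro i; fin_cases i <;> assumption)
    (fun E h => derivation_laur_eq_zero (h 0) (h 1) (h 2)) E hE0
  apply hε0
  have ha0 : toLaur d f a ≠ 0 := by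
    intro h
    apply hcon
    rw [map_eq_zero_iff _ hinj] at h
    exact ⟨0, by rw [h, map_zero]⟩
  set F := gcomp (bigrading k l) ε E with hF
  have hgen : ∀ (i : Fin 3) γ, toL (X i) ∈ bigrading k l γ → IsNilp F (toL (X i)) := by
    intro i γ hγ
    have := (hEnil (incl d f (X i))).gcomp_gproj hε (γ := γ)
    rw [toLaur_incl, gproj_same hγ] at this
    exact this (DegLE.of_mem hγ)
  have hFx : IsNilp F (lmon 1 0 0) := by simpa using hgen 0 _ (by simpa using hxG)
  have hFz : IsNilp F (lmon 0 1 0) := by simpa using hgen 1 _ (by simpa using hzG)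
  have hFt : IsNilp F (lmon 0 0 1) := by simpa using hgen 2 _ (by simpa using htG)
  have hFp : ∀ p : Poly3, IsNilp F (toL p) := by
    intro p
    rw [← mem_nilpSubalgebra]
    induction p using MvPolynomial.induction_on with
    | C a => rw [← algebraMap_eq, AlgHom.commutes]; exact algebraMap_mem _ _
    | add p q hp hq => rw [map_add]; exact add_mem hp hq
    | mul_X p i hp =>
      rw [map_mul]
      refine mul_mem hp ?_
      fin_cases i
      · simpa [mem_nilpSubalgebra] using hFx
      · simpa [mem_nilpSubalgebra] using hFz
      · simpa [mem_nilpSubalgebra] using hFt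
  have hFy : IsNilp F (yTop k l d) := by
    obtain ⟨q, hq⟩ := exists_eq_emb_add f
    have h1 : toLaur d f (-yCoord d f) = yTop k l d + lmon (-d + 1) 0 0 * toL q := by
      rw [map_neg, toLaur_yCoord, neg_neg]
      conv_lhs => rw [hq]
      have : lmon (-d + 1 : ℤ) 0 0 = lmon (-d) 0 0 * lmon 1 0 0 := by rw [lmon_mul]
      rw [yTop, hf, this, map_add, map_mul, toL_X0]
      ring
    have h2 : ∀ δ : ℤ ×ₗ ℤ, (d : ℤ) ≤ (ofLex δ).1 →
        gproj (bigrading k l) δ (lmon (-d + 1) 0 0 * toL q) = 0 := by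
      intro δ hδ
      rw [gproj_lmon_mul, gproj_toL_eq_zero, mul_zero]
      have : (ofLex (δ - toLex (-(-(d : ℤ) + 1), (0 : ℤ)))).1 = (ofLex δ).1 - d + 1 := by
        simp only [ofLex_sub, ofLex_toLex, Prod.fst_sub]
        ring
      rw [this]
      omega
    have h3 := (hEnil (-yCoord d f)).gcomp_gproj hε (γ := toLex ((d : ℤ), ((k * l : ℕ) : ℤ))) (by
      intro δ hδ
      rw [h1, map_add, gproj_ne (yTop_mem d) hδ.ne, h2, add_zero]
      rw [Prod.Lex.lt_iff] at hδ
      rcases hδ with h | h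
      · exact h.le
      · exact h.1.le)
    rwa [h1, map_add, gproj_same (yTop_mem d), h2 _ (by simp), add_zero] at h3
  obtain ⟨γ, hγ0, hγ⟩ := exists_top (𝒜 := bigrading k l) ha0
  obtain ⟨m, j, H, g, -, heq, hm⟩ := exists_initial_form hd0 hf hγ0 hγ
  have hy : F (yTop k l d) = 0 := by
    have h1 : F (gproj (bigrading k l) γ (toLaur d f a)) = 0 := by
      rw [hF, ← (gproj_apply_of_degLE hε hγ).2, hE, ha, map_zero, map_zero]
    rw [heq] at h1 hγ0
    have hxj : IsNilp F (lmon j 0 0) := by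
      rw [← mem_nilpSubalgebra] at hFx
      rw [← lmon_one_pow, ← mem_nilpSubalgebra]
      exact pow_mem hFx j
    have hym : IsNilp F (yTop k l d ^ m) := by
      rw [← mem_nilpSubalgebra] at hFy ⊢
      exact pow_mem hFy m
    have h2 := ((hxj.mul hym).apply_eq_zero_of_mul (hFp _) hγ0 h1).1
    have h3 := (hxj.apply_eq_zero_of_mul hym (left_ne_zero_of_mul hγ0) h2).2
    exact apply_eq_zero_of_pow (hm hcon) (yTop_ne_zero d) h3
  have hgenA : ∀ (i : Fin 3) γ, toL (X i) ∈ bigrading k l γ →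
      F (toL (X i)) ∈ (toLaur d (emb (curvePoly ℂ k l))).range := by
    intro i γ hγ
    have h1 := gproj_apply_of_degLE hε (DegLE.of_mem hγ)
    rw [gproj_same hγ, ← hF, ← toLaur_incl (d := d) (f := f), hE] at h1
    rw [toLaur_incl] at h1
    rw [← h1.2]
    by_cases h0 : gproj (bigrading k l) (γ + ε) (toLaur d f (D (incl d f (X i)))) = 0
    · rw [h0]
      exact zero_mem _
    · obtain ⟨m, j, H, g, -, heq, -⟩ := exists_initial_form hd0 hf h0 h1.1
      rw [heq, ← lmon_one_pow, ← toL_X0, ← toLaur_incl (d := d) (f := emb (curvePoly ℂ k l)),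
        ← toLaur_incl (d := d) (f := emb (curvePoly ℂ k l)), yTop_eq]
      exact mul_mem (mul_mem (pow_mem (AlgHom.mem_range_self _ _) _)
        (pow_mem (AlgHom.mem_range_self _ _) _)) (AlgHom.mem_range_self _ _)
  refine homogeneousDerivation_eq_zero hd hk hl hkl (fun γ a ha => gcomp_mem ε E ha) hFx hFz hFt hy ?_
  suffices h : ∀ a : HomRing d k l, F (toLaur d _ a) ∈ (toLaur d (emb (curvePoly ℂ k l))).range by
    intro a
    obtain ⟨b, hb⟩ := h a
    exact ⟨b, hb.symm⟩
  intro a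
  induction a using coordinateRing_induction with
  | hincl p =>
    induction p using MvPolynomial.induction_on with
    | C c =>
      rw [← algebraMap_eq, AlgHom.commutes, AlgHom.commutes, F.map_algebraMap]
      exact zero_mem _
    | add p q hp hq => simp only [map_add]; exact add_mem hp hq
    | mul_X p i hp =>
      rw [map_mul, map_mul, F.leibniz, smul_eq_mul, smul_eq_mul]
      refine add_mem (mul_mem ⟨_, rfl⟩ ?_) (mul_mem ⟨_, rfl⟩ hp)
      rw [toLaur_incl]
      fin_cases i
      · exact hgenA 0 _ (by simpa using hxG)
      · exact hgenA 1 _ (by simpa using hzG)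
      · exact hgenA 2 _ (by simpa using htG)
  | hy =>
    rw [← neg_neg (yCoord _ _), map_neg, ← yTop_eq, map_neg, hy, neg_zero]
    exact zero_mem _
  | hadd a b ha hb => rw [map_add, map_add]; exact add_mem ha hb
  | hmul a b ha hb =>
    rw [map_mul, F.leibniz, smul_eq_mul, smul_eq_mul]
    exact add_mem (mul_mem ⟨_, rfl⟩ hb) (mul_mem ⟨_, rfl⟩ ha)

/-- The derivations `x ^ d ∂ᵢ - (∂ᵢ f) ∂_y` of the coordinate ring. -/
theorem exists_lnd (hd : d ≠ 0) (hf : ev0 f ≠ 0) (i : Fin 3) (hi : i ≠ 0) :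
    ∃ D : Derivation ℂ (CoordinateRing d f) (CoordinateRing d f), (∀ a, IsNilp D a) ∧ D ≠ 0 ∧
      ∀ j, j ≠ i → D (incl d f (X j)) = 0 := by
  set D4 : Derivation ℂ (MvPolynomial (Fin 4) ℂ) (MvPolynomial (Fin 4) ℂ) := mkDerivation ℂ
    ![0, - rename ![0, 2, 3] (pderiv i f), X 0 ^ d * Pi.single (M := fun _ => _) i 1 1,
      X 0 ^ d * Pi.single (M := fun _ => _) i 1 2] with hD4
  have hren : ∀ p : Poly3, D4 (rename ![0, 2, 3] p) = X 0 ^ d * rename ![0, 2, 3] (pderiv i p) := by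
    intro p
    induction p using MvPolynomial.induction_on with
    | C c => rw [rename_C, derivation_C, derivation_C, map_zero, mul_zero]
    | add p q hp hq => simp only [map_add, hp, hq, mul_add]
    | mul_X p j hp =>
      have hX : D4 (X (![0, 2, 3] j)) = X 0 ^ d * rename ![0, 2, 3] (pderiv i (X j)) := by
        rw [hD4, mkDerivation_X, pderiv_X]
        fin_cases j <;> fin_cases i <;> simp_all
      rw [map_mul, rename_X, D4.leibniz, Derivation.leibniz, hX, hp]
      simp only [smul_eq_mul, map_add, map_mul, rename_X]
      ring
  have hD0 : D4 (X 0) = 0 := by rw [hD4, mkDerivation_X]; rfl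
  have hD1 : D4 (X 1) = - rename ![0, 2, 3] (pderiv i f) := by rw [hD4, mkDerivation_X]; rfl
  have hDeq : D4 (equation d f) = 0 := by
    rw [equation, map_add, D4.leibniz, D4.leibniz_pow, hren, hD0, hD1]
    simp
  set π := Ideal.Quotient.mkₐ ℂ (Ideal.span {equation d f}) with hπ
  have hsurj : Function.Surjective π := Ideal.Quotient.mkₐ_surjective _ _
  have hker : ∀ a, π a = 0 → π (D4 a) = 0 := by
    intro a ha
    rw [hπ, Ideal.Quotient.mkₐ_eq_mk, Ideal.Quotient.eq_zero_iff_mem, Ideal.mem_span_singleton]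
      at ha ⊢
    obtain ⟨b, rfl⟩ := ha
    rw [D4.leibniz, hDeq, smul_zero, add_zero]
    exact dvd_mul_right _ _
  set D := Derivation.liftOfSurjective hsurj hker with hD
  have happ : ∀ a, D (π a) = π (D4 a) := Derivation.liftOfSurjective_apply hsurj hker
  have hincl : ∀ p, D (incl d f p) = incl d f (X 0 ^ d * pderiv i p) := by
    intro p
    change D (π (rename ![0, 2, 3] p)) = π (rename ![0, 2, 3] (X 0 ^ d * pderiv i p))
    rw [happ, hren, map_mul (rename ![0, 2, 3]), map_pow (rename ![0, 2, 3]), rename_X]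
    rfl
  have hX : ∀ j, IsNilp D (incl d f (X j)) := by
    intro j
    by_cases hj : j = i
    · refine ⟨2, ?_⟩
      have hX0 : pderiv i (X 0 : Poly3) = 0 := pderiv_X_of_ne hi.symm
      rw [Function.iterate_succ_apply', Function.iterate_one, hincl, hincl, hj, pderiv_X_self,
        mul_one, Derivation.leibniz_pow, hX0]
      simp
    · refine .of_apply_eq_zero ?_
      rw [hincl, pderiv_X_of_ne hj]
      simp
  have hp : ∀ p, IsNilp D (incl d f p) := by
    intro p
    rw [← mem_nilpSubalgebra]
    induction p using MvPolynomial.induction_on with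
    | C a => rw [← algebraMap_eq, AlgHom.commutes]; exact algebraMap_mem _ _
    | add p q hp hq => rw [map_add]; exact add_mem hp hq
    | mul_X p i hp =>
      rw [map_mul]
      exact mul_mem hp (hX i)
  refine ⟨D, fun a => ?_, ?_, fun j hj => ?_⟩
  · rw [← mem_nilpSubalgebra]
    induction a using coordinateRing_induction with
    | hincl p => exact hp p
    | hy =>
      have h1 : D (yCoord d f) = incl d f (-pderiv i f) := by
        have : yCoord d f = π (X 1) := rfl
        rw [this, happ, hD1, map_neg, map_neg]
        rfl
      obtain ⟨n, hn⟩ := hp (-pderiv i f)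
      exact ⟨n + 1, by rw [Function.iterate_succ_apply, h1, hn]⟩
    | hadd a b ha hb => exact add_mem ha hb
    | hmul a b ha hb => exact mul_mem ha hb
  · intro h
    have h1 := hincl (X i)
    rw [h, pderiv_X_self, mul_one, Derivation.zero_apply, map_pow] at h1
    have h2 := eq_zero_of_X0_pow_mul hd hf d (a := 1) (by rw [mul_one, ← h1])
    have h3 : incl d f 1 = incl d f 0 := by rw [map_one, h2, map_zero]
    exact one_ne_zero (incl_injective h3)
  · rw [hincl, pderiv_X_of_ne hj]
    simp

end Derksen

section Isomorphisms

open MvPolynomial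

variable {d : ℕ} {f f' : Poly3}

theorem apply_incl_mem_range {k l : ℕ} (hd : 2 ≤ d) (hk : 2 ≤ k) (hl : 2 ≤ l)
    (hkl : Nat.Coprime k l) (hf : ev0 f = curvePoly ℂ k l) (hf' : ev0 f' = curvePoly ℂ k l)
    (φ : CoordinateRing d f ≃ₐ[ℂ] CoordinateRing d f') (p : Poly3) :
    φ (incl d f p) ∈ (incl d f').range := by
  have hX : ∀ j, φ (incl d f (X j)) ∈ (incl d f').range := by
    intro j
    obtain ⟨i, hi, hij⟩ : ∃ i : Fin 3, i ≠ 0 ∧ j ≠ i := by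
      fin_cases j
      · exact ⟨1, by decide, by decide⟩
      · exact ⟨2, by decide, by decide⟩
      · exact ⟨1, by decide, by decide⟩
    obtain ⟨D, hD, hD0, hDj⟩ := exists_lnd (d := d) (f := f) (by omega)
      (hf ▸ curvePoly_ne_zero) i hi
    set D' : Derivation ℂ (CoordinateRing d f') (CoordinateRing d f') :=
      Derivation.mk' (φ.toLinearMap ∘ₗ (D : CoordinateRing d f →ₗ[ℂ] CoordinateRing d f) ∘ₗ
        φ.symm.toLinearMap) (fun a b => by simp) with hD'
    have happ : ∀ a, D' a = φ (D (φ.symm a)) := fun a => rfl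
    have hit : ∀ n a, D'^[n] a = φ (D^[n] (φ.symm a)) := by
      intro n a
      induction n with
      | zero => simp
      | succ n ih => rw [Function.iterate_succ_apply', ih, happ, φ.symm_apply_apply,
          Function.iterate_succ_apply']
    obtain ⟨q, hq⟩ := mem_range_incl_of_apply_eq_zero hd hk hl hkl hf' (D := D')
      (fun a => by
        obtain ⟨n, hn⟩ := hD (φ.symm a)
        exact ⟨n, by rw [hit, hn, map_zero]⟩)
      (fun h => hD0 (Derivation.ext fun a => by
        have := happ (φ a)
        rw [h, φ.symm_apply_apply] at this
        exact φ.injective (by rw [← this]; simp)))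
      (a := φ (incl d f (X j))) (by rw [happ, φ.symm_apply_apply, hDj j hij, map_zero])
    exact ⟨q, hq⟩
  induction p using MvPolynomial.induction_on with
  | C a => rw [← algebraMap_eq, AlgHom.commutes, AlgEquiv.commutes]; exact algebraMap_mem _ _
  | add p q hp hq => rw [map_add, map_add]; exact add_mem hp hq
  | mul_X p i hp =>
    rw [map_mul, map_mul]
    exact mul_mem hp (hX i)

/-- Isomorphisms of coordinate rings restrict to automorphisms of `ℂ[x, z, t]`. -/
theorem exists_restriction {k l : ℕ} (hd : 2 ≤ d) (hk : 2 ≤ k) (hl : 2 ≤ l)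
    (hkl : Nat.Coprime k l) (hf : ev0 f = curvePoly ℂ k l) (hf' : ev0 f' = curvePoly ℂ k l)
    (φ : CoordinateRing d f ≃ₐ[ℂ] CoordinateRing d f') :
    ∃ Φ : Poly3 ≃ₐ[ℂ] Poly3, ∀ p, φ (incl d f p) = incl d f' (Φ p) := by
  have hex : ∀ {f f' : Poly3} (_ : ev0 f = curvePoly ℂ k l) (_ : ev0 f' = curvePoly ℂ k l)
      (φ : CoordinateRing d f ≃ₐ[ℂ] CoordinateRing d f'),
      ∃ Φ : Poly3 →ₐ[ℂ] Poly3, ∀ p, incl d f' (Φ p) = φ (incl d f p) := by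
    intro f f' hf hf' φ
    refine ⟨(AlgEquiv.ofInjective (incl d f') incl_injective).symm.toAlgHom.comp
      (((φ : CoordinateRing d f →ₐ[ℂ] CoordinateRing d f').comp (incl d f)).codRestrict
        (incl d f').range (apply_incl_mem_range hd hk hl hkl hf hf' φ)), fun p => ?_⟩
    have := (AlgEquiv.ofInjective (incl d f') incl_injective).apply_symm_apply
      ⟨φ (incl d f p), apply_incl_mem_range hd hk hl hkl hf hf' φ p⟩
    exact congrArg Subtype.val this
  obtain ⟨Φ, hΦ⟩ := hex hf hf' φ
  obtain ⟨Ψ, hΨ⟩ := hex hf' hf φ.symm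
  refine ⟨AlgEquiv.ofAlgHom Φ Ψ ?_ ?_, fun p => (hΦ p).symm⟩
  · refine AlgHom.ext fun p => incl_injective (d := d) (f := f') ?_
    rw [AlgHom.comp_apply, hΦ, hΨ, φ.apply_symm_apply]
    rfl
  · refine AlgHom.ext fun p => incl_injective (d := d) (f := f) ?_
    rw [AlgHom.comp_apply, hΨ, hΦ, φ.symm_apply_apply]
    rfl

theorem exists_eq_add_yCoord_mul (hd : d ≠ 0) (hf : ev0 f ≠ 0) (N : ℕ) : ∀ (p : Poly3)
    (a : CoordinateRing d f), N ≤ d → incl d f (X 0) ^ N * a = incl d f p →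
    ∃ b c, a = incl d f b + yCoord d f * incl d f c := by
  induction N with
  | zero => exact fun p a _ h => ⟨p, 0, by simpa using h⟩
  | succ N ih =>
    intro p a hN h
    obtain ⟨h0, hh0⟩ := pow_dvd_ev0_of_eq_incl hd hf incl_injective h (m := 1) (by omega)
    rw [pow_one] at hh0
    obtain ⟨p1, hp1⟩ := exists_eq_emb_add p
    obtain ⟨f1, hf1⟩ := exists_eq_emb_add f
    have hp : p = f * emb h0 + X 0 * (p1 - f1 * emb h0) := by
      rw [hp1, hh0, map_mul]
      linear_combination (-emb h0) * hf1
    have hpow : incl d f (X 0) ^ d = incl d f (X 0) ^ (N + 1) * incl d f (X 0) ^ (d - (N + 1)) := by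
      rw [← pow_add]
      congr 1
      omega
    obtain ⟨b, c, hbc⟩ := ih (p1 - f1 * emb h0)
      (a + incl d f (X 0) ^ (d - (N + 1)) * (yCoord d f * incl d f (emb h0))) (by omega) (by
        rw [← sub_eq_zero]
        apply eq_zero_of_X0_mul hd hf
        have h2 := incl_X0_pow_mul_yCoord (d := d) (f := f)
        rw [hpow] at h2
        have h3 := congrArg (incl d f) hp
        simp only [map_add, map_mul, map_sub] at h3 ⊢
        linear_combination h + h3 + incl d f (emb h0) * h2)
    refine ⟨b, c - X 0 ^ (d - (N + 1)) * emb h0, ?_⟩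
    simp only [map_sub, map_mul, map_pow]
    linear_combination hbc

theorem mem_centerIdeal_of_incl_eq (hd : d ≠ 0) (hf : ev0 f ≠ 0) {q : Poly3}
    {a : CoordinateRing d f} (h : incl d f q = incl d f (X 0) ^ d * a) : q ∈ centerIdeal d f := by
  obtain ⟨b, c, rfl⟩ := exists_eq_add_yCoord_mul hd hf d q a le_rfl h.symm
  rw [mem_centerIdeal]
  refine ⟨b, -c, incl_injective (d := d) (f := f) ?_⟩
  rw [h]
  simp only [map_add, map_mul, map_neg, map_pow]
  linear_combination incl d f c * incl_X0_pow_mul_yCoord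

/-- Isomorphisms of coordinate rings come from automorphisms of `ℂ[x, z, t]` which rescale `x` and
map the ideal `(x ^ d, f)` to `(x ^ d, f')`. -/
theorem exists_automorphism {k l : ℕ} (hd : 2 ≤ d) (hk : 2 ≤ k) (hl : 2 ≤ l)
    (hkl : Nat.Coprime k l) (hf : ev0 f = curvePoly ℂ k l) (hf' : ev0 f' = curvePoly ℂ k l)
    (φ : CoordinateRing d f ≃ₐ[ℂ] CoordinateRing d f') :
    ∃ (Φ : Poly3 ≃ₐ[ℂ] Poly3) (μ : ℂˣ), Φ (X 0) = C (μ : ℂ) * X 0 ∧ Φ f ∈ centerIdeal d f' := by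
  obtain ⟨Φ, hΦ⟩ := exists_restriction hd hk hl hkl hf hf' φ
  have hd0 : d ≠ 0 := by omega
  have hf0 : ev0 f' ≠ 0 := hf' ▸ curvePoly_ne_zero
  have hprime : Prime (X 0 : Poly3) := X_prime
  have hdvd : X 0 ∣ Φ (X 0) := by
    obtain ⟨B, u, -, hu⟩ := exists_pow_mul_eq_incl (φ.symm (yCoord d f'))
    have h1 := congrArg φ hu
    rw [map_mul, map_pow, φ.apply_symm_apply, hΦ, hΦ] at h1
    have h2 : Φ (X 0) ^ (d * B) * f' = X 0 ^ d * -Φ u := by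
      apply incl_injective (d := d) (f := f')
      simp only [map_mul, map_pow, map_neg]
      linear_combination (incl d f' (Φ (X 0)) ^ (d * B)) * incl_X0_pow_mul_yCoord (d := d) (f := f')
        - (incl d f' (X 0) ^ d) * h1
    have h3 : X 0 ∣ Φ (X 0) ^ (d * B) * f' := by
      rw [h2]
      exact (dvd_pow_self _ hd0).mul_right _
    rcases hprime.dvd_or_dvd h3 with h | h
    · exact hprime.dvd_of_dvd_pow h
    · exact absurd (ev0_eq_zero_iff.mpr h) hf0
  have hirr : Irreducible (Φ (X 0)) := (MulEquiv.irreducible_iff Φ).mpr hprime.irreducible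
  obtain ⟨u, hu⟩ := (hprime.irreducible.associated_of_dvd hirr hdvd)
  obtain ⟨μ, hμ, hμu⟩ := MvPolynomial.isUnit_iff_eq_C_of_isReduced.mp u.isUnit
  obtain ⟨μ, rfl⟩ := hμ
  refine ⟨Φ, μ, ?_, ?_⟩
  · rw [← hu, hμu, mul_comm]
  · refine mem_centerIdeal_of_incl_eq hd0 hf0
      (a := - (incl d f' (C (μ : ℂ)) ^ d * φ (yCoord d f))) ?_
    have h1 := congrArg φ (incl_X0_pow_mul_yCoord (d := d) (f := f))
    rw [map_mul, map_pow, map_neg, hΦ, hΦ, ← hu, hμu, map_mul] at h1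
    linear_combination h1

theorem exists_algHom (Φ : Poly3 ≃ₐ[ℂ] Poly3) (μ : ℂˣ) (hx : Φ (X 0) = C (μ : ℂ) * X 0)
    (hf : Φ f ∈ centerIdeal d f') : ∃ ψ : CoordinateRing d f →ₐ[ℂ] CoordinateRing d f',
      ∀ p, ψ (incl d f p) = incl d f' (Φ p) := by
  obtain ⟨a, b, hab⟩ := mem_centerIdeal.mp hf
  refine ⟨coordinateRingLift ((incl d f').comp (Φ : Poly3 →ₐ[ℂ] Poly3))
    (incl d f' (C (((μ⁻¹ : ℂˣ) : ℂ) ^ d)) * (incl d f' b * yCoord d f' - incl d f' a)) ?_, fun p => ?_⟩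
  · have h1 : (C (μ : ℂ) * C ((μ⁻¹ : ℂˣ) : ℂ) : Poly3) = 1 := by
      rw [← C_mul]
      simp
    have h3 : incl d f' (C (μ : ℂ)) ^ d * incl d f' (C ((μ⁻¹ : ℂˣ) : ℂ)) ^ d = 1 := by
      rw [← mul_pow, ← map_mul, h1, map_one, one_pow]
    change incl d f' (Φ (X 0)) ^ d * _ + incl d f' (Φ f) = 0
    rw [hx, hab]
    simp only [map_mul, map_pow, map_add]
    linear_combination (incl d f' (X 0) ^ d * (incl d f' b * yCoord d f' - incl d f' a)) * h3 +
      incl d f' b * incl_X0_pow_mul_yCoord (d := d) (f := f')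
  · simp

theorem nonempty_algEquiv (hd : d ≠ 0) (hf0 : ev0 f ≠ 0) (hf0' : ev0 f' ≠ 0)
    (Φ : Poly3 ≃ₐ[ℂ] Poly3) (μ : ℂˣ) (hx : Φ (X 0) = C (μ : ℂ) * X 0)
    (hf : Φ f ∈ centerIdeal d f') (hf' : Φ.symm f' ∈ centerIdeal d f) :
    Nonempty (CoordinateRing d f ≃ₐ[ℂ] CoordinateRing d f') := by
  have hx' : Φ.symm (X 0) = C ((μ⁻¹ : ℂˣ) : ℂ) * X 0 := by
    rw [AlgEquiv.symm_apply_eq, map_mul, hx, ← mul_assoc, ← algebraMap_eq, AlgEquiv.commutes,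
      ← map_mul]
    simp
  obtain ⟨ψ, hψ⟩ := exists_algHom Φ μ hx hf
  obtain ⟨ψ', hψ'⟩ := exists_algHom Φ.symm μ⁻¹ hx' hf'
  have hcomp : ∀ {f : Poly3} (_ : ev0 f ≠ 0) (χ : CoordinateRing d f →ₐ[ℂ] CoordinateRing d f),
      (∀ p, χ (incl d f p) = incl d f p) → χ = AlgHom.id ℂ _ := by
    intro f hf0 χ hχ
    refine coordinateRing_algHom_ext hχ ?_
    rw [← sub_eq_zero]
    apply eq_zero_of_X0_pow_mul hd hf0 d
    have h1 := congrArg χ (incl_X0_pow_mul_yCoord (d := d) (f := f))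
    rw [map_mul, map_pow, map_neg, hχ, hχ] at h1
    rw [mul_sub, h1, AlgHom.id_apply, incl_X0_pow_mul_yCoord, sub_self]
  exact ⟨AlgEquiv.ofAlgHom ψ ψ' (hcomp hf0' _ fun p => by simp [hψ, hψ'])
    (hcomp hf0 _ fun p => by simp [hψ, hψ'])⟩

end Isomorphisms

section Calculus

open MvPolynomial

/-- The Poisson bracket `∂p/∂z * ∂q/∂t - ∂p/∂t * ∂q/∂z` of `ℂ[x, z, t]` over `ℂ[x]`. -/
noncomputable def bracket (p q : Poly3) : Poly3 :=
  pderiv 1 p * pderiv 2 q - pderiv 2 p * pderiv 1 q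

/-- The Poisson bracket of `ℂ[z, t]`. -/
noncomputable def planeBracket (p q : Poly2) : Poly2 :=
  pderiv 0 p * pderiv 1 q - pderiv 1 p * pderiv 0 q

theorem ev0_pderiv_succ (i : Fin 2) (p : Poly3) : ev0 (pderiv i.succ p) = pderiv i (ev0 p) := by
  induction p using MvPolynomial.induction_on with
  | C a => simp [← algebraMap_eq]
  | add p q hp hq => simp only [map_add, hp, hq]
  | mul_X p j hp =>
    rw [map_mul ev0, pderiv_mul, pderiv_mul, map_add, map_mul ev0, map_mul ev0, hp]
    congr 2
    fin_cases i <;> fin_cases j <;> simp [pderiv_X, ev0]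

theorem ev0_pderiv_one (p : Poly3) : ev0 (pderiv 1 p) = pderiv 0 (ev0 p) := ev0_pderiv_succ 0 p

theorem ev0_pderiv_two (p : Poly3) : ev0 (pderiv 2 p) = pderiv 1 (ev0 p) := ev0_pderiv_succ 1 p

theorem ev0_bracket (p q : Poly3) : ev0 (bracket p q) = planeBracket (ev0 p) (ev0 q) := by
  simp only [bracket, planeBracket, map_sub, map_mul, ev0_pderiv_one, ev0_pderiv_two]

/-- The first order Taylor formula modulo `x ^ (m + 1)` for endomorphisms congruent to the
identity modulo `x ^ m`. -/
theorem exists_taylor {m : ℕ} (hm : m ≠ 0) (Φ : Poly3 →ₐ[ℂ] Poly3) (hx : Φ (X 0) = X 0) {a b : Poly3}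
    (hz : Φ (X 1) = X 1 + X 0 ^ m * a) (ht : Φ (X 2) = X 2 + X 0 ^ m * b) (p : Poly3) :
    ∃ e, Φ p = p + X 0 ^ m * (a * pderiv 1 p + b * pderiv 2 p) + X 0 ^ (m + 1) * e := by
  obtain ⟨m, rfl⟩ := Nat.exists_eq_add_of_le' (Nat.one_le_iff_ne_zero.mpr hm)
  have hX : ∀ i, Φ (X i) = X i + X 0 ^ (m + 1) * (a * pderiv 1 (X i) + b * pderiv 2 (X i)) := by
    intro i
    fin_cases i
    · simpa [pderiv_X] using hx
    · simpa [pderiv_X] using hz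
    · simpa [pderiv_X] using ht
  induction p using MvPolynomial.induction_on with
  | C c => exact ⟨0, by simp [← algebraMap_eq]⟩
  | add p q hp hq =>
    obtain ⟨e, he⟩ := hp
    obtain ⟨e', he'⟩ := hq
    refine ⟨e + e', ?_⟩
    rw [map_add, he, he']
    simp only [map_add]
    ring
  | mul_X p i hp =>
    obtain ⟨e, he⟩ := hp
    refine ⟨e * Φ (X i) + X 0 ^ m * ((a * pderiv 1 p + b * pderiv 2 p) *
      (a * pderiv 1 (X i) + b * pderiv 2 (X i))), ?_⟩
    rw [map_mul, he, hX, pderiv_mul, pderiv_mul]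
    ring

theorem pderiv_curvePoly_zero (k l : ℕ) :
    pderiv 0 (curvePoly ℂ k l) = C (k : ℂ) * X 0 ^ (k - 1) := by
  simp [curvePoly, pderiv_X]

theorem pderiv_curvePoly_one (k l : ℕ) :
    pderiv 1 (curvePoly ℂ k l) = C (l : ℂ) * X 1 ^ (l - 1) := by
  simp [curvePoly, pderiv_X]

theorem planeBracket_curvePoly (k l : ℕ) (p : Poly2) : planeBracket p (curvePoly ℂ k l) =
    pderiv 0 p * (C (l : ℂ) * X 1 ^ (l - 1)) - pderiv 1 p * (C (k : ℂ) * X 0 ^ (k - 1)) := by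
  rw [planeBracket, pderiv_curvePoly_zero, pderiv_curvePoly_one]

/-- The space of the polynomials `{p, r₀} + u * r₀`. -/
noncomputable def tangentSpace (k l : ℕ) : Submodule ℂ Poly2 where
  carrier := {h | ∃ p u, h = planeBracket p (curvePoly ℂ k l) + u * curvePoly ℂ k l}
  add_mem' := by
    rintro _ _ ⟨p, u, rfl⟩ ⟨q, v, rfl⟩
    exact ⟨p + q, u + v, by simp only [planeBracket, map_add]; ring⟩
  zero_mem' := ⟨0, 0, by simp [planeBracket]⟩
  smul_mem' := by
    rintro c _ ⟨p, u, rfl⟩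
    exact ⟨c • p, c • u, by
      simp only [planeBracket, Derivation.map_smul]
      simp only [smul_eq_C_mul]
      ring⟩

theorem planeBracket_mem_tangentSpace (k l : ℕ) (p : Poly2) :
    planeBracket p (curvePoly ℂ k l) ∈ tangentSpace k l := ⟨p, 0, by simp⟩

theorem mul_mem_tangentSpace (k l : ℕ) (u : Poly2) :
    u * curvePoly ℂ k l ∈ tangentSpace k l := ⟨0, u, by simp [planeBracket]⟩

theorem planeBracket_monomial (k l A B : ℕ) :
    planeBracket (X 0 ^ A * X 1 ^ B) (curvePoly ℂ k l) =
      C ((l * A : ℕ) : ℂ) * (X 0 ^ (A - 1) * X 1 ^ (B + (l - 1))) -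
      C ((k * B : ℕ) : ℂ) * (X 0 ^ (A + (k - 1)) * X 1 ^ (B - 1)) := by
  rw [planeBracket_curvePoly]
  simp only [pderiv_mul, pderiv_pow, pderiv_X, map_natCast, Nat.cast_mul, map_mul]
  simp
  ring

theorem monomial_mem_tangentSpace_of_left {k l : ℕ} (hk : 2 ≤ k) (hl : 2 ≤ l) {a b : ℕ}
    (ha : k - 1 ≤ a) : (X 0 ^ a * X 1 ^ b : Poly2) ∈ tangentSpace k l := by
  obtain ⟨A, rfl⟩ := Nat.exists_eq_add_of_le' ha
  have h1 := planeBracket_mem_tangentSpace k l (X 0 ^ A * X 1 ^ (b + 1))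
  rw [planeBracket_monomial, Nat.add_sub_cancel] at h1
  have hne : ((k * (b + 1) + l * A : ℕ) : ℂ) ≠ 0 := by
    exact_mod_cast by positivity
  rw [← Submodule.smul_mem_iff _ hne]
  have h2 : C ((l * A : ℕ) : ℂ) * (X 0 ^ (A - 1) * X 1 ^ (b + 1 + (l - 1)) +
      X 0 ^ (A + (k - 1)) * X 1 ^ b) ∈ tangentSpace k l := by
    rcases A with _ | A
    · simp
    · have := mul_mem_tangentSpace k l (C ((l * (A + 1) : ℕ) : ℂ) * (X 0 ^ A * X 1 ^ b))
      convert this using 1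
      rw [Nat.add_sub_cancel, curvePoly, show b + 1 + (l - 1) = b + l by omega,
        show A + 1 + (k - 1) = A + k by omega]
      ring
  have h3 := sub_mem h2 h1
  convert h3 using 1
  rw [smul_eq_C_mul, Nat.cast_add, map_add]
  ring

theorem monomial_mem_tangentSpace_of_right {k l : ℕ} (hk : 2 ≤ k) (hl : 2 ≤ l) {a b : ℕ}
    (hb : l - 1 ≤ b) : (X 0 ^ a * X 1 ^ b : Poly2) ∈ tangentSpace k l := by
  obtain ⟨B, rfl⟩ := Nat.exists_eq_add_of_le' hb
  have h1 := planeBracket_mem_tangentSpace k l (X 0 ^ (a + 1) * X 1 ^ B)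
  rw [planeBracket_monomial, Nat.add_sub_cancel] at h1
  have hne : ((l * (a + 1) + k * B : ℕ) : ℂ) ≠ 0 := by
    exact_mod_cast by positivity
  rw [← Submodule.smul_mem_iff _ hne]
  have h2 : C ((k * B : ℕ) : ℂ) * (X 0 ^ (a + 1 + (k - 1)) * X 1 ^ (B - 1) +
      X 0 ^ a * X 1 ^ (B + (l - 1))) ∈ tangentSpace k l := by
    rcases B with _ | B
    · simp
    · have := mul_mem_tangentSpace k l (C ((k * (B + 1) : ℕ) : ℂ) * (X 0 ^ a * X 1 ^ B))
      convert this using 1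
      rw [Nat.add_sub_cancel, curvePoly, show a + 1 + (k - 1) = a + k by omega,
        show B + 1 + (l - 1) = B + l by omega]
      ring
  have h3 := add_mem h2 h1
  convert h3 using 1
  rw [smul_eq_C_mul, Nat.cast_add, map_add]
  ring

/-- The monomials `z ^ i * t ^ j` with `i ≤ k - 2` and `j ≤ l - 2` span a complement of the
space of all `{p, r₀} + u * r₀`. -/
theorem exists_sub_mem_tangentSpace {k l : ℕ} (hk : 2 ≤ k) (hl : 2 ≤ l) (h : Poly2) :
    ∃ c : Fin (k - 1) × Fin (l - 1) → ℂ,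
      h - ∑ p, C (c p) * (X 0 ^ (p.1 : ℕ) * X 1 ^ (p.2 : ℕ)) ∈ tangentSpace k l := by
  induction h using MvPolynomial.induction_on' with
  | monomial m a =>
    rw [monomial_fin_two]
    by_cases hm : m 0 < k - 1 ∧ m 1 < l - 1
    · refine ⟨Pi.single (⟨m 0, hm.1⟩, ⟨m 1, hm.2⟩) a, ?_⟩
      rw [Finset.sum_eq_single (⟨m 0, hm.1⟩, ⟨m 1, hm.2⟩)]
      · simp
      · intro p _ hp
        rw [Pi.single_eq_of_ne hp, C_0, zero_mul]
      · simp
    · refine ⟨0, ?_⟩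
      simp only [Pi.zero_apply, C_0, zero_mul, Finset.sum_const_zero, sub_zero]
      rw [← smul_eq_C_mul]
      apply Submodule.smul_mem
      rcases not_and_or.mp hm with h | h
      · exact monomial_mem_tangentSpace_of_left hk hl (not_lt.mp h)
      · exact monomial_mem_tangentSpace_of_right hk hl (not_lt.mp h)
  | add p q hp hq =>
    obtain ⟨c, hc⟩ := hp
    obtain ⟨c', hc'⟩ := hq
    refine ⟨c + c', ?_⟩
    convert add_mem hc hc' using 1
    simp only [Pi.add_apply, C_add, add_mul, Finset.sum_add_distrib]
    ring

/-- The coefficients of a polynomial all of whose values lie in a subspace lie in that subspace. -/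
theorem mem_of_forall_sum_smul_mem {M : Type*} [AddCommGroup M] [Module ℂ M] (W : Submodule ℂ M)
    {n : ℕ} (v : ℕ → M) (h : ∀ ζ : ℂ, ∑ j ∈ Finset.range n, ζ ^ j • v j ∈ W) {j : ℕ} (hj : j < n) :
    v j ∈ W := by
  rw [← Submodule.Quotient.mk_eq_zero, ← Module.forall_dual_apply_eq_zero_iff ℂ]
  intro φ
  set P : Polynomial ℂ := ∑ i ∈ Finset.range n,
    Polynomial.C (φ (Submodule.Quotient.mk (v i))) * Polynomial.X ^ i with hP
  have hP0 : P = 0 := by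
    apply Polynomial.funext
    intro ζ
    have h1 := congrArg φ ((Submodule.Quotient.mk_eq_zero W).mpr (h ζ))
    rw [← Submodule.mkQ_apply, map_sum, map_sum, map_zero] at h1
    rw [hP, Polynomial.eval_finsetSum, Polynomial.eval_zero, ← h1]
    refine Finset.sum_congr rfl fun i _ => ?_
    rw [Polynomial.eval_mul, Polynomial.eval_C, Polynomial.eval_pow, Polynomial.eval_X, map_smul,
      map_smul, smul_eq_mul, Submodule.mkQ_apply, mul_comm]
  have h2 := congrArg (fun Q => Polynomial.coeff Q j) hP0
  simp only [hP, Polynomial.finsetSum_coeff, Polynomial.coeff_C_mul_X_pow, Finset.sum_ite_eq,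
    Finset.mem_range, hj, if_true, Polynomial.coeff_zero] at h2
  exact h2

theorem mem_span_linear_pow (p : Poly2) : p ∈ Submodule.span ℂ
    (Set.range fun ζ : ℂ × ℕ => (X 0 + C ζ.1 * X 1 : Poly2) ^ ζ.2) := by
  induction p using MvPolynomial.induction_on' with
  | monomial m a =>
    rw [monomial_fin_two, ← smul_eq_C_mul]
    apply Submodule.smul_mem
    have hne : ((Nat.choose (m 0 + m 1) (m 1) : ℕ) : ℂ) ≠ 0 := by
      exact_mod_cast (Nat.choose_pos (by omega)).ne'
    rw [← Submodule.smul_mem_iff _ hne]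
    have := mem_of_forall_sum_smul_mem (Submodule.span ℂ
      (Set.range fun ζ : ℂ × ℕ => (X 0 + C ζ.1 * X 1 : Poly2) ^ ζ.2)) (n := m 0 + m 1 + 1)
      (fun j => ((Nat.choose (m 0 + m 1) j : ℕ) : ℂ) • (X 0 ^ (m 0 + m 1 - j) * X 1 ^ j))
      (fun ζ => by
        refine Submodule.subset_span ⟨(ζ, m 0 + m 1), ?_⟩
        simp only
        rw [add_comm, add_pow]
        refine Finset.sum_congr rfl fun j _ => ?_
        simp only [smul_eq_C_mul, mul_pow, C_pow, map_natCast]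
        ring) (j := m 1) (by omega)
    simpa using this
  | add p q hp hq => exact add_mem hp hq

end Calculus

section Deformation

open MvPolynomial

variable {d k l : ℕ}

/-- The coordinate rings of the hypersurfaces given by `f` and `f'` are isomorphic. -/
def CoordEquiv (d : ℕ) (f f' : Poly3) : Prop :=
  Nonempty (CoordinateRing d f ≃ₐ[ℂ] CoordinateRing d f')

theorem CoordEquiv.trans {f g h : Poly3} (h1 : CoordEquiv d f g) (h2 : CoordEquiv d g h) :
    CoordEquiv d f h := ⟨h1.some.trans h2.some⟩

theorem CoordEquiv.symm {f g : Poly3} (h1 : CoordEquiv d f g) : CoordEquiv d g f :=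
  ⟨h1.some.symm⟩

theorem CoordEquiv.refl (f : Poly3) : CoordEquiv d f f := ⟨AlgEquiv.refl⟩

theorem coordEquiv_of_mem_centerIdeal (hd : d ≠ 0) {f f' : Poly3} (hf0 : ev0 f ≠ 0)
    (hf0' : ev0 f' ≠ 0) (h : f ∈ centerIdeal d f') (h' : f' ∈ centerIdeal d f) :
    CoordEquiv d f f' :=
  nonempty_algEquiv hd hf0 hf0' AlgEquiv.refl 1 (by simp) h h'

theorem coordEquiv_add_X0_pow_mul (hd : d ≠ 0) {f : Poly3} (hf0 : ev0 f ≠ 0) (e : Poly3) :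
    CoordEquiv d f (f + X 0 ^ d * e) := by
  refine coordEquiv_of_mem_centerIdeal hd hf0 ?_ ?_ ?_
  · simpa [hd] using hf0
  · exact mem_centerIdeal.mpr ⟨-e, 1, by ring⟩
  · exact mem_centerIdeal.mpr ⟨e, 1, by ring⟩

theorem coordEquiv_unit_mul (hd : d ≠ 0) {f : Poly3} (hf0 : ev0 f ≠ 0) (v : Poly3) :
    CoordEquiv d f ((1 + X 0 * v) * f) := by
  refine coordEquiv_of_mem_centerIdeal hd hf0 (by simpa using hf0) ?_ ?_
  · obtain ⟨s, hs⟩ := sub_dvd_pow_sub_pow (1 : Poly3) (-(X 0 * v)) d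
    refine mem_centerIdeal.mpr ⟨(-v) ^ d * f, s, ?_⟩
    rw [one_pow, sub_neg_eq_add, ← mul_neg, mul_pow] at hs
    linear_combination f * hs
  · exact mem_centerIdeal.mpr ⟨0, 1 + X 0 * v, by ring⟩

theorem coordEquiv_apply (hd : d ≠ 0) {f : Poly3} (Φ : Poly3 ≃ₐ[ℂ] Poly3) (μ : ℂˣ)
    (hx : Φ (X 0) = C (μ : ℂ) * X 0) (hf0 : ev0 f ≠ 0) (hf0' : ev0 (Φ f) ≠ 0) :
    CoordEquiv d f (Φ f) :=
  nonempty_algEquiv hd hf0 hf0' Φ μ hx self_mem_centerIdeal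
    (by rw [Φ.symm_apply_apply]; exact self_mem_centerIdeal)

/-- The endomorphism `z ↦ z - ζ x ^ m c L ^ n`, `t ↦ t + x ^ m c L ^ n` where `L = z + ζ t`. -/
noncomputable def shearHom (m n : ℕ) (ζ c : ℂ) : Poly3 →ₐ[ℂ] Poly3 :=
  aeval ![X 0, X 1 + X 0 ^ m * (-C ζ * (C c * (X 1 + C ζ * X 2) ^ n)),
    X 2 + X 0 ^ m * (C c * (X 1 + C ζ * X 2) ^ n)]

theorem shearHom_linear (m n : ℕ) (ζ c : ℂ) :
    shearHom m n ζ c (X 1 + C ζ * X 2) = X 1 + C ζ * X 2 := by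
  rw [← algebraMap_eq]
  simp only [shearHom, map_add, map_mul, AlgHom.commutes, aeval_X]
  simp only [algebraMap_eq, Matrix.cons_val]
  ring

theorem shearHom_comp (m n : ℕ) (ζ c c' : ℂ) (h : c + c' = 0) :
    (shearHom m n ζ c).comp (shearHom m n ζ c') = AlgHom.id ℂ _ := by
  have hC : (C c + C c' : Poly3) = 0 := by rw [← C_add, h, C_0]
  have hL := shearHom_linear m n ζ c
  have hCC : ∀ a : ℂ, shearHom m n ζ c (C a) = C a := fun a => by
    rw [← algebraMap_eq, AlgHom.commutes]
  rw [map_add, map_mul, hCC] at hL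
  have h0 : shearHom m n ζ c (X 0) = X 0 := by simp [shearHom]
  refine MvPolynomial.algHom_ext fun i => ?_
  rw [AlgHom.comp_apply]
  fin_cases i
  · simp [shearHom]
  · change shearHom m n ζ c (shearHom m n ζ c' (X 1)) = X 1
    conv_lhs => rw [shearHom.eq_def m n ζ c', aeval_X]
    simp only [Matrix.cons_val, map_add (shearHom m n ζ c), map_mul (shearHom m n ζ c),
      map_pow (shearHom m n ζ c), map_neg (shearHom m n ζ c), hCC, h0]
    rw [hL]
    simp only [shearHom, aeval_X, Matrix.cons_val]
    linear_combination (-C ζ * X 0 ^ m * (X 1 + C ζ * X 2) ^ n) * hC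
  · change shearHom m n ζ c (shearHom m n ζ c' (X 2)) = X 2
    conv_lhs => rw [shearHom.eq_def m n ζ c', aeval_X]
    simp only [Matrix.cons_val, map_add (shearHom m n ζ c), map_mul (shearHom m n ζ c),
      map_pow (shearHom m n ζ c), hCC, h0]
    rw [hL]
    simp only [shearHom, aeval_X, Matrix.cons_val]
    linear_combination (X 0 ^ m * (X 1 + C ζ * X 2) ^ n) * hC

/-- The automorphism underlying `shearHom`. -/
noncomputable def shear (m n : ℕ) (ζ c : ℂ) : Poly3 ≃ₐ[ℂ] Poly3 :=
  AlgEquiv.ofAlgHom (shearHom m n ζ c) (shearHom m n ζ (-c)) (shearHom_comp _ _ _ _ _ (by simp))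
    (shearHom_comp _ _ _ _ _ (by simp))

/-- Every hypersurface `f` with `f = r` modulo `x` has the same coordinate ring as
some `f'` with `f' = f + x ^ m * h` modulo `x ^ (m + 1)`. -/
def IsTrivialDeformation (d : ℕ) (r : Poly2) (m : ℕ) (h : Poly2) : Prop :=
  ∀ f, ev0 f = r → ∃ f', ev0 f' = r ∧ CoordEquiv d f f' ∧
    ∃ e, f' = f + X 0 ^ m * emb h + X 0 ^ (m + 1) * e

theorem IsTrivialDeformation.add {r h h' : Poly2} {m : ℕ} (H : IsTrivialDeformation d r m h)
    (H' : IsTrivialDeformation d r m h') : IsTrivialDeformation d r m (h + h') := by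
  intro f hf
  obtain ⟨g, hg, hfg, e, he⟩ := H f hf
  obtain ⟨g', hg', hfg', e', he'⟩ := H' g hg
  refine ⟨g', hg', hfg.trans hfg', e + e', ?_⟩
  rw [he', he, map_add]
  ring

theorem isTrivialDeformation_zero {r : Poly2} {m : ℕ} : IsTrivialDeformation d r m 0 :=
  fun f hf => ⟨f, hf, CoordEquiv.refl f, 0, by simp⟩

theorem isTrivialDeformation_mul (hd : d ≠ 0) {r : Poly2} (hr : r ≠ 0) {m : ℕ} (hm : m ≠ 0)
    (u : Poly2) : IsTrivialDeformation d r m (u * r) := by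
  obtain ⟨m, rfl⟩ := Nat.exists_eq_add_of_le' (Nat.one_le_iff_ne_zero.mpr hm)
  intro f hf
  obtain ⟨q, hq⟩ := exists_eq_emb_add f
  refine ⟨_, ?_, coordEquiv_unit_mul hd (hf ▸ hr) (X 0 ^ m * emb u), emb u * q, ?_⟩
  · simpa using hf
  · rw [hf] at hq
    rw [map_mul]
    linear_combination (X 0 ^ (m + 1) * emb u) * hq

theorem isTrivialDeformation_bracket_pow (hd : d ≠ 0) {r : Poly2} (hr : r ≠ 0) {m : ℕ}
    (hm : m ≠ 0) (ζ c : ℂ) (n : ℕ) :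
    IsTrivialDeformation d r m (planeBracket (c • (X 0 + C ζ * X 1) ^ n) r) := by
  intro f hf
  set w : Poly3 := C (n * c) * (X 1 + C ζ * X 2) ^ (n - 1) with hw
  have hx : shear m (n - 1) ζ (n * c) (X 0) = X 0 := by simp [shear, shearHom]
  have hz : shear m (n - 1) ζ (n * c) (X 1) = X 1 + X 0 ^ m * (-C ζ * w) := by
    simp [shear, shearHom, hw]
  have ht : shear m (n - 1) ζ (n * c) (X 2) = X 2 + X 0 ^ m * w := by
    simp [shear, shearHom, hw]
  obtain ⟨e, he⟩ := exists_taylor hm (shear m (n - 1) ζ (n * c)).toAlgHom hx hz ht f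
  replace he : shear m (n - 1) ζ (n * c) f = _ := he
  have hev : ev0 (shear m (n - 1) ζ (n * c) f) = r := by
    rw [he]
    simpa [hm] using hf
  obtain ⟨q, hq⟩ := exists_eq_emb_add (-C ζ * w * pderiv 1 f + w * pderiv 2 f)
  refine ⟨_, hev, coordEquiv_apply hd (shear m (n - 1) ζ (n * c)) 1 (by rw [hx]; simp)
    (hf ▸ hr) (by rw [hev]; exact hr), e + q, ?_⟩
  have hbr : planeBracket (c • (X 0 + C ζ * X 1) ^ n) r =
      ev0 (-C ζ * w * pderiv 1 f + w * pderiv 2 f) := by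
    have h1 : ∀ a : ℂ, ev0 (C a) = C a := fun a => by
      rw [← algebraMap_eq, AlgHom.commutes, algebraMap_eq]
    simp only [hw, map_add, map_mul, map_neg, map_pow, ev0_X1, ev0_X2, ev0_pderiv_one,
      ev0_pderiv_two, hf, h1, planeBracket, pderiv_pow, pderiv_mul, pderiv_C,
      smul_eq_C_mul]
    simp [pderiv_X]
    ring
  rw [he, hbr]
  linear_combination X 0 ^ m * hq

theorem isTrivialDeformation_of_mem_tangentSpace (hd : d ≠ 0) {m : ℕ} (hm : m ≠ 0) {h : Poly2}
    (hh : h ∈ tangentSpace k l) : IsTrivialDeformation d (curvePoly ℂ k l) m h := by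
  obtain ⟨p, u, rfl⟩ := hh
  refine IsTrivialDeformation.add ?_ (isTrivialDeformation_mul hd curvePoly_ne_zero hm u)
  suffices ∀ c : ℂ, IsTrivialDeformation d (curvePoly ℂ k l) m
      (planeBracket (c • p) (curvePoly ℂ k l)) by simpa using this 1
  induction mem_span_linear_pow p using Submodule.span_induction with
  | mem p hp =>
    obtain ⟨⟨ζ, n⟩, rfl⟩ := hp
    exact fun c => isTrivialDeformation_bracket_pow hd curvePoly_ne_zero hm ζ c n
  | zero =>
    intro c
    simpa [planeBracket] using isTrivialDeformation_zero
  | add p q _ _ hp hq =>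
    intro c
    convert (hp c).add (hq c) using 1
    simp only [planeBracket, smul_add, map_add]
    ring
  | smul a p _ hp =>
    intro c
    rw [smul_smul]
    exact hp (c * a)

/-- The polynomial `r₀ + ∑ a i j * z ^ i * t ^ j`, where `a i j ∈ ℂ[x]`. -/
noncomputable def versal (k l : ℕ) (a : Fin (k - 1) × Fin (l - 1) → Polynomial ℂ) : Poly3 :=
  emb (curvePoly ℂ k l) +
    ∑ p, Polynomial.aeval (X 0 : Poly3) (a p) * emb (X 0 ^ (p.1 : ℕ) * X 1 ^ (p.2 : ℕ))

theorem ev0_aeval_X0 (a : Polynomial ℂ) :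
    ev0 (Polynomial.aeval (X 0 : Poly3) a) = C (a.coeff 0) := by
  rw [← Polynomial.aeval_algHom_apply, ev0_X0, Polynomial.coeff_zero_eq_aeval_zero]
  conv_lhs => rw [← map_zero (algebraMap ℂ Poly2), Polynomial.aeval_algebraMap_apply]
  rfl

theorem ev0_versal {a : Fin (k - 1) × Fin (l - 1) → Polynomial ℂ} (ha : ∀ p, (a p).coeff 0 = 0) :
    ev0 (versal k l a) = curvePoly ℂ k l := by
  simp [versal, ev0_aeval_X0, ha]

/-- Every threefold is isomorphic to a member of the versal family. -/
theorem exists_coordEquiv_versal (hd : d ≠ 0) (hk : 2 ≤ k) (hl : 2 ≤ l) {f : Poly3}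
    (hf : ev0 f = curvePoly ℂ k l) : ∃ a : Fin (k - 1) × Fin (l - 1) → Polynomial ℂ,
      (∀ p, (a p).coeff 0 = 0) ∧ CoordEquiv d f (versal k l a) := by
  have key : ∀ m : ℕ, ∃ a : Fin (k - 1) × Fin (l - 1) → Polynomial ℂ, (∀ p, (a p).coeff 0 = 0) ∧
      ∃ f', ev0 f' = curvePoly ℂ k l ∧ CoordEquiv d f f' ∧
        ∃ e, f' = versal k l a + X 0 ^ (m + 1) * e := by
    intro m
    induction m with
    | zero =>
      refine ⟨0, by simp, f, hf, CoordEquiv.refl f, ?_⟩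
      obtain ⟨q, hq⟩ := exists_eq_emb_add f
      exact ⟨q, by rw [hq, hf]; simp [versal]⟩
    | succ m ih =>
      obtain ⟨a, ha, g, hg, hfg, e, he⟩ := ih
      obtain ⟨c, hc⟩ := exists_sub_mem_tangentSpace hk hl (-ev0 e)
      obtain ⟨g', hg', hgg', e', he'⟩ :=
        isTrivialDeformation_of_mem_tangentSpace hd (Nat.succ_ne_zero m) hc g hg
      obtain ⟨q, hq⟩ := exists_eq_emb_add e
      refine ⟨fun p => a p - Polynomial.C (c p) * Polynomial.X ^ (m + 1), fun p => ?_, g', hg',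
        hfg.trans hgg', e' + q, ?_⟩
      · simp [ha]
      · rw [he', he]
        simp only [versal, map_sub, map_mul, map_pow, map_neg, Polynomial.aeval_X, sub_mul,
          Finset.sum_sub_distrib, map_sum, Polynomial.aeval_C, Nat.succ_eq_add_one]
        have h1 : ∀ a : ℂ, emb (C a) = C a := fun a => by
          rw [← algebraMap_eq, AlgHom.commutes, algebraMap_eq]
        simp only [h1, algebraMap_eq, mul_sub, Finset.mul_sum]
        have h2 : ∀ p : Fin (k - 1) × Fin (l - 1),
            C (c p) * X 0 ^ (m + 1) * (emb (X 0) ^ (p.1 : ℕ) * emb (X 1) ^ (p.2 : ℕ)) =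
            X 0 ^ (m + 1) * (C (c p) * (emb (X 0) ^ (p.1 : ℕ) * emb (X 1) ^ (p.2 : ℕ))) :=
          fun p => by ring
        simp only [h2]
        linear_combination X 0 ^ (m + 1) * hq
  obtain ⟨a, ha, f', hf', hff', e, he⟩ := key (d - 1)
  rw [Nat.sub_add_cancel (Nat.one_le_iff_ne_zero.mpr hd)] at he
  refine ⟨a, ha, hff'.trans ?_⟩
  rw [he]
  exact (coordEquiv_add_X0_pow_mul hd (by rw [ev0_versal ha]; exact curvePoly_ne_zero) e).symm

end Deformation

section TruncatedExponential

open MvPolynomial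

theorem pderiv_pderiv_comm {σ : Type*} (i j : σ) (p : MvPolynomial σ ℂ) :
    pderiv i (pderiv j p) = pderiv j (pderiv i p) := by
  classical
  have h : ⁅(pderiv i : Derivation ℂ (MvPolynomial σ ℂ) (MvPolynomial σ ℂ)),
      (pderiv j : Derivation ℂ (MvPolynomial σ ℂ) (MvPolynomial σ ℂ))⁆ = 0 := by
    refine MvPolynomial.derivation_ext fun s => ?_
    rw [Derivation.commutator_apply]
    simp only [pderiv_X, Pi.single_apply]
    split_ifs <;> simp
  have := DFunLike.congr_fun h p
  rwa [Derivation.commutator_apply, Derivation.zero_apply, sub_eq_zero] at this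

/-- The bracket as a bilinear map. -/
noncomputable def bracketLinear : Poly3 →ₗ[ℂ] Poly3 →ₗ[ℂ] Poly3 :=
  LinearMap.mk₂ ℂ bracket (fun p q r => by simp only [bracket, map_add]; ring)
    (fun c p q => by
      simp only [bracket, Derivation.map_smul]
      simp only [smul_eq_C_mul]
      ring)
    (fun p q r => by simp only [bracket, map_add]; ring)
    (fun c p q => by
      simp only [bracket, Derivation.map_smul]
      simp only [smul_eq_C_mul]
      ring)

@[simp] theorem bracketLinear_apply (p q : Poly3) : bracketLinear p q = bracket p q := rfl

theorem bracket_X0_pow_mul_left (i : ℕ) (p q : Poly3) :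
    bracket (X 0 ^ i * p) q = X 0 ^ i * bracket p q := by
  simp [bracket, pderiv_X]
  ring

theorem bracket_X0_pow_mul_right (i : ℕ) (p q : Poly3) :
    bracket p (X 0 ^ i * q) = X 0 ^ i * bracket p q := by
  simp [bracket, pderiv_X]
  ring

/-- The Hamiltonian derivation `{g, ·}`. -/
noncomputable def hamiltonian (g : Poly3) : Derivation ℂ Poly3 Poly3 :=
  pderiv 1 g • pderiv 2 - pderiv 2 g • pderiv 1

@[simp] theorem hamiltonian_apply (g p : Poly3) : hamiltonian g p = bracket g p := rfl

theorem bracket_bracket (g p q : Poly3) :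
    bracket g (bracket p q) = bracket (bracket g p) q + bracket p (bracket g q) := by
  simp only [bracket, pderiv_mul, map_sub]
  rw [pderiv_pderiv_comm 2 1 p, pderiv_pderiv_comm 2 1 q, pderiv_pderiv_comm 2 1 g]
  ring

variable (δ : Derivation ℂ Poly3 Poly3)

/-- The `n`-th divided power of a derivation. -/
noncomputable def dividedPower (n : ℕ) (p : Poly3) : Poly3 := ((n.factorial : ℂ)⁻¹) • δ^[n] p

theorem iterate_apply_bilinear (B : Poly3 →ₗ[ℂ] Poly3 →ₗ[ℂ] Poly3)
    (hB : ∀ p q, δ (B p q) = B (δ p) q + B p (δ q)) (n : ℕ) (p q : Poly3) :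
    δ^[n] (B p q) = ∑ ij ∈ Finset.HasAntidiagonal.antidiagonal n, n.choose ij.1 • B (δ^[ij.1] p) (δ^[ij.2] q) := by
  induction n with
  | zero => simp
  | succ n ih =>
    rw [Finset.sum_antidiagonal_choose_succ_nsmul (fun i j => B (δ^[i] p) (δ^[j] q)) n]
    simp only [Function.iterate_succ_apply', ih, map_sum, map_nsmul, hB, smul_add,
      Finset.sum_add_distrib]
    rw [add_comm]
    congr 1
    refine Finset.sum_congr rfl fun ⟨i, j⟩ hij => ?_
    rw [n.choose_symm_of_eq_add (Finset.HasAntidiagonal.mem_antidiagonal.1 hij).symm]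

theorem dividedPower_bilinear (B : Poly3 →ₗ[ℂ] Poly3 →ₗ[ℂ] Poly3)
    (hB : ∀ p q, δ (B p q) = B (δ p) q + B p (δ q)) (n : ℕ) (p q : Poly3) :
    dividedPower δ n (B p q) = ∑ ij ∈ Finset.HasAntidiagonal.antidiagonal n,
      B (dividedPower δ ij.1 p) (dividedPower δ ij.2 q) := by
  rw [dividedPower, iterate_apply_bilinear δ B hB, Finset.smul_sum]
  refine Finset.sum_congr rfl fun ⟨i, j⟩ hij => ?_
  have hn := Finset.HasAntidiagonal.mem_antidiagonal.1 hij
  simp only at hn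
  subst hn
  simp only [dividedPower, map_smul, LinearMap.smul_apply, smul_smul]
  rw [← Nat.cast_smul_eq_nsmul ℂ, smul_smul]
  congr 1
  have h1 := Nat.add_choose_mul_factorial_mul_factorial i j
  have h2 : (((i + j).choose i : ℕ) : ℂ) * (i.factorial : ℂ) * (j.factorial : ℂ) =
      ((i + j).factorial : ℂ) := by
    rw [Nat.choose_symm_add]
    exact_mod_cast h1
  have hi : (i.factorial : ℂ) ≠ 0 := by exact_mod_cast i.factorial_ne_zero
  have hj : (j.factorial : ℂ) ≠ 0 := by exact_mod_cast j.factorial_ne_zero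
  have hij : ((i + j).factorial : ℂ) ≠ 0 := by exact_mod_cast (i + j).factorial_ne_zero
  field_simp
  rw [← h2]
  ring

/-- The exponential of `x ^ m * δ`, truncated at order `d`. -/
noncomputable def truncExp (d m : ℕ) (p : Poly3) : Poly3 :=
  ∑ n ∈ Finset.range d, X 0 ^ (m * n) * dividedPower δ n p

theorem dvd_truncExp_bilinear {d m : ℕ} (hm : m ≠ 0) (B : Poly3 →ₗ[ℂ] Poly3 →ₗ[ℂ] Poly3)
    (hB : ∀ p q, δ (B p q) = B (δ p) q + B p (δ q))
    (hX : ∀ i j p q, B (X 0 ^ i * p) (X 0 ^ j * q) = X 0 ^ (i + j) * B p q) (p q : Poly3) :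
    X 0 ^ d ∣ B (truncExp δ d m p) (truncExp δ d m q) - truncExp δ d m (B p q) := by
  set F : ℕ × ℕ → Poly3 := fun ij =>
    (X 0 : Poly3) ^ (m * ij.1 + m * ij.2) * B (dividedPower δ ij.1 p) (dividedPower δ ij.2 q) with hF
  have h1 : B (truncExp δ d m p) (truncExp δ d m q) =
      ∑ ij ∈ Finset.range d ×ˢ Finset.range d, F ij := by
    simp only [truncExp, map_sum, LinearMap.sum_apply, hX, Finset.sum_product]
    exact Finset.sum_comm
  have h2 : truncExp δ d m (B p q) =
      ∑ ij ∈ (Finset.range d ×ˢ Finset.range d) with ij.1 + ij.2 < d, F ij := by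
    rw [truncExp, ← Finset.sum_fiberwise_of_maps_to (g := fun ij : ℕ × ℕ => ij.1 + ij.2)
      (t := Finset.range d)]
    · refine Finset.sum_congr rfl fun n hn => ?_
      rw [dividedPower_bilinear δ B hB, Finset.mul_sum]
      refine Finset.sum_congr ?_ fun ij hij => ?_
      · ext ij
        simp only [Finset.HasAntidiagonal.mem_antidiagonal, Finset.mem_filter, Finset.mem_product,
          Finset.mem_range] at hn ⊢
        omega
      · simp only [Finset.mem_filter] at hij
        rw [hF, ← hij.2, mul_add]
    · intro ij hij
      simp only [Finset.mem_filter] at hij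
      simpa using hij.2
  rw [h1, h2, ← Finset.sum_filter_add_sum_filter_not _ (fun ij : ℕ × ℕ => ij.1 + ij.2 < d),
    add_sub_cancel_left]
  refine Finset.dvd_sum fun ij hij => ?_
  simp only [Finset.mem_filter] at hij
  refine Dvd.dvd.mul_right (pow_dvd_pow _ ?_) _
  rw [← mul_add]
  exact (not_lt.mp hij.2).trans (Nat.le_mul_of_pos_left _ (Nat.pos_of_ne_zero hm))

theorem truncExp_of_apply_eq_zero {d m : ℕ} (hd : d ≠ 0) {p : Poly3} (hp : δ p = 0) :
    truncExp δ d m p = p := by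
  obtain ⟨d, rfl⟩ := Nat.exists_eq_add_of_le' (Nat.one_le_iff_ne_zero.mpr hd)
  rw [truncExp, Finset.sum_range_succ']
  have : ∀ n, dividedPower δ (n + 1) p = 0 := fun n => by
    rw [dividedPower, Function.iterate_succ_apply, hp, iterate_derivation_zero, smul_zero]
  simp only [this, mul_zero, Finset.sum_const_zero]
  simp [dividedPower]

theorem truncExp_eq {d m : ℕ} (hd : 2 ≤ d) (hm : m ≠ 0) (p : Poly3) :
    ∃ e, truncExp δ d m p = p + X 0 ^ m * δ p + X 0 ^ (m + 1) * e := by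
  obtain ⟨d, rfl⟩ := Nat.exists_eq_add_of_le' hd
  refine ⟨∑ n ∈ Finset.range d, X 0 ^ (m * (n + 2) - (m + 1)) * dividedPower δ (n + 2) p, ?_⟩
  rw [truncExp, Finset.sum_range_succ', Finset.sum_range_succ', Finset.mul_sum]
  have : ∀ n, X 0 ^ (m + 1) * (X 0 ^ (m * (n + 2) - (m + 1)) * dividedPower δ (n + 2) p) =
      X 0 ^ (m * (n + 2)) * dividedPower δ (n + 2) p := by
    intro n
    rw [← mul_assoc, ← pow_add]
    congr 2
    have : m + 1 ≤ m * (n + 2) := by nlinarith [Nat.pos_of_ne_zero hm]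
    omega
  simp only [this]
  simp [dividedPower]
  ring

theorem dvd_truncExp {d m : ℕ} {f : Poly3} (hf : f ∣ δ f) : f ∣ truncExp δ d m f := by
  refine Finset.dvd_sum fun n _ => Dvd.dvd.mul_left ?_ _
  rw [dividedPower, smul_eq_C_mul]
  refine Dvd.dvd.mul_left ?_ _
  suffices ∀ n (g : Poly3), f ∣ g → f ∣ δ^[n] g from this n f dvd_rfl
  intro n
  induction n with
  | zero => exact fun g hg => hg
  | succ n ih =>
    rintro _ ⟨g, rfl⟩
    rw [Function.iterate_succ_apply]
    apply ih
    rw [δ.leibniz]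
    exact dvd_add (Dvd.intro _ rfl) (hf.mul_left _)

/-- The endomorphism of `ℂ[x, z, t]` given by the truncated exponential of `x ^ m * δ`. -/
noncomputable def truncExpHom (d m : ℕ) : Poly3 →ₐ[ℂ] Poly3 :=
  aeval fun i => truncExp δ d m (X i)

theorem dvd_truncExpHom_sub {d m : ℕ} (hd : d ≠ 0) (hm : m ≠ 0) (p : Poly3) :
    X 0 ^ d ∣ truncExpHom δ d m p - truncExp δ d m p := by
  induction p using MvPolynomial.induction_on with
  | C c =>
    rw [truncExp_of_apply_eq_zero δ hd (by simp), ← algebraMap_eq, AlgHom.commutes, sub_self]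
    exact dvd_zero _
  | add p q hp hq =>
    have : truncExp δ d m (p + q) = truncExp δ d m p + truncExp δ d m q := by
      simp only [truncExp, dividedPower, iterate_derivation_add, smul_add, mul_add,
        Finset.sum_add_distrib]
    rw [map_add, this, add_sub_add_comm]
    exact dvd_add hp hq
  | mul_X p i hp =>
    have h1 := dvd_truncExp_bilinear δ (d := d) hm (LinearMap.mul ℂ Poly3) (fun p q => by
      simp only [LinearMap.mul_apply', Derivation.leibniz, smul_eq_mul]
      ring) (fun i j p q => by simp only [LinearMap.mul_apply']; ring) p (X i)
    simp only [LinearMap.mul_apply'] at h1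
    have h2 : truncExpHom δ d m (p * X i) - truncExp δ d m (p * X i) =
        (truncExpHom δ d m p - truncExp δ d m p) * truncExp δ d m (X i) +
        (truncExp δ d m p * truncExp δ d m (X i) - truncExp δ d m (p * X i)) := by
      rw [map_mul]
      simp only [truncExpHom, aeval_X]
      ring
    rw [h2]
    exact dvd_add (hp.mul_right _) h1

/-- For every `g` there is an endomorphism of `ℂ[x, z, t]` over `ℂ[x]`, congruent to
`id + x ^ m {g, ·}` modulo `x ^ (m + 1)`, which modulo `x ^ d` preserves the bracket and
the ideals generated by elements `f` dividing `{g, f}`. -/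
theorem exists_hamiltonian_flow {d m : ℕ} (hd : 2 ≤ d) (hm : m ≠ 0) (g : Poly3) :
    ∃ G : Poly3 →ₐ[ℂ] Poly3, G (X 0) = X 0 ∧
      (∀ i, ∃ e, G (X i) = X i + X 0 ^ m * bracket g (X i) + X 0 ^ (m + 1) * e) ∧
      X 0 ^ d ∣ bracket (G (X 1)) (G (X 2)) - 1 ∧
      ∀ f, f ∣ bracket g f → ∃ u v, G f = u * f + X 0 ^ d * v := by
  have hX0 : hamiltonian g (X 0) = 0 := by simp [bracket, pderiv_X]
  have hd0 : d ≠ 0 := by omega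
  refine ⟨truncExpHom (hamiltonian g) d m, ?_, fun i => ?_, ?_, fun f hf => ?_⟩
  · rw [truncExpHom, aeval_X, truncExp_of_apply_eq_zero _ hd0 hX0]
  · rw [truncExpHom, aeval_X]
    exact truncExp_eq _ hd hm _
  · have h1 := dvd_truncExp_bilinear (hamiltonian g) (d := d) hm bracketLinear
      (fun p q => bracket_bracket g p q)
      (fun i j p q => by
        simp only [bracketLinear_apply, bracket_X0_pow_mul_left, bracket_X0_pow_mul_right]
        ring) (X 1) (X 2)
    have h2 : bracket (X 1 : Poly3) (X 2) = 1 := by simp [bracket, pderiv_X]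
    rw [bracketLinear_apply, bracketLinear_apply, h2,
      truncExp_of_apply_eq_zero _ hd0 (Derivation.map_one_eq_zero _)] at h1
    simpa only [truncExpHom, aeval_X] using h1
  · obtain ⟨v, hv⟩ := dvd_truncExpHom_sub (hamiltonian g) hd0 hm f
    obtain ⟨u, hu⟩ := dvd_truncExp (d := d) (m := m) (hamiltonian g) hf
    exact ⟨u, v, by rw [mul_comm u, ← hu, ← hv]; ring⟩

end TruncatedExponential

section NormalForm

open MvPolynomial

variable {k l : ℕ}

/-- The polynomial `∑ c i j (r₀) * z ^ i * t ^ j`. -/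
noncomputable def ofNormalForm (k l : ℕ) (c : ℕ × ℕ →₀ Polynomial ℂ) : Poly2 :=
  c.sum fun ij P => Polynomial.aeval (curvePoly ℂ k l) P * (X 0 ^ ij.1 * X 1 ^ ij.2)

theorem ofNormalForm_add (c c' : ℕ × ℕ →₀ Polynomial ℂ) :
    ofNormalForm k l (c + c') = ofNormalForm k l c + ofNormalForm k l c' :=
  Finsupp.sum_add_index' (by simp) (fun ij P Q => by rw [map_add, add_mul])

theorem ofNormalForm_single (ij : ℕ × ℕ) (P : Polynomial ℂ) :
    ofNormalForm k l (Finsupp.single ij P) =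
      Polynomial.aeval (curvePoly ℂ k l) P * (X 0 ^ ij.1 * X 1 ^ ij.2) :=
  Finsupp.sum_single_index (by simp)

/-- `ℂ[z, t]` is generated by the `z ^ i * t ^ j`, `i < k`, as a module over `ℂ[r₀]`. -/
theorem exists_ofNormalForm (hk : k ≠ 0) (f : Poly2) :
    ∃ c : ℕ × ℕ →₀ Polynomial ℂ, (∀ ij ∈ c.support, ij.1 < k) ∧ ofNormalForm k l c = f := by
  have hadd : ∀ {f g : Poly2},
      (∃ c : ℕ × ℕ →₀ Polynomial ℂ, (∀ ij ∈ c.support, ij.1 < k) ∧ ofNormalForm k l c = f) →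
      (∃ c : ℕ × ℕ →₀ Polynomial ℂ, (∀ ij ∈ c.support, ij.1 < k) ∧ ofNormalForm k l c = g) →
      ∃ c : ℕ × ℕ →₀ Polynomial ℂ, (∀ ij ∈ c.support, ij.1 < k) ∧ ofNormalForm k l c = f + g := by
    rintro f g ⟨c, hc, rfl⟩ ⟨c', hc', rfl⟩
    refine ⟨c + c', fun ij hij => ?_, ofNormalForm_add _ _⟩
    rcases Finset.mem_union.mp (Finsupp.support_add hij) with h | h
    · exact hc _ h
    · exact hc' _ h
  have hmon : ∀ (a b : ℕ) (P : Polynomial ℂ), ∃ c : ℕ × ℕ →₀ Polynomial ℂ,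
      (∀ ij ∈ c.support, ij.1 < k) ∧ ofNormalForm k l c =
        Polynomial.aeval (curvePoly ℂ k l) P * (X 0 ^ a * X 1 ^ b) := by
    intro a
    induction a using Nat.strong_induction_on with
    | _ a ih =>
      intro b P
      by_cases ha : a < k
      · refine ⟨Finsupp.single (a, b) P, fun ij hij => ?_, ofNormalForm_single _ _⟩
        rw [Finset.mem_singleton.mp (Finsupp.support_single_subset hij)]
        exact ha
      · obtain ⟨a, rfl⟩ := Nat.exists_eq_add_of_le' (not_lt.mp ha)
        convert hadd (ih a (by omega) b (P * Polynomial.X)) (ih a (by omega) (b + l) (-P)) using 4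
        rw [map_mul, Polynomial.aeval_X, map_neg]
        simp only [curvePoly]
        ring
  induction f using MvPolynomial.induction_on' with
  | monomial m a =>
    obtain ⟨c, hc, h⟩ := hmon (m 0) (m 1) (Polynomial.C a)
    refine ⟨c, hc, ?_⟩
    rw [h, monomial_fin_two, Polynomial.aeval_C, algebraMap_eq]
  | add p q hp hq => exact hadd hp hq

theorem weight_injective (hk : k ≠ 0) (hkl : Nat.Coprime k l) {i j i' j' : ℕ} (hi : i < k)
    (hi' : i' < k) (h : l * i + k * j = l * i' + k * j') : i = i' ∧ j = j' := by
  have h1 : i ≡ i' [MOD k] := by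
    have h2 : l * i ≡ l * i' [MOD k] := by
      have h3 : l * i + k * j ≡ l * i' + k * j' [MOD k] := by rw [h]
      simpa [Nat.ModEq, Nat.add_mul_mod_self_left] using h3
    exact Nat.ModEq.cancel_left_of_coprime hkl h2
  have h4 : i = i' := by
    rwa [Nat.ModEq, Nat.mod_eq_of_lt hi, Nat.mod_eq_of_lt hi'] at h1
  subst h4
  exact ⟨rfl, Nat.eq_of_mul_eq_mul_left (Nat.pos_of_ne_zero hk) (by omega)⟩

/-- The parametrization `(ε * X ^ l, X ^ k)` of the curve `z ^ k + t ^ l = 0`, where `ε ^ k = -1`. -/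
noncomputable def curveParam (k l : ℕ) (ε : ℂ) : Poly2 →ₐ[ℂ] Polynomial ℂ :=
  aeval ![Polynomial.C ε * Polynomial.X ^ l, Polynomial.X ^ k]

theorem curveParam_curvePoly {ε : ℂ} (hε : ε ^ k = -1) :
    curveParam k l ε (curvePoly ℂ k l) = 0 := by
  simp only [curveParam, curvePoly, map_add, map_pow, aeval_X, Matrix.cons_val_zero,
    Matrix.cons_val_one, mul_pow, ← Polynomial.C_pow, hε, Polynomial.C_neg, Polynomial.C_1,
    ← pow_mul]
  rw [mul_comm k l]
  ring

theorem curvePoly_dvd_of_curveParam_eq_zero (hk : k ≠ 0) (hkl : Nat.Coprime k l) {ε : ℂ}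
    (hε : ε ^ k = -1) {f : Poly2} (hf : curveParam k l ε f = 0) : curvePoly ℂ k l ∣ f := by
  obtain ⟨c, hc, rfl⟩ := exists_ofNormalForm (l := l) hk f
  have hε0 : ε ≠ 0 := by
    rintro rfl
    rw [zero_pow hk] at hε
    norm_num at hε
  have hterm : ∀ (ij : ℕ × ℕ) (P : Polynomial ℂ), curveParam k l ε
      (Polynomial.aeval (curvePoly ℂ k l) P * (X 0 ^ ij.1 * X 1 ^ ij.2)) =
      Polynomial.C (P.coeff 0 * ε ^ ij.1) * Polynomial.X ^ (l * ij.1 + k * ij.2) := by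
    intro ij P
    rw [map_mul, ← Polynomial.aeval_algHom_apply, curveParam_curvePoly hε,
      Polynomial.coeff_zero_eq_aeval_zero]
    conv_lhs => rw [← map_zero (algebraMap ℂ (Polynomial ℂ)), Polynomial.aeval_algebraMap_apply]
    simp only [curveParam, map_mul, map_pow, aeval_X, Matrix.cons_val_zero, Matrix.cons_val_one,
      Polynomial.algebraMap_eq, mul_pow, pow_add, pow_mul]
    ring
  refine Finset.dvd_sum fun ij hij => Dvd.dvd.mul_right ?_ _
  suffices h : (c ij).coeff 0 = 0 by
    obtain ⟨Q, hQ⟩ := Polynomial.X_dvd_iff.mpr h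
    rw [hQ, map_mul, Polynomial.aeval_X]
    exact Dvd.intro _ rfl
  have h1 := congrArg (fun P => Polynomial.coeff P (l * ij.1 + k * ij.2)) hf
  simp only [ofNormalForm, Finsupp.sum, map_sum, hterm, Polynomial.finsetSum_coeff,
    Polynomial.coeff_C_mul_X_pow, Polynomial.coeff_zero] at h1
  rw [Finset.sum_eq_single_of_mem ij hij, if_pos rfl] at h1
  · exact (mul_eq_zero.mp h1).resolve_right (pow_ne_zero _ hε0)
  · intro ij' hij' hne
    rw [if_neg]
    intro h
    have := weight_injective hk hkl (hc _ hij) (hc _ hij') h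
    exact hne (Prod.ext this.1.symm this.2.symm)

theorem derivative_curveParam (ε : ℂ) (p : Poly2) :
    Polynomial.derivative (curveParam k l ε p) =
      curveParam k l ε (pderiv 0 p) * (Polynomial.C (ε * l) * Polynomial.X ^ (l - 1)) +
      curveParam k l ε (pderiv 1 p) * (Polynomial.C (k : ℂ) * Polynomial.X ^ (k - 1)) := by
  induction p using MvPolynomial.induction_on with
  | C a => simp [← algebraMap_eq]
  | add p q hp hq =>
    simp only [map_add, hp, hq]
    ring
  | mul_X p i hp =>
    rw [map_mul, Polynomial.derivative_mul, hp, pderiv_mul, pderiv_mul]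
    simp only [map_add, map_mul]
    fin_cases i
    · simp [curveParam, pderiv_X, Polynomial.derivative_X_pow]
      ring
    · simp [curveParam, pderiv_X, Polynomial.derivative_X_pow]
      ring

/-- The solutions of `{p, r₀} ∈ (r₀)` are the elements of `(r₀)` up to constants. -/
theorem exists_eq_mul_add_C (hk : 2 ≤ k) (hl : 2 ≤ l) (hkl : Nat.Coprime k l) {p : Poly2}
    (hp : curvePoly ℂ k l ∣ planeBracket p (curvePoly ℂ k l)) :
    ∃ q c, p = q * curvePoly ℂ k l + C c := by
  obtain ⟨ε, hε⟩ : ∃ ε : ℂ, ε ^ k = -1 := IsAlgClosed.exists_pow_nat_eq _ (by omega)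
  have hε0 : ε ≠ 0 := by
    rintro rfl
    rw [zero_pow (by omega)] at hε
    norm_num at hε
  have h0 : curveParam k l ε (planeBracket p (curvePoly ℂ k l)) = 0 := by
    obtain ⟨u, hu⟩ := hp
    rw [hu, map_mul, curveParam_curvePoly hε, zero_mul]
  have hder : Polynomial.derivative (curveParam k l ε p) = 0 := by
    have h1 : Polynomial.X ^ ((k - 1) * (l - 1)) *
        Polynomial.derivative (curveParam k l ε p) =
        Polynomial.C ε * curveParam k l ε (planeBracket p (curvePoly ℂ k l)) := by
      rw [derivative_curveParam, planeBracket_curvePoly]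
      have hε' : Polynomial.C ε * Polynomial.C ε ^ (k - 1) = -1 := by
        rw [← pow_succ', Nat.sub_add_cancel (by omega), ← Polynomial.C_pow, hε]
        simp
      have hC : ∀ a : ℂ, curveParam k l ε (C a) = Polynomial.C a := fun a => by
        rw [← algebraMap_eq, AlgHom.commutes, Polynomial.algebraMap_eq]
      obtain ⟨k, rfl⟩ := Nat.exists_eq_add_of_le' (show 1 ≤ k by omega)
      obtain ⟨l, rfl⟩ := Nat.exists_eq_add_of_le' (show 1 ≤ l by omega)
      simp only [Nat.add_sub_cancel, map_sub, map_mul, map_pow, hC] at hε' ⊢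
      have hz : curveParam (k + 1) (l + 1) ε (X 0) = Polynomial.C ε * Polynomial.X ^ (l + 1) := by
        simp [curveParam]
      have ht : curveParam (k + 1) (l + 1) ε (X 1) = Polynomial.X ^ (k + 1) := by
        simp [curveParam]
      rw [hz, ht, mul_pow, ← pow_mul, ← pow_mul]
      linear_combination (curveParam (k + 1) (l + 1) ε (pderiv 1 p) *
        Polynomial.C ((k + 1 : ℕ) : ℂ) * Polynomial.X ^ ((l + 1) * k)) * hε'
    rw [h0, mul_zero] at h1
    exact (mul_eq_zero.mp h1).resolve_left (pow_ne_zero _ Polynomial.X_ne_zero)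
  obtain ⟨c, hc⟩ := Polynomial.natDegree_eq_zero.mp
    (Polynomial.derivative_eq_zero.mp hder)
  obtain ⟨q, hq⟩ := curvePoly_dvd_of_curveParam_eq_zero (f := p - C c) (by omega) hkl hε (by
    rw [map_sub, ← hc, ← algebraMap_eq, AlgHom.commutes, Polynomial.algebraMap_eq, sub_self])
  exact ⟨q, c, by rw [mul_comm q, ← hq]; ring⟩

/-- Antiderivatives of polynomials. -/
noncomputable def antideriv (i : Fin 2) : Poly2 →ₗ[ℂ] Poly2 :=
  (basisMonomials (Fin 2) ℂ).constr ℂ fun m =>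
    monomial (m + Finsupp.single i 1) (((m i + 1 : ℕ) : ℂ)⁻¹)

theorem antideriv_monomial (i : Fin 2) (m : Fin 2 →₀ ℕ) (a : ℂ) :
    antideriv i (monomial m a) = monomial (m + Finsupp.single i 1) (a * ((m i + 1 : ℕ) : ℂ)⁻¹) := by
  have h : (monomial m a : Poly2) = a • basisMonomials (Fin 2) ℂ m := by
    rw [coe_basisMonomials, smul_monomial, smul_eq_mul, mul_one]
  rw [h, map_smul, antideriv, Module.Basis.constr_basis, smul_monomial, smul_eq_mul]

theorem pderiv_antideriv (i : Fin 2) (p : Poly2) : pderiv i (antideriv i p) = p := by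
  induction p using MvPolynomial.induction_on' with
  | monomial m a =>
    have h : ((m i + 1 : ℕ) : ℂ) ≠ 0 := by exact_mod_cast (m i).succ_ne_zero
    rw [antideriv_monomial, pderiv_monomial, add_tsub_cancel_right, Finsupp.add_apply,
      Finsupp.single_eq_same, mul_assoc, inv_mul_cancel₀ h, mul_one]
  | add p q hp hq => rw [map_add, map_add, hp, hq]

theorem pderiv_antideriv_of_ne {i j : Fin 2} (hij : i ≠ j) (p : Poly2) :
    pderiv j (antideriv i p) = antideriv i (pderiv j p) := by
  induction p using MvPolynomial.induction_on' with
  | monomial m a =>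
    rw [antideriv_monomial, pderiv_monomial, pderiv_monomial, antideriv_monomial]
    have h1 : m + Finsupp.single i 1 - Finsupp.single j 1 =
        m - Finsupp.single j 1 + Finsupp.single i 1 := by
      ext s
      simp only [Finsupp.tsub_apply, Finsupp.add_apply, Finsupp.single_apply]
      split_ifs <;> omega
    rw [h1]
    congr 1
    simp only [Finsupp.tsub_apply, Finsupp.add_apply, Finsupp.single_apply, hij, hij.symm, if_false]
    simp only [add_zero, Nat.sub_zero]
    ring
  | add p q hp hq => rw [map_add, map_add, map_add, map_add, hp, hq]

/-- Vector fields with divergence zero are Hamiltonian. -/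
theorem exists_hamiltonian {a b : Poly2} (h : pderiv 0 a + pderiv 1 b = 0) :
    ∃ p, a = -pderiv 1 p ∧ b = pderiv 0 p := by
  refine ⟨antideriv 0 b - antideriv 1 (a + pderiv 1 (antideriv 0 b)), ?_, ?_⟩
  · rw [map_sub, pderiv_antideriv]
    ring
  · rw [map_sub, pderiv_antideriv, pderiv_antideriv_of_ne (by decide), map_add,
      pderiv_pderiv_comm, pderiv_antideriv, h, map_zero, sub_zero]

theorem eq_zero_of_sum_monomial_eq {c : Fin (k - 1) × Fin (l - 1) → ℂ} {P Q : Poly2}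
    (h : ∑ p, C (c p) * (X 0 ^ (p.1 : ℕ) * X 1 ^ (p.2 : ℕ)) =
      P * X 0 ^ (k - 1) + Q * X 1 ^ (l - 1)) : c = 0 := by
  funext p
  set m : Fin (k - 1) × Fin (l - 1) → Fin 2 →₀ ℕ := fun p =>
    Finsupp.single 0 (p.1 : ℕ) + Finsupp.single 1 (p.2 : ℕ) with hm
  have hm0 : ∀ p, m p 0 = p.1 := fun p => by simp [hm]
  have hm1 : ∀ p, m p 1 = p.2 := fun p => by simp [hm]
  have h1 : ∀ p, C (c p) * (X 0 ^ (p.1 : ℕ) * X 1 ^ (p.2 : ℕ)) = monomial (m p) (c p) := fun p => by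
    rw [monomial_fin_two, hm0, hm1]
  have h2 := congrArg (coeff (m p)) h
  simp only [h1] at h2
  rw [coeff_sum, Finset.sum_eq_single p, coeff_monomial, if_pos rfl, coeff_add, X_pow_eq_monomial,
    X_pow_eq_monomial, coeff_mul_monomial', coeff_mul_monomial', if_neg, if_neg, add_zero] at h2
  · exact h2
  · intro h3
    have := h3 1
    rw [hm1, Finsupp.single_eq_same] at this
    exact absurd p.2.2 (not_lt.mpr this)
  · intro h3
    have := h3 0
    rw [hm0, Finsupp.single_eq_same] at this
    exact absurd p.1.2 (not_lt.mpr this)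
  · intro p' _ hne
    rw [coeff_monomial, if_neg]
    intro h3
    apply hne
    refine Prod.ext (Fin.ext ?_) (Fin.ext ?_)
    · rw [← hm0, h3, hm0]
    · rw [← hm1, h3, hm1]
  · simp

end NormalForm

section Uniqueness

open MvPolynomial

variable {d k l : ℕ}

theorem bracket_mul_left (p q r : Poly3) :
    bracket (p * q) r = p * bracket q r + q * bracket p r := by
  simp only [bracket, pderiv_mul]
  ring

theorem bracket_mul_right (p q r : Poly3) :
    bracket r (p * q) = p * bracket r q + q * bracket r p := by
  simp only [bracket, pderiv_mul]
  ring

theorem bracket_swap (p q : Poly3) : bracket p q = -bracket q p := by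
  simp only [bracket]
  ring

/-- The chain rule for the bracket. -/
theorem bracket_apply_apply (Φ : Poly3 →ₐ[ℂ] Poly3) {μ : ℂ} (hx : Φ (X 0) = C μ * X 0) (p q : Poly3) :
    bracket (Φ p) (Φ q) = Φ (bracket p q) * bracket (Φ (X 1)) (Φ (X 2)) := by
  have hC : ∀ (c : ℂ) (r : Poly3), bracket (C c) r = 0 := fun c r => by simp [bracket]
  have hC' : ∀ (c : ℂ) (r : Poly3), bracket r (C c) = 0 := fun c r => by simp [bracket]
  have hΦ : ∀ c : ℂ, Φ (C c) = C c := fun c => by rw [← algebraMap_eq, AlgHom.commutes]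
  have h0 : ∀ r, bracket (Φ (X 0)) r = 0 := fun r => by simp [hx, bracket, pderiv_X]
  have h00 : ∀ r, bracket (X 0 : Poly3) r = 0 := fun r => by simp [bracket, pderiv_X]
  have hself : ∀ r : Poly3, bracket r r = 0 := fun r => by simp only [bracket]; ring
  have h12 : bracket (X 1 : Poly3) (X 2) = 1 := by simp [bracket, pderiv_X]
  induction p using MvPolynomial.induction_on with
  | C c => rw [hΦ, hC, hC, map_zero, zero_mul]
  | add p p' hp hp' =>
    have hadd : ∀ a b c : Poly3, bracket (a + b) c = bracket a c + bracket b c := fun a b c => by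
      simp only [bracket, map_add]; ring
    rw [map_add, hadd, hadd, hp, hp', map_add, add_mul]
  | mul_X p i hp =>
    have hX : bracket (Φ (X i)) (Φ q) = Φ (bracket (X i) q) * bracket (Φ (X 1)) (Φ (X 2)) := by
      clear hp
      induction q using MvPolynomial.induction_on with
      | C c => rw [hΦ, hC', hC', map_zero, zero_mul]
      | add q q' hq hq' =>
        have hadd : ∀ a b c : Poly3, bracket c (a + b) = bracket c a + bracket c b :=
          fun a b c => by simp only [bracket, map_add]; ring
        rw [map_add, hadd, hadd, hq, hq', map_add, add_mul]
      | mul_X q j hq =>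
        have hj : bracket (Φ (X i)) (Φ (X j)) =
            Φ (bracket (X i) (X j)) * bracket (Φ (X 1)) (Φ (X 2)) := by
          fin_cases i <;> fin_cases j
          all_goals simp only [Fin.zero_eta, Fin.mk_one, Fin.reduceFinMk, h0, h00, hself, map_zero,
            zero_mul, h12, map_one, one_mul]
          · rw [bracket_swap, h0, bracket_swap, h00, neg_zero, map_zero, zero_mul]
          · rw [bracket_swap, h0, bracket_swap, h00, neg_zero, map_zero, zero_mul]
          · rw [bracket_swap, bracket_swap (X 2), h12, map_neg, map_one, neg_one_mul]
        rw [map_mul, bracket_mul_right, bracket_mul_right, hq, hj, map_add, map_mul, map_mul]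
        ring
    rw [map_mul, bracket_mul_left, bracket_mul_left, hp, hX, map_add, map_mul, map_mul]
    ring

/-- Automorphisms which rescale `x` multiply the bracket by a constant. -/
theorem exists_bracket_eq_C (Φ : Poly3 ≃ₐ[ℂ] Poly3) {μ : ℂˣ} (hx : Φ (X 0) = C (μ : ℂ) * X 0) :
    ∃ c : ℂ, bracket (Φ (X 1)) (Φ (X 2)) = C c := by
  have h := bracket_apply_apply (Φ : Poly3 →ₐ[ℂ] Poly3) hx (Φ.symm (X 1)) (Φ.symm (X 2))
  replace h : bracket (Φ (Φ.symm (X 1))) (Φ (Φ.symm (X 2))) =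
      Φ (bracket (Φ.symm (X 1)) (Φ.symm (X 2))) * bracket (Φ (X 1)) (Φ (X 2)) := h
  rw [Φ.apply_symm_apply, Φ.apply_symm_apply] at h
  have h12 : bracket (X 1 : Poly3) (X 2) = 1 := by simp [bracket, pderiv_X]
  rw [h12] at h
  have hu : IsUnit (bracket (Φ (X 1)) (Φ (X 2))) := IsUnit.of_mul_eq_one_right _ h.symm
  obtain ⟨c, -, hc⟩ := MvPolynomial.isUnit_iff_eq_C_of_isReduced.mp hu
  exact ⟨c, hc⟩

/-- The endomorphisms of `ℂ[x, z, t]` over `ℂ[x]` which are the identity modulo `x ^ m`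
and preserve the bracket modulo `x ^ d`. -/
structure IsSpecial (d m : ℕ) (Φ : Poly3 →ₐ[ℂ] Poly3) : Prop where
  apply_X0 : Φ (X 0) = X 0
  dvd_sub (i : Fin 3) : X 0 ^ m ∣ Φ (X i) - X i
  dvd_bracket_sub : X 0 ^ d ∣ bracket (Φ (X 1)) (Φ (X 2)) - 1

theorem IsSpecial.dvd_apply_sub {m : ℕ} {Φ : Poly3 →ₐ[ℂ] Poly3} (h : IsSpecial d m Φ) (p : Poly3) :
    X 0 ^ m ∣ Φ p - p := by
  induction p using MvPolynomial.induction_on with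
  | C c =>
    rw [← algebraMap_eq, AlgHom.commutes, sub_self]
    exact dvd_zero _
  | add p q hp hq =>
    rw [map_add, add_sub_add_comm]
    exact dvd_add hp hq
  | mul_X p i hp =>
    rw [map_mul, show Φ p * Φ (X i) - p * X i = (Φ p - p) * Φ (X i) + p * (Φ (X i) - X i) by ring]
    exact dvd_add (hp.mul_right _) ((h.dvd_sub i).mul_left _)

theorem dvd_of_ev0_eq_zero {m : ℕ} {p : Poly3} (h : ev0 p = 0) : X 0 ^ (m + 1) ∣ X 0 ^ m * p := by
  rw [pow_succ]
  exact mul_dvd_mul_left _ (ev0_eq_zero_iff.mp h)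

theorem versal_eq_add (a b : Fin (k - 1) × Fin (l - 1) → Polynomial ℂ) {m : ℕ}
    {c : Fin (k - 1) × Fin (l - 1) → Polynomial ℂ} (h : ∀ p, a p - b p = Polynomial.X ^ m * c p) :
    versal k l a = versal k l b + X 0 ^ m *
      ∑ p, Polynomial.aeval (X 0 : Poly3) (c p) * emb (X 0 ^ (p.1 : ℕ) * X 1 ^ (p.2 : ℕ)) := by
  rw [versal, versal, Finset.mul_sum, add_assoc, ← Finset.sum_add_distrib]
  congr 1
  refine Finset.sum_congr rfl fun p _ => ?_
  have := congrArg (Polynomial.aeval (X 0 : Poly3)) (h p)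
  rw [map_sub, map_mul, map_pow, Polynomial.aeval_X] at this
  linear_combination emb (X 0 ^ (p.1 : ℕ) * X 1 ^ (p.2 : ℕ)) * this

theorem dvd_sub_and_exists_isSpecial_succ (hk : 2 ≤ k) (hl : 2 ≤ l)
    (hkl : Nat.Coprime k l) {a b : Fin (k - 1) × Fin (l - 1) → Polynomial ℂ}
    (ha : ∀ p, (a p).coeff 0 = 0) (hb : ∀ p, (b p).coeff 0 = 0) {m : ℕ} (hm : m ≠ 0) (hmd : m < d)
    {Φ : Poly3 →ₐ[ℂ] Poly3} (hΦ : IsSpecial d m Φ)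
    (hΦa : Φ (versal k l a) ∈ centerIdeal d (versal k l b))
    (hab : ∀ p, Polynomial.X ^ m ∣ a p - b p) :
    (∀ p, Polynomial.X ^ (m + 1) ∣ a p - b p) ∧
    ∃ Ψ : Poly3 →ₐ[ℂ] Poly3, IsSpecial d (m + 1) Ψ ∧
      Ψ (versal k l a) ∈ centerIdeal d (versal k l b) := by
  obtain ⟨A, hA⟩ := hΦ.dvd_sub 1
  obtain ⟨B, hB⟩ := hΦ.dvd_sub 2
  rw [sub_eq_iff_eq_add'] at hA hB
  choose c hc using hab
  have hX0 : (X 0 : Poly3) ^ m ≠ 0 := pow_ne_zero _ (X_ne_zero 0)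
  obtain ⟨e, he⟩ := exists_taylor hm Φ hΦ.apply_X0 hA hB (versal k l a)
  obtain ⟨V, U, hUV⟩ := mem_centerIdeal.mp hΦa
  set S : Poly3 :=
    ∑ p, Polynomial.aeval (X 0 : Poly3) (c p) * emb (X 0 ^ (p.1 : ℕ) * X 1 ^ (p.2 : ℕ)) with hS
  have hver : versal k l a = versal k l b + X 0 ^ m * S := versal_eq_add a b hc
  have hdm : (X 0 : Poly3) ^ d = X 0 ^ m * (X 0 * X 0 ^ (d - m - 1)) := by
    rw [← pow_succ', ← pow_add]
    congr 1
    omega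
  obtain ⟨u, hu⟩ : X 0 ^ m ∣ U - 1 := by
    have h1 : X 0 ^ m ∣ versal k l b * (U - 1) := by
      refine ⟨S + (A * pderiv 1 (versal k l a) + B * pderiv 2 (versal k l a)) + X 0 * e -
        (X 0 * X 0 ^ (d - m - 1)) * V, ?_⟩
      linear_combination he - hUV + hver - V * hdm
    refine (X_prime (i := (0 : Fin 3))).pow_dvd_of_dvd_mul_left _ ?_ h1
    rw [← ev0_eq_zero_iff, ev0_versal hb]
    exact curvePoly_ne_zero
  have hmain : ev0 S + (ev0 A * (C (k : ℂ) * X 0 ^ (k - 1)) + ev0 B * (C (l : ℂ) * X 1 ^ (l - 1))) =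
      ev0 u * curvePoly ℂ k l := by
    have h1 : S + (A * pderiv 1 (versal k l a) + B * pderiv 2 (versal k l a)) + X 0 * e -
        (X 0 * X 0 ^ (d - m - 1)) * V = versal k l b * u := by
      apply mul_left_cancel₀ hX0
      linear_combination -he + hUV - hver + V * hdm + versal k l b * hu
    have h2 := congrArg ev0 h1
    simp only [map_add, map_sub, map_mul, ev0_X0, zero_mul, sub_zero, add_zero, ev0_versal hb,
      ev0_versal ha, ev0_pderiv_one, ev0_pderiv_two, pderiv_curvePoly_zero,
      pderiv_curvePoly_one] at h2
    rw [h2, mul_comm]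
  have hevS : ev0 S = ∑ p, C ((c p).coeff 0) * (X 0 ^ (p.1 : ℕ) * X 1 ^ (p.2 : ℕ)) := by
    simp only [hS, map_sum, map_mul ev0, ev0_aeval_X0, ev0_emb]
  have hc0 : (fun p => (c p).coeff 0) = 0 := by
    refine eq_zero_of_sum_monomial_eq (P := ev0 u * X 0 - ev0 A * C (k : ℂ))
      (Q := ev0 u * X 1 - ev0 B * C (l : ℂ)) ?_
    rw [← hevS]
    have hk' : (X 0 : Poly2) ^ k = X 0 * X 0 ^ (k - 1) := by
      rw [← pow_succ', Nat.sub_add_cancel (by omega)]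
    have hl' : (X 1 : Poly2) ^ l = X 1 * X 1 ^ (l - 1) := by
      rw [← pow_succ', Nat.sub_add_cancel (by omega)]
    rw [curvePoly, hk', hl'] at hmain
    linear_combination hmain
  refine ⟨fun p => ?_, ?_⟩
  · rw [hc p, pow_succ]
    exact mul_dvd_mul_left _ (Polynomial.X_dvd_iff.mpr (congrFun hc0 p))
  have hS0 : ev0 S = 0 := by
    rw [hevS]
    refine Finset.sum_eq_zero fun p _ => ?_
    have := congrFun hc0 p
    simp only [Pi.zero_apply] at this
    rw [this, C_0, zero_mul]
  have hdiv : pderiv 0 (ev0 A) + pderiv 1 (ev0 B) = 0 := by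
    obtain ⟨w, hw⟩ := hΦ.dvd_bracket_sub
    have h1 : pderiv 1 A + pderiv 2 B + X 0 ^ m * bracket A B = X 0 * X 0 ^ (d - m - 1) * w := by
      apply mul_left_cancel₀ hX0
      rw [hA, hB, hdm] at hw
      simp only [bracket, map_add, pderiv_mul, pderiv_pow, pderiv_X] at hw
      simp at hw
      rw [bracket]
      linear_combination hw
    have h2 := congrArg ev0 h1
    simpa only [map_add, map_mul, map_pow, ev0_X0, zero_pow hm, zero_mul, add_zero, ev0_pderiv_one,
      ev0_pderiv_two] using h2
  obtain ⟨p, hpA, hpB⟩ := exists_hamiltonian hdiv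
  obtain ⟨q, c', hq⟩ := exists_eq_mul_add_C hk hl hkl (p := p) ⟨ev0 u, by
    rw [planeBracket_curvePoly, ← hpB]
    rw [hS0, hpA] at hmain
    linear_combination hmain⟩
  obtain ⟨G, hG0, hG, hGbr, hGid⟩ := exists_hamiltonian_flow (d := d) (by omega) hm
    (-(emb q * versal k l a))
  have hbrX : ∀ i, ev0 (bracket (-(emb q * versal k l a)) (X i)) = -planeBracket p (ev0 (X i)) := by
    intro i
    rw [ev0_bracket, map_neg, map_mul, ev0_emb, ev0_versal ha, hq]
    simp only [planeBracket, map_add, map_neg, pderiv_C]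
    ring
  refine ⟨Φ.comp G, ⟨?_, fun i => ?_, ?_⟩, ?_⟩
  · rw [AlgHom.comp_apply, hG0, hΦ.apply_X0]
  · obtain ⟨e', he'⟩ := hG i
    rw [AlgHom.comp_apply, he', map_add, map_add, map_mul, map_mul, map_pow, map_pow, hΦ.apply_X0]
    obtain ⟨w, hw⟩ := hΦ.dvd_apply_sub (bracket (-(emb q * versal k l a)) (X i))
    obtain ⟨D, hD, hD0⟩ : ∃ D, Φ (X i) = X i + X 0 ^ m * D ∧ ev0 D = planeBracket p (ev0 (X i)) := by
      fin_cases i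
      · exact ⟨0, by simpa using hΦ.apply_X0, by simp [planeBracket]⟩
      · exact ⟨A, hA, by simp [planeBracket, pderiv_X, hpA]⟩
      · exact ⟨B, hB, by simp [planeBracket, pderiv_X, hpB]⟩
    have h1 : X 0 ^ (m + 1) ∣ X 0 ^ m * (D + Φ (bracket (-(emb q * versal k l a)) (X i))) := by
      apply dvd_of_ev0_eq_zero
      rw [sub_eq_iff_eq_add'] at hw
      rw [hw, map_add, map_add, hbrX, hD0, map_mul, map_pow, ev0_X0, zero_pow hm]
      ring
    have h2 := dvd_add h1 (Dvd.intro (Φ e') rfl : X 0 ^ (m + 1) ∣ X 0 ^ (m + 1) * Φ e')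
    convert h2 using 1
    rw [hD]
    ring
  · obtain ⟨w, hw⟩ := hGbr
    obtain ⟨w', hw'⟩ := hΦ.dvd_bracket_sub
    rw [sub_eq_iff_eq_add'] at hw hw'
    rw [AlgHom.comp_apply, AlgHom.comp_apply, bracket_apply_apply Φ (μ := 1) (by simpa using hΦ.apply_X0),
      hw, hw', map_add, map_one, map_mul, map_pow, hΦ.apply_X0]
    exact ⟨w' + Φ w * (1 + X 0 ^ d * w'), by ring⟩
  · obtain ⟨u', v', huv⟩ := hGid (versal k l a) ⟨-bracket (emb q) (versal k l a), by
      simp only [bracket, map_neg, pderiv_mul]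
      ring⟩
    rw [AlgHom.comp_apply, huv, map_add, map_mul, map_mul, map_pow, hΦ.apply_X0]
    exact add_mem (Ideal.mul_mem_left _ _ hΦa) (Ideal.mul_mem_right _ _ X0_pow_mem_centerIdeal)

/-- Automorphisms over `ℂ[x]` which are the identity modulo `x` identify the parameters
modulo `x ^ d`. -/
theorem dvd_sub_of_mem_centerIdeal (hk : 2 ≤ k) (hl : 2 ≤ l)
    (hkl : Nat.Coprime k l) {a b : Fin (k - 1) × Fin (l - 1) → Polynomial ℂ}
    (ha : ∀ p, (a p).coeff 0 = 0) (hb : ∀ p, (b p).coeff 0 = 0) (hd : d ≠ 0)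
    {Φ : Poly3 →ₐ[ℂ] Poly3} (hΦ : IsSpecial d 1 Φ)
    (hΦa : Φ (versal k l a) ∈ centerIdeal d (versal k l b)) (p : Fin (k - 1) × Fin (l - 1)) :
    Polynomial.X ^ d ∣ a p - b p := by
  have key : ∀ m, m < d → (∀ p, Polynomial.X ^ (m + 1) ∣ a p - b p) ∧
      ∃ Ψ : Poly3 →ₐ[ℂ] Poly3, IsSpecial d (m + 1) Ψ ∧
        Ψ (versal k l a) ∈ centerIdeal d (versal k l b) := by
    intro m
    induction m with
    | zero =>
      refine fun _ => ⟨fun p => ?_, Φ, hΦ, hΦa⟩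
      rw [zero_add, pow_one, Polynomial.X_dvd_iff, Polynomial.coeff_sub, ha, hb, sub_zero]
    | succ m ih =>
      intro hm
      obtain ⟨h1, Ψ, hΨ, hΨa⟩ := ih (by omega)
      exact dvd_sub_and_exists_isSpecial_succ hk hl hkl ha hb (Nat.succ_ne_zero m) hm hΨ hΨa h1
  have := (key (d - 1) (by omega)).1 p
  rwa [Nat.sub_add_cancel (Nat.one_le_iff_ne_zero.mpr hd)] at this

end Uniqueness

section LaurentPoint

variable {k l : ℕ}

/-- Laurent series in a local parameter at infinity of the generic curve `z ^ k + t ^ l = r`, with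
coefficients in `ℂ[r]`. -/
abbrev Laurent : Type := HahnSeries ℤ (Polynomial ℂ)

/-- The valuation on Laurent series. -/
noncomputable abbrev laurentVal : AddValuation Laurent (WithTop ℤ) :=
  HahnSeries.addVal ℤ (Polynomial ℂ)

theorem laurentVal_C {P : Polynomial ℂ} (hP : P ≠ 0) : laurentVal (HahnSeries.C P) = 0 := by
  rw [HahnSeries.addVal_apply, HahnSeries.C_apply, HahnSeries.orderTop_single hP]
  rfl

theorem laurentVal_C_nonneg (P : Polynomial ℂ) : 0 ≤ laurentVal (HahnSeries.C P) := by
  by_cases hP : P = 0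
  · rw [hP, map_zero, AddValuation.map_zero]
    exact le_top
  · rw [laurentVal_C hP]

theorem laurentVal_pow_nonneg_iff {Z : Laurent} {n : ℕ} (hn : n ≠ 0) :
    0 ≤ laurentVal (Z ^ n) ↔ 0 ≤ laurentVal Z := by
  rw [AddValuation.map_pow]
  by_cases hZ : laurentVal Z = ⊤
  · rw [hZ]
    obtain ⟨n, rfl⟩ := Nat.exists_eq_succ_of_ne_zero hn
    rw [succ_nsmul]
    simp
  · obtain ⟨ζ, hζ⟩ := WithTop.ne_top_iff_exists.mp hZ
    rw [← hζ, ← WithTop.coe_nsmul]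
    norm_cast
    rw [nsmul_eq_mul]
    have : (0 : ℤ) < n := by exact_mod_cast Nat.pos_of_ne_zero hn
    exact mul_nonneg_iff_of_pos_left this

theorem laurentVal_nonneg {Z T : Laurent} {P : Polynomial ℂ} (hk : k ≠ 0) (hl : l ≠ 0)
    (h : Z ^ k + T ^ l = HahnSeries.C P) (hT : 0 ≤ laurentVal T) : 0 ≤ laurentVal Z := by
  rw [← laurentVal_pow_nonneg_iff hk, eq_sub_of_add_eq h]
  exact (le_min (laurentVal_C_nonneg P) ((laurentVal_pow_nonneg_iff hl).mpr hT)).trans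
    (AddValuation.map_sub _ _ _)

theorem exists_laurentVal_eq {Z T : Laurent} {P : Polynomial ℂ} (hk : k ≠ 0) (hl : l ≠ 0)
    (hkl : Nat.Coprime k l) (h : Z ^ k + T ^ l = HahnSeries.C P) (hT : ¬ 0 ≤ laurentVal T) :
    ∃ m : ℕ, 0 < m ∧ laurentVal Z = ((-(l * m : ℕ) : ℤ) : WithTop ℤ) ∧
      laurentVal T = ((-(k * m : ℕ) : ℤ) : WithTop ℤ) := by
  obtain ⟨τ, hτ⟩ := WithTop.ne_top_iff_exists.mp (lt_of_lt_of_le (not_le.mp hT) le_top).ne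
  have hTl : laurentVal (T ^ l) < 0 := not_le.mp (mt (laurentVal_pow_nonneg_iff hl).mp hT)
  have h1 : laurentVal (Z ^ k) = laurentVal (T ^ l) := by
    rw [eq_sub_of_add_eq h, sub_eq_neg_add, AddValuation.map_add_eq_of_lt_left,
      AddValuation.map_neg]
    rw [AddValuation.map_neg]
    exact hTl.trans_le (laurentVal_C_nonneg P)
  have hZ : laurentVal Z ≠ ⊤ := by
    intro h2
    have h3 : 0 ≤ laurentVal (Z ^ k) := (laurentVal_pow_nonneg_iff hk).mpr (by rw [h2]; exact le_top)
    rw [h1] at h3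
    exact absurd hTl (not_lt.mpr h3)
  obtain ⟨ζ, hζ⟩ := WithTop.ne_top_iff_exists.mp hZ
  rw [AddValuation.map_pow, AddValuation.map_pow, ← hζ, ← hτ, ← WithTop.coe_nsmul,
    ← WithTop.coe_nsmul, WithTop.coe_inj, nsmul_eq_mul, nsmul_eq_mul] at h1
  rw [← hτ] at hT
  have hτ0 : τ < 0 := by
    rw [not_le] at hT
    exact_mod_cast hT
  have hkτ : (k : ℤ) ∣ τ := (Nat.Coprime.isCoprime hkl).dvd_of_dvd_mul_left (Dvd.intro _ h1)
  obtain ⟨m, rfl⟩ := hkτ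
  have hk' : (0 : ℤ) < k := by exact_mod_cast Nat.pos_of_ne_zero hk
  have hζ' : ζ = l * m := by
    apply mul_left_cancel₀ hk'.ne'
    rw [h1]
    ring
  have hm : m < 0 := by
    by_contra hm
    exact absurd hτ0 (not_lt.mpr (mul_nonneg hk'.le (not_lt.mp hm)))
  obtain ⟨n, hn⟩ := Int.eq_ofNat_of_zero_le (neg_nonneg.mpr hm.le)
  refine ⟨n, by omega, ?_, ?_⟩
  · rw [← hζ, hζ']
    rw [WithTop.coe_inj]
    push_cast
    linear_combination (-l : ℤ) * hn
  · rw [← hτ]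
    rw [WithTop.coe_inj]
    push_cast
    linear_combination (-k : ℤ) * hn

/-- A point of the generic curve over the Laurent series. -/
theorem exists_laurent_point (hk : k ≠ 0) (hl : l ≠ 0) : ∃ Z T : Laurent,
    Z ^ k + T ^ l = HahnSeries.C Polynomial.X ∧ laurentVal T = ((-k : ℤ) : WithTop ℤ) := by
  obtain ⟨ε, hε⟩ : ∃ ε : ℂ, ε ^ k = -1 := IsAlgClosed.exists_pow_nat_eq _ (Nat.pos_of_ne_zero hk)
  obtain ⟨g, hg⟩ : ∃ g : PowerSeries (Polynomial ℂ), g ^ k = 1 + PowerSeries.X := by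
    refine ⟨PowerSeries.binomialSeries _ (1 / k : ℚ), ?_⟩
    have h1 : ∀ n : ℕ, PowerSeries.binomialSeries (Polynomial ℂ) (1 / k : ℚ) ^ n =
        PowerSeries.binomialSeries (Polynomial ℂ) (n * (1 / k) : ℚ) := by
      intro n
      induction n with
      | zero => simp
      | succ n ih =>
        rw [pow_succ, ih, ← PowerSeries.binomialSeries_add]
        congr 1
        push_cast
        ring
    rw [h1, mul_one_div_cancel (by exact_mod_cast hk)]
    simpa using PowerSeries.binomialSeries_nat (R := ℚ) (A := Polynomial ℂ) 1
  have hs : PowerSeries.HasSubst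
      (-(PowerSeries.C (Polynomial.X : Polynomial ℂ) * PowerSeries.X ^ (k * l))) :=
    PowerSeries.HasSubst.of_constantCoeff_zero' (by simp [hk, hl])
  have hg' := congrArg (PowerSeries.substAlgHom (R := Polynomial ℂ) hs) hg
  rw [map_pow, map_add, map_one, PowerSeries.substAlgHom_X] at hg'
  set G := HahnSeries.ofPowerSeries ℤ (Polynomial ℂ) (PowerSeries.substAlgHom hs g) with hG
  have hGk : G ^ k = 1 - HahnSeries.C Polynomial.X * HahnSeries.single ((k * l : ℕ) : ℤ) 1 := by
    rw [hG, ← map_pow, hg', map_add, map_one, map_neg, map_mul, HahnSeries.ofPowerSeries_C,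
      HahnSeries.ofPowerSeries_X_pow, sub_eq_add_neg]
  refine ⟨HahnSeries.C (Polynomial.C ε) * HahnSeries.single (-l : ℤ) 1 * G,
    HahnSeries.single (-k : ℤ) 1, ?_, ?_⟩
  · rw [mul_pow, mul_pow, hGk, ← map_pow, ← Polynomial.C_pow, hε, HahnSeries.single_pow,
      HahnSeries.single_pow, one_pow, one_pow]
    have h2 : HahnSeries.single (k • (-l : ℤ)) (1 : Polynomial ℂ) *
        HahnSeries.single ((k * l : ℕ) : ℤ) 1 = 1 := by
      rw [HahnSeries.single_mul_single, mul_one]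
      have : k • (-l : ℤ) + ((k * l : ℕ) : ℤ) = 0 := by
        push_cast
        ring
      rw [this]
      rfl
    have h3 : l • (-k : ℤ) = k • (-l : ℤ) := by
      simp only [nsmul_eq_mul]
      ring
    rw [h3]
    simp only [map_neg, map_one]
    linear_combination HahnSeries.C Polynomial.X * h2
  · rw [HahnSeries.addVal_apply, HahnSeries.orderTop_single one_ne_zero]

/-- The valuation of a polynomial in normal form at a pair of Laurent series. -/
theorem exists_laurentVal_sum_eq (hk : k ≠ 0) (hkl : Nat.Coprime k l) {c : ℕ × ℕ →₀ Polynomial ℂ}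
    (hc : ∀ ij ∈ c.support, ij.1 < k) (hc0 : c ≠ 0) {Z T : Laurent} {m : ℕ} (hm : 0 < m)
    (hZ : laurentVal Z = ((-(l * m : ℕ) : ℤ) : WithTop ℤ))
    (hT : laurentVal T = ((-(k * m : ℕ) : ℤ) : WithTop ℤ)) :
    ∃ ij ∈ c.support, (∀ ij' ∈ c.support, l * ij'.1 + k * ij'.2 ≤ l * ij.1 + k * ij.2) ∧
      laurentVal (c.sum fun ij P => HahnSeries.C P * (Z ^ ij.1 * T ^ ij.2)) =
        ((-(m * (l * ij.1 + k * ij.2) : ℕ) : ℤ) : WithTop ℤ) := by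
  have hterm : ∀ ij ∈ c.support, laurentVal (HahnSeries.C (c ij) * (Z ^ ij.1 * T ^ ij.2)) =
      ((-(m * (l * ij.1 + k * ij.2) : ℕ) : ℤ) : WithTop ℤ) := by
    intro ij hij
    rw [AddValuation.map_mul, AddValuation.map_mul, AddValuation.map_pow, AddValuation.map_pow,
      laurentVal_C (Finsupp.mem_support_iff.mp hij), zero_add, hZ, hT, ← WithTop.coe_nsmul,
      ← WithTop.coe_nsmul, ← WithTop.coe_add]
    congr 1
    simp only [nsmul_eq_mul]
    push_cast
    ring
  obtain ⟨ij, hij, hmax⟩ := Finset.exists_max_image c.support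
    (fun ij => l * ij.1 + k * ij.2) (Finsupp.support_nonempty_iff.mpr hc0)
  refine ⟨ij, hij, hmax, ?_⟩
  rw [Finsupp.sum, ← Finset.add_sum_erase _ _ hij, AddValuation.map_add_eq_of_lt_left, hterm _ hij]
  rw [hterm _ hij]
  refine AddValuation.map_lt_sum _ (WithTop.coe_ne_top) fun ij' hij' => ?_
  obtain ⟨hne, hij'⟩ := Finset.mem_erase.mp hij'
  rw [hterm _ hij', WithTop.coe_lt_coe, neg_lt_neg_iff, Int.ofNat_lt]
  refine Nat.mul_lt_mul_of_pos_left (lt_of_le_of_ne (hmax _ hij') fun h => hne ?_) hm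
  have := weight_injective hk hkl (hc _ hij') (hc _ hij) h
  exact Prod.ext this.1 this.2

open MvPolynomial in
/-- The evaluation of polynomials at a pair of Laurent series. -/
noncomputable def laurentEval (Z T : Laurent) : Poly2 →+* Laurent :=
  eval₂Hom (HahnSeries.C.comp Polynomial.C) ![Z, T]

open MvPolynomial in
theorem apply_ofNormalForm {χ : Poly2 →+* Laurent}
    (hC : ∀ a, χ (C a) = HahnSeries.C (Polynomial.C a))
    (hr : χ (curvePoly ℂ k l) = HahnSeries.C Polynomial.X) (c : ℕ × ℕ →₀ Polynomial ℂ) :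
    χ (ofNormalForm k l c) =
      c.sum fun ij P => HahnSeries.C P * (χ (X 0) ^ ij.1 * χ (X 1) ^ ij.2) := by
  have hP : ∀ P : Polynomial ℂ, χ (Polynomial.aeval (curvePoly ℂ k l) P) = HahnSeries.C P := by
    intro P
    induction P using Polynomial.induction_on' with
    | add p q hp hq => rw [map_add, map_add, map_add, hp, hq]
    | monomial n a =>
      rw [← Polynomial.C_mul_X_pow_eq_monomial, map_mul, map_pow, Polynomial.aeval_C,
        Polynomial.aeval_X, map_mul, map_pow, hr, algebraMap_eq, hC, map_mul, map_pow]
  simp only [ofNormalForm, Finsupp.sum, map_sum, map_mul, map_pow, hP]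

end LaurentPoint

section PlaneAutomorphisms

open MvPolynomial

variable {k l : ℕ}

/-- The normal forms of the images of the coordinates under an automorphism which preserves `r₀`. -/
theorem exists_normalForm_apply (hk : 2 ≤ k) (hl : 2 ≤ l) (hkl : Nat.Coprime k l)
    (ψ : Poly2 ≃ₐ[ℂ] Poly2) (hψ : ψ (curvePoly ℂ k l) = curvePoly ℂ k l) :
    (∃ c : ℕ × ℕ →₀ Polynomial ℂ, ofNormalForm k l c = ψ (X 0) ∧ (∀ ij ∈ c.support, ij.1 < k) ∧
      (∀ ij ∈ c.support, l * ij.1 + k * ij.2 ≤ l) ∧ ∃ ij ∈ c.support, l * ij.1 + k * ij.2 = l) ∧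
    (∃ c : ℕ × ℕ →₀ Polynomial ℂ, ofNormalForm k l c = ψ (X 1) ∧ (∀ ij ∈ c.support, ij.1 < k) ∧
      (∀ ij ∈ c.support, l * ij.1 + k * ij.2 ≤ k) ∧ ∃ ij ∈ c.support, l * ij.1 + k * ij.2 = k) := by
  have hk0 : k ≠ 0 := by omega
  have hl0 : l ≠ 0 := by omega
  obtain ⟨Z, T, hZT, hT⟩ := exists_laurent_point hk0 hl0
  set φ := laurentEval Z T with hφ
  have hφC : ∀ a, φ (C a) = HahnSeries.C (Polynomial.C a) := fun a => by simp [hφ, laurentEval]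
  have hφ0 : φ (X 0) = Z := by simp [hφ, laurentEval]
  have hφ1 : φ (X 1) = T := by simp [hφ, laurentEval]
  have hφr : φ (curvePoly ℂ k l) = HahnSeries.C Polynomial.X := by
    rw [curvePoly, map_add, map_pow, map_pow, hφ0, hφ1, hZT]
  set χ : Poly2 →+* Laurent := φ.comp (ψ : Poly2 →+* Poly2) with hχ
  have hχa : ∀ p, χ p = φ (ψ p) := fun p => rfl
  have hχC : ∀ a, χ (C a) = HahnSeries.C (Polynomial.C a) := fun a => by
    rw [hχa, ← algebraMap_eq, AlgEquiv.commutes, algebraMap_eq, hφC]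
  have hχr : χ (curvePoly ℂ k l) = HahnSeries.C Polynomial.X := by rw [hχa, hψ, hφr]
  have hχZT : χ (X 0) ^ k + χ (X 1) ^ l = HahnSeries.C Polynomial.X := by
    rw [← map_pow, ← map_pow, ← map_add, ← hχr]
    rfl
  have hTneg : ¬ 0 ≤ laurentVal T := by
    rw [hT, not_le]
    have : (-k : ℤ) < 0 := by omega
    exact_mod_cast this
  obtain ⟨m, hm, hZm, hTm⟩ := exists_laurentVal_eq hk0 hl0 hkl hZT hTneg
  obtain rfl : m = 1 := by
    rw [hT, WithTop.coe_inj, neg_inj] at hTm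
    have : k = k * m := by exact_mod_cast hTm
    exact (Nat.eq_of_mul_eq_mul_left (Nat.pos_of_ne_zero hk0) (by rw [mul_one]; exact this)).symm
  have hχneg : ¬ 0 ≤ laurentVal (χ (X 1)) := by
    intro hnn
    have hnn' := laurentVal_nonneg hk0 hl0 hχZT hnn
    have hall : ∀ p, 0 ≤ laurentVal (χ p) := by
      intro p
      induction p using MvPolynomial.induction_on with
      | C a =>
        rw [hχC]
        exact laurentVal_C_nonneg _
      | add p q hp hq =>
        rw [map_add]
        exact (le_min hp hq).trans (AddValuation.map_add _ _ _)
      | mul_X p i hp =>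
        rw [map_mul, AddValuation.map_mul]
        refine add_nonneg hp ?_
        fin_cases i
        · exact hnn'
        · exact hnn
    apply hTneg
    rw [← hφ1, ← ψ.apply_symm_apply (X 1), ← hχa]
    exact hall _
  obtain ⟨n, hn, hZn, hTn⟩ := exists_laurentVal_eq hk0 hl0 hkl hχZT hχneg
  have hdvd : ∀ (p : Poly2) (w : ℕ), p ≠ 0 → laurentVal (φ p) = ((-(w : ℕ) : ℤ) : WithTop ℤ) →
      n ∣ w := by
    intro p w hp hw
    obtain ⟨c, hc, hcp⟩ := exists_ofNormalForm (l := l) hk0 (ψ.symm p)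
    have hc0 : c ≠ 0 := by
      rintro rfl
      exact hp (ψ.symm.injective (by rw [← hcp, map_zero]; rfl))
    obtain ⟨ij, -, -, hv⟩ := exists_laurentVal_sum_eq hk0 hkl hc hc0 hn hZn hTn
    rw [← apply_ofNormalForm hχC hχr, hcp, hχa, ψ.apply_symm_apply, hw, WithTop.coe_inj,
      neg_inj] at hv
    exact Dvd.intro _ (by exact_mod_cast hv.symm)
  obtain rfl : n = 1 := by
    have h1 := hdvd (X 0) l (X_ne_zero 0) (by rw [hφ0, hZm, mul_one])
    have h2 := hdvd (X 1) k (X_ne_zero 1) (by rw [hφ1, hTm, mul_one])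
    exact Nat.eq_one_of_dvd_coprimes hkl h2 h1
  have hmain : ∀ (p : Poly2) (w : ℕ), p ≠ 0 → laurentVal (χ p) = ((-(w * 1 : ℕ) : ℤ) : WithTop ℤ) →
      ∃ c : ℕ × ℕ →₀ Polynomial ℂ, ofNormalForm k l c = ψ p ∧ (∀ ij ∈ c.support, ij.1 < k) ∧
        (∀ ij ∈ c.support, l * ij.1 + k * ij.2 ≤ w) ∧
        ∃ ij ∈ c.support, l * ij.1 + k * ij.2 = w := by
    intro p w hp hw
    obtain ⟨c, hc, hcp⟩ := exists_ofNormalForm (l := l) hk0 (ψ p)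
    have hc0 : c ≠ 0 := by
      rintro rfl
      exact hp (ψ.injective (by rw [← hcp, map_zero]; rfl))
    obtain ⟨ij, hij, hmax, hv⟩ := exists_laurentVal_sum_eq hk0 hkl hc hc0 Nat.one_pos hZm hTm
    rw [← hφ0, ← hφ1, ← apply_ofNormalForm hφC hφr, hcp, ← hχa, hw, WithTop.coe_inj, neg_inj,
      mul_one, one_mul] at hv
    have hv' : w = l * ij.1 + k * ij.2 := by exact_mod_cast hv
    exact ⟨c, hcp, hc, fun ij' hij' => hv' ▸ hmax ij' hij', ij, hij, hv'.symm⟩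
  exact ⟨hmain (X 0) l (X_ne_zero 0) hZn, hmain (X 1) k (X_ne_zero 1) hTn⟩

/-- The diagonal endomorphism `z ↦ a z`, `t ↦ b t` of `ℂ[z, t]`. -/
noncomputable def planeScaling (a b : ℂ) : Poly2 →ₐ[ℂ] Poly2 := aeval ![C a * X 0, C b * X 1]

@[simp] theorem planeScaling_X0 (a b : ℂ) : planeScaling a b (X 0) = C a * X 0 := by
  simp [planeScaling]

@[simp] theorem planeScaling_X1 (a b : ℂ) : planeScaling a b (X 1) = C b * X 1 := by
  simp [planeScaling]

theorem planeScaling_curvePoly {a b c : ℂ} (ha : a ^ k = c) (hb : b ^ l = c) :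
    planeScaling a b (curvePoly ℂ k l) = C c * curvePoly ℂ k l := by
  simp only [curvePoly, map_add, map_pow, planeScaling_X0, planeScaling_X1, mul_pow, ← C_pow, ha, hb]
  ring

theorem planeScaling_aeval {a b : ℂ} (ha : a ^ k = 1) (hb : b ^ l = 1) (P : Polynomial ℂ) :
    planeScaling a b (Polynomial.aeval (curvePoly ℂ k l) P) =
      Polynomial.aeval (curvePoly ℂ k l) P := by
  rw [← Polynomial.aeval_algHom_apply, planeScaling_curvePoly ha hb, C_1, one_mul]

theorem planeScaling_ofNormalForm {a b : ℂ} (ha : a ^ k = 1) (hb : b ^ l = 1)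
    {c : ℕ × ℕ →₀ Polynomial ℂ} (hc : ∀ ij ∈ c.support, a ^ ij.1 * b ^ ij.2 = 1) :
    planeScaling a b (ofNormalForm k l c) = ofNormalForm k l c := by
  rw [ofNormalForm, Finsupp.sum, map_sum]
  refine Finset.sum_congr rfl fun ij hij => ?_
  have h : (C a ^ ij.1 * C b ^ ij.2 : Poly2) = 1 := by
    rw [← C_pow, ← C_pow, ← C_mul, hc ij hij, C_1]
  simp only [map_mul, map_pow, planeScaling_aeval ha hb, planeScaling_X0, planeScaling_X1, mul_pow]
  linear_combination (Polynomial.aeval (curvePoly ℂ k l) (c ij) * X 0 ^ ij.1 * X 1 ^ ij.2) * h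

theorem aeval_curvePoly_ne_zero (hk : k ≠ 0) (hl : l ≠ 0) {P : Polynomial ℂ} (hP : P ≠ 0) :
    Polynomial.aeval (curvePoly ℂ k l) P ≠ 0 := by
  intro h
  apply hP
  have h1 := congrArg (aeval ![(Polynomial.X : Polynomial ℂ), 0]) h
  rw [← Polynomial.aeval_algHom_apply, map_zero] at h1
  have h2 : aeval ![(Polynomial.X : Polynomial ℂ), 0] (curvePoly ℂ k l) = Polynomial.X ^ k := by
    simp [curvePoly, hl]
  rw [h2, ← Polynomial.expand_aeval, Polynomial.aeval_X_left_apply] at h1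
  exact (Polynomial.expand_eq_zero (Nat.pos_of_ne_zero hk)).mp h1

/-- If `(a + b) ^ n` is fixed by an endomorphism which fixes `a` and multiplies `b` by a nontrivial
scalar, then `a = 0`. -/
theorem eq_zero_of_apply_pow_eq {n : ℕ} (hn : n ≠ 0) (σ : Poly2 →ₐ[ℂ] Poly2) {a b : Poly2} {ω : ℂ}
    (ha : σ a = a) (hb : σ b = C ω * b) (hω : ω ≠ 1) (hb0 : b ≠ 0)
    (h : σ ((a + b) ^ n) = (a + b) ^ n) : a = 0 := by
  have hC : ∀ c, σ (C c) = C c := fun c => by rw [← algebraMap_eq, AlgHom.commutes]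
  have hinj : Function.Injective (C : ℂ →+* Poly2) := C_injective _ _
  rw [map_pow, map_add, ha, hb, ← sub_eq_zero,
    ((Complex.isPrimitiveRoot_exp n hn).map_of_injective hinj).pow_sub_pow_eq_prod_sub_mul _ _
      (Nat.pos_of_ne_zero hn), Finset.prod_eq_zero_iff] at h
  obtain ⟨ζ, hζ, h⟩ := h
  have hu : IsUnit ζ := IsUnit.of_pow_eq_one
    ((Polynomial.mem_nthRootsFinset (Nat.pos_of_ne_zero hn) _).mp hζ) hn
  obtain ⟨ω', -, rfl⟩ := MvPolynomial.isUnit_iff_eq_C_of_isReduced.mp hu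
  have h1 := congrArg σ h
  simp only [map_sub, map_add, map_mul, hC, ha, hb, map_zero] at h1
  have h2 : (C ((ω' - ω) * (1 - ω)) : Poly2) * b = 0 := by
    simp only [C_mul, C_sub, C_1]
    linear_combination h1 - h
  have h3 : ω' = ω := by
    rw [mul_eq_zero, or_iff_left hb0, C_eq_zero, mul_eq_zero, sub_eq_zero, sub_eq_zero] at h2
    exact h2.resolve_right (Ne.symm hω)
  subst h3
  have h4 : (C (1 - ω') : Poly2) * a = 0 := by
    simp only [C_sub, C_1]
    linear_combination h
  rw [mul_eq_zero, C_eq_zero, sub_eq_zero] at h4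
  exact h4.resolve_left (Ne.symm hω)

theorem exists_eq_C_mul_of_irreducible {p x : Poly2} (hp : Irreducible (p * x)) (hx : ¬ IsUnit x) :
    ∃ a, p * x = C a * x := by
  obtain ⟨a, -, ha⟩ := MvPolynomial.isUnit_iff_eq_C_of_isReduced.mp
    ((hp.isUnit_or_isUnit rfl).resolve_right hx)
  exact ⟨a, by rw [ha]⟩

/-- The automorphisms of the plane which preserve `r₀` are diagonal. -/
theorem exists_eq_C_mul_X (hk : 2 ≤ k) (hl : 2 ≤ l) (hkl : Nat.Coprime k l)
    (ψ : Poly2 ≃ₐ[ℂ] Poly2) (hψ : ψ (curvePoly ℂ k l) = curvePoly ℂ k l) :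
    ∃ a b : ℂ, ψ (X 0) = C a * X 0 ∧ ψ (X 1) = C b * X 1 := by
  obtain ⟨⟨c, hc, hck, hcle, ij, hij, hcl⟩, c', hc', -, hcle', ij', hij', hcl'⟩ :=
    exists_normalForm_apply hk hl hkl ψ hψ
  have hij0 : ij = (1, 0) := by
    obtain ⟨i, j⟩ := ij
    simp only at hcl
    rcases i with _ | _ | i
    · exfalso
      have h1 : k ∣ l := ⟨j, by omega⟩
      have := Nat.eq_one_of_dvd_coprimes hkl dvd_rfl h1
      omega
    · have : k * j = 0 := by omega
      rcases Nat.mul_eq_zero.mp this with h | h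
      · omega
      · rw [h]
    · exfalso
      nlinarith [Nat.zero_le (k * j), Nat.zero_le (l * i)]
  have hij0' : ij' = (0, 1) := by
    obtain ⟨i, j⟩ := ij'
    simp only at hcl'
    rcases j with _ | _ | j
    · exfalso
      have h1 : l ∣ k := ⟨i, by omega⟩
      have := Nat.eq_one_of_dvd_coprimes hkl h1 dvd_rfl
      omega
    · have : l * i = 0 := by omega
      rcases Nat.mul_eq_zero.mp this with h | h
      · omega
      · rw [h]
    · exfalso
      nlinarith [Nat.zero_le (l * i), Nat.zero_le (k * j)]
  subst hij0 hij0'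
  set h := ofNormalForm k l (c.erase (1, 0)) with hh
  set g := ofNormalForm k l (c'.erase (0, 1)) with hg
  set E := Polynomial.aeval (curvePoly ℂ k l) (c (1, 0)) with hE
  set Q := Polynomial.aeval (curvePoly ℂ k l) (c' (0, 1)) with hQ
  have hz : ψ (X 0) = h + E * X 0 := by
    rw [← hc, ← Finsupp.single_add_erase (1, 0) c, ofNormalForm_add, ofNormalForm_single]
    simp only [pow_one, pow_zero, mul_one]
    ring
  have ht : ψ (X 1) = g + Q * X 1 := by
    rw [← hc', ← Finsupp.single_add_erase (0, 1) c', ofNormalForm_add, ofNormalForm_single]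
    simp only [pow_one, pow_zero, one_mul]
    ring
  have hE0 : E ≠ 0 :=
    aeval_curvePoly_ne_zero (by omega) (by omega) (Finsupp.mem_support_iff.mp hij)
  have hQ0 : Q ≠ 0 :=
    aeval_curvePoly_ne_zero (by omega) (by omega) (Finsupp.mem_support_iff.mp hij')
  have hsupp : ∀ ij ∈ (c.erase (1, 0)).support, ij.1 = 0 := by
    rintro ⟨i, j⟩ hmem
    rw [Finsupp.support_erase, Finset.mem_erase] at hmem
    have := hcle _ hmem.2
    simp only at this ⊢
    rcases i with _ | _ | i
    · rfl
    · rcases j with _ | j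
      · exact absurd rfl hmem.1
      · exfalso
        nlinarith [Nat.zero_le (k * j)]
    · exfalso
      nlinarith [Nat.zero_le (k * j), Nat.zero_le (l * i)]
  have hsupp' : ∀ ij ∈ (c'.erase (0, 1)).support, ij.2 = 0 := by
    rintro ⟨i, j⟩ hmem
    rw [Finsupp.support_erase, Finset.mem_erase] at hmem
    have := hcle' _ hmem.2
    simp only at this ⊢
    rcases j with _ | _ | j
    · rfl
    · rcases i with _ | i
      · exact absurd rfl hmem.1
      · exfalso
        nlinarith [Nat.zero_le (l * i)]
    · exfalso
      nlinarith [Nat.zero_le (k * j), Nat.zero_le (l * i)]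
  obtain ⟨ω, hω, hω1⟩ : ∃ ω : ℂ, ω ^ k = 1 ∧ ω ≠ 1 :=
    ⟨_, (Complex.isPrimitiveRoot_exp k (by omega)).pow_eq_one,
      (Complex.isPrimitiveRoot_exp k (by omega)).ne_one (by omega)⟩
  obtain ⟨η, hη, hη1⟩ : ∃ η : ℂ, η ^ l = 1 ∧ η ≠ 1 :=
    ⟨_, (Complex.isPrimitiveRoot_exp l (by omega)).pow_eq_one,
      (Complex.isPrimitiveRoot_exp l (by omega)).ne_one (by omega)⟩
  have hsum : ψ (X 0) ^ k + ψ (X 1) ^ l = curvePoly ℂ k l := by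
    rw [← map_pow, ← map_pow, ← map_add]
    exact hψ
  have hr : ∀ {a b : ℂ}, a ^ k = 1 → b ^ l = 1 →
      planeScaling a b (curvePoly ℂ k l) = curvePoly ℂ k l := fun ha hb => by
    rw [planeScaling_curvePoly ha hb, C_1, one_mul]
  have H1 : planeScaling ω 1 (ψ (X 1)) = ψ (X 1) → h = 0 := by
    intro hfix
    refine eq_zero_of_apply_pow_eq (n := k) (by omega) (planeScaling ω 1) (b := E * X 0) (ω := ω)
      ?_ ?_ hω1 (mul_ne_zero hE0 (X_ne_zero 0)) ?_
    · exact planeScaling_ofNormalForm hω (one_pow l) fun ij hij => by simp [hsupp ij hij]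
    · rw [map_mul, planeScaling_aeval hω (one_pow l), planeScaling_X0]
      ring
    · rw [← hz, eq_sub_of_add_eq hsum, map_sub, hr hω (one_pow l), map_pow, hfix]
  have H2 : planeScaling 1 η (ψ (X 0)) = ψ (X 0) → g = 0 := by
    intro hfix
    refine eq_zero_of_apply_pow_eq (n := l) (by omega) (planeScaling 1 η) (b := Q * X 1) (ω := η)
      ?_ ?_ hη1 (mul_ne_zero hQ0 (X_ne_zero 1)) ?_
    · exact planeScaling_ofNormalForm (one_pow k) hη fun ij hij => by simp [hsupp' ij hij]
    · rw [map_mul, planeScaling_aeval (one_pow k) hη, planeScaling_X1]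
      ring
    · rw [← ht, eq_sub_of_add_eq' hsum, map_sub, hr (one_pow k) hη, map_pow, hfix]
  have H1' : h = 0 → planeScaling 1 η (ψ (X 0)) = ψ (X 0) := by
    intro h0
    rw [hz, h0, zero_add, map_mul, planeScaling_aeval (one_pow k) hη, planeScaling_X0, C_1, one_mul]
  have H2' : g = 0 → planeScaling ω 1 (ψ (X 1)) = ψ (X 1) := by
    intro h0
    rw [ht, h0, zero_add, map_mul, planeScaling_aeval hω (one_pow l), planeScaling_X1, C_1, one_mul]
  have hhg : h = 0 ∧ g = 0 := by
    rcases lt_or_gt_of_ne (show k ≠ l by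
      rintro rfl
      rw [Nat.coprime_self] at hkl
      omega) with hlt | hlt
    · have h0 : h = 0 := H1 (by
        rw [← hc']
        refine planeScaling_ofNormalForm hω (one_pow l) fun ij hij => ?_
        have : ij.1 = 0 := by
          by_contra hne
          have h1 := hcle' ij hij
          nlinarith [Nat.pos_of_ne_zero hne, Nat.zero_le (k * ij.2)]
        simp [this])
      exact ⟨h0, H2 (H1' h0)⟩
    · have g0 : g = 0 := H2 (by
        rw [← hc]
        refine planeScaling_ofNormalForm (one_pow k) hη fun ij hij => ?_
        have : ij.2 = 0 := by
          by_contra hne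
          have h1 := hcle ij hij
          nlinarith [Nat.pos_of_ne_zero hne, Nat.zero_le (l * ij.1)]
        simp [this])
      exact ⟨H1 (H2' g0), g0⟩
  rw [hhg.1, zero_add] at hz
  rw [hhg.2, zero_add] at ht
  have hirr : ∀ i, Irreducible (ψ (X i)) := fun i =>
    (MulEquiv.irreducible_iff ψ).mpr (X_prime (i := i)).irreducible
  have hX : ∀ i, ¬ IsUnit (X i : Poly2) := fun i => (X_prime (i := i)).not_isUnit
  obtain ⟨a, ha⟩ := exists_eq_C_mul_of_irreducible (hz ▸ hirr 0) (hX 0)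
  obtain ⟨b, hb⟩ := exists_eq_C_mul_of_irreducible (ht ▸ hirr 1) (hX 1)
  exact ⟨a, b, hz.trans ha, ht.trans hb⟩

theorem exists_pow_eq_of_pow_eq_pow {G : Type*} [CommGroup G] (hkl : Nat.Coprime k l) {u v : G}
    (h : u ^ k = v ^ l) : ∃ s : G, s ^ l = u ∧ s ^ k = v := by
  obtain ⟨q, p, hqp⟩ := (Nat.isCoprime_iff_coprime.mpr hkl)
  have h' : u ^ (k : ℤ) = v ^ (l : ℤ) := by exact_mod_cast h
  refine ⟨u ^ p * v ^ q, ?_, ?_⟩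
  · rw [← zpow_natCast, mul_zpow, ← zpow_mul, ← zpow_mul, mul_comm q, zpow_mul v, ← h', ← zpow_mul,
      ← zpow_add, add_comm, mul_comm (k : ℤ), hqp, zpow_one]
  · rw [← zpow_natCast, mul_zpow, ← zpow_mul, ← zpow_mul, mul_comm p, zpow_mul u, h', ← zpow_mul,
      ← zpow_add, add_comm, mul_comm (l : ℤ), hqp, zpow_one]

/-- The automorphisms of the plane which preserve the curve `r₀ = 0` come from the action
of the multiplicative group. -/
theorem exists_eq_C_pow_mul_X (hk : 2 ≤ k) (hl : 2 ≤ l) (hkl : Nat.Coprime k l)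
    (ψ : Poly2 ≃ₐ[ℂ] Poly2) {c : ℂˣ} (hψ : ψ (curvePoly ℂ k l) = C (c : ℂ) * curvePoly ℂ k l) :
    ∃ s : ℂˣ, ψ (X 0) = C ((s : ℂ) ^ l) * X 0 ∧ ψ (X 1) = C ((s : ℂ) ^ k) * X 1 := by
  obtain ⟨a, ha⟩ : ∃ a : ℂ, a ^ k = c := IsAlgClosed.exists_pow_nat_eq _ (by omega)
  obtain ⟨b, hb⟩ : ∃ b : ℂ, b ^ l = c := IsAlgClosed.exists_pow_nat_eq _ (by omega)
  have ha0 : a ≠ 0 := by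
    rintro rfl
    exact c.ne_zero (by rw [← ha, zero_pow (by omega)])
  have hb0 : b ≠ 0 := by
    rintro rfl
    exact c.ne_zero (by rw [← hb, zero_pow (by omega)])
  have hcomp : ∀ {a b a' b' : ℂ}, a * a' = 1 → b * b' = 1 →
      (planeScaling a b).comp (planeScaling a' b') = AlgHom.id ℂ _ := by
    intro a b a' b' h h'
    refine MvPolynomial.algHom_ext fun i => ?_
    fin_cases i
    · simp [← mul_assoc, ← C_mul, mul_comm a', h]
    · simp [← mul_assoc, ← C_mul, mul_comm b', h']
  set S : Poly2 ≃ₐ[ℂ] Poly2 := AlgEquiv.ofAlgHom (planeScaling a b) (planeScaling a⁻¹ b⁻¹)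
    (hcomp (mul_inv_cancel₀ ha0) (mul_inv_cancel₀ hb0))
    (hcomp (inv_mul_cancel₀ ha0) (inv_mul_cancel₀ hb0)) with hS
  have hSa : ∀ p, S p = planeScaling a b p := fun p => rfl
  have hCψ : ∀ e, ψ (C e) = C e := fun e => by rw [← algebraMap_eq, AlgEquiv.commutes]
  have hCS : ∀ e, S (C e) = C e := fun e => by rw [← algebraMap_eq, AlgEquiv.commutes]
  obtain ⟨a', b', ha', hb'⟩ := exists_eq_C_mul_X hk hl hkl (S.symm.trans ψ) (by
    have h1 : S.symm (curvePoly ℂ k l) = C ((c⁻¹ : ℂˣ) : ℂ) * curvePoly ℂ k l := by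
      rw [AlgEquiv.symm_apply_eq, map_mul, hCS, hSa, planeScaling_curvePoly ha hb, ← mul_assoc,
        ← C_mul]
      simp
    rw [AlgEquiv.trans_apply, h1, map_mul, hCψ, hψ, ← mul_assoc, ← C_mul]
    simp)
  have hz : ψ (X 0) = C (a * a') * X 0 := by
    have h1 : ψ (S.symm (S (X 0))) = C (a * a') * X 0 := by
      rw [hSa, planeScaling_X0, ← hCS a, map_mul, S.symm_apply_apply, map_mul, hCψ, C_mul, mul_assoc]
      exact congrArg _ ha'
    rwa [S.symm_apply_apply] at h1
  have ht : ψ (X 1) = C (b * b') * X 1 := by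
    have h1 : ψ (S.symm (S (X 1))) = C (b * b') * X 1 := by
      rw [hSa, planeScaling_X1, ← hCS b, map_mul, S.symm_apply_apply, map_mul, hCψ, C_mul, mul_assoc]
      exact congrArg _ hb'
    rwa [S.symm_apply_apply] at h1
  have hne : ∀ i, ψ (X i) ≠ 0 := fun i => (map_ne_zero_iff ψ ψ.injective).mpr (X_ne_zero i)
  have hu : a * a' ≠ 0 := fun h0 => hne 0 (by rw [hz, h0, C_0, zero_mul])
  have hv : b * b' ≠ 0 := fun h0 => hne 1 (by rw [ht, h0, C_0, zero_mul])
  have huv : (a * a') ^ k = (b * b') ^ l := by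
    have h1 : C ((a * a') ^ k) * X 0 ^ k + C ((b * b') ^ l) * X 1 ^ l =
        C (c : ℂ) * (X 0 ^ k + X 1 ^ l : Poly2) := by
      rw [C_pow, C_pow, ← mul_pow, ← mul_pow, ← hz, ← ht, ← map_pow, ← map_pow, ← map_add]
      exact hψ
    have h2 := congrArg (aeval ![(1 : ℂ), 0]) h1
    have h3 := congrArg (aeval ![(0 : ℂ), 1]) h1
    have hk0 : k ≠ 0 := by omega
    have hl0 : l ≠ 0 := by omega
    simp [hk0, hl0] at h2 h3
    rw [h2, h3]
  obtain ⟨s, hs, hs'⟩ := exists_pow_eq_of_pow_eq_pow hkl (u := Units.mk0 _ hu)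
    (v := Units.mk0 _ hv) (Units.ext (by simpa using huv))
  refine ⟨s, ?_, ?_⟩
  · rw [hz, ← Units.val_pow_eq_pow_val, hs, Units.val_mk0]
  · rw [ht, ← Units.val_pow_eq_pow_val, hs', Units.val_mk0]

end PlaneAutomorphisms

section Classification

open MvPolynomial

variable {d k l : ℕ}

/-- The diagonal endomorphism `x ↦ μ x`, `z ↦ a z`, `t ↦ b t` of `ℂ[x, z, t]`. -/
noncomputable def scalingHom (μ a b : ℂ) : Poly3 →ₐ[ℂ] Poly3 :=
  aeval ![C μ * X 0, C a * X 1, C b * X 2]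

theorem scalingHom_comp {μ a b μ' a' b' : ℂ} (h : μ * μ' = 1) (ha : a * a' = 1) (hb : b * b' = 1) :
    (scalingHom μ a b).comp (scalingHom μ' a' b') = AlgHom.id ℂ _ := by
  have hC : ∀ c, scalingHom μ a b (C c) = C c := fun c => by
    rw [← algebraMap_eq, AlgHom.commutes]
  have key : ∀ (c c' : ℂ) (p : Poly3), c * c' = 1 → C c' * (C c * p) = p := fun c c' p hc => by
    rw [← mul_assoc, ← C_mul, mul_comm c', hc, C_1, one_mul]
  refine MvPolynomial.algHom_ext fun i => ?_
  rw [AlgHom.comp_apply, AlgHom.id_apply, scalingHom.eq_def μ' a' b', aeval_X]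
  fin_cases i
  · simp only [Fin.zero_eta, Matrix.cons_val, map_mul, hC]
    simp [scalingHom, key _ _ _ h]
  · simp only [Fin.mk_one, Matrix.cons_val, map_mul, hC]
    simp [scalingHom, key _ _ _ ha]
  · simp only [Fin.reduceFinMk, Matrix.cons_val, map_mul, hC]
    simp [scalingHom, key _ _ _ hb]

/-- The diagonal automorphism `x ↦ μ x`, `z ↦ a z`, `t ↦ b t` of `ℂ[x, z, t]`. -/
noncomputable def scaling (μ a b : ℂˣ) : Poly3 ≃ₐ[ℂ] Poly3 :=
  AlgEquiv.ofAlgHom (scalingHom μ a b) (scalingHom (μ⁻¹ : ℂˣ) (a⁻¹ : ℂˣ) (b⁻¹ : ℂˣ))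
    (scalingHom_comp (by simp) (by simp) (by simp)) (scalingHom_comp (by simp) (by simp) (by simp))

@[simp] theorem scaling_X0 (μ a b : ℂˣ) : scaling μ a b (X 0) = C (μ : ℂ) * X 0 := by
  simp [scaling, scalingHom]

@[simp] theorem scaling_X1 (μ a b : ℂˣ) : scaling μ a b (X 1) = C (a : ℂ) * X 1 := by
  simp [scaling, scalingHom]

@[simp] theorem scaling_X2 (μ a b : ℂˣ) : scaling μ a b (X 2) = C (b : ℂ) * X 2 := by
  simp [scaling, scalingHom]

theorem scaling_aeval (μ a b : ℂˣ) (P : Polynomial ℂ) :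
    scaling μ a b (Polynomial.aeval (X 0 : Poly3) P) =
      Polynomial.aeval (X 0 : Poly3) (dilate μ P) := by
  induction P using Polynomial.induction_on' with
  | add p q hp hq => simp only [map_add, hp, hq]
  | monomial n c =>
    rw [← Polynomial.C_mul_X_pow_eq_monomial]
    simp only [map_mul, map_pow, dilate, Polynomial.aeval_C, Polynomial.aeval_X,
      scaling_X0, Polynomial.algebraMap_eq, algebraMap_eq]
    rw [← algebraMap_eq, AlgEquiv.commutes]

/-- The weight of the parameter `a i j`. -/
def paramWeight (k l : ℕ) (p : Fin (k - 1) × Fin (l - 1)) : ℤ :=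
  (l : ℤ) * (p.1 : ℕ) + (k : ℤ) * (p.2 : ℕ) - (k : ℤ) * l

theorem scaling_versal {a a' : Fin (k - 1) × Fin (l - 1) → Polynomial ℂ} (c μ : ℂˣ)
    (h : ∀ p, dilate μ (a p) = Polynomial.C ((c ^ paramWeight k l p : ℂˣ) : ℂ) * a' p) :
    scaling μ (c⁻¹ ^ l) (c⁻¹ ^ k) (versal k l a) =
      C ((c⁻¹ ^ (k * l) : ℂˣ) : ℂ) * versal k l a' := by
  have hemb : ∀ c, emb (C c) = C c := fun c => by rw [← algebraMap_eq, AlgHom.commutes]; rfl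
  rw [versal, versal, map_add, map_sum, mul_add, Finset.mul_sum]
  congr 1
  · simp only [curvePoly, map_add, map_pow, emb_X0, emb_X1, scaling_X1, scaling_X2, mul_pow,
      Units.val_pow_eq_pow_val]
    rw [← pow_mul, ← pow_mul, mul_comm l k]
    ring
  · refine Finset.sum_congr rfl fun p _ => ?_
    rw [map_mul, scaling_aeval, h, map_mul, Polynomial.aeval_C, algebraMap_eq]
    simp only [map_mul, map_pow, emb_X0, emb_X1, scaling_X1, scaling_X2, mul_pow]
    have hc : c ^ paramWeight k l p * (c⁻¹ ^ l) ^ (p.1 : ℕ) * (c⁻¹ ^ k) ^ (p.2 : ℕ) =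
        c⁻¹ ^ (k * l) := by
      simp only [← zpow_natCast, inv_zpow', ← zpow_mul, ← zpow_add, paramWeight]
      congr 1
      push_cast
      ring
    have hc' := congrArg (fun u : ℂˣ => (C (u : ℂ) : Poly3)) hc
    simp only [Units.val_mul, C_mul, Units.val_pow_eq_pow_val, C_pow] at hc' ⊢
    linear_combination (Polynomial.aeval (X 0 : Poly3) (a' p) * X 1 ^ (p.1 : ℕ) *
      X 2 ^ (p.2 : ℕ)) * hc'

theorem exists_scaled_params (a : Fin (k - 1) × Fin (l - 1) → Polynomial ℂ)
    (ha : ∀ p, (a p).coeff 0 = 0) (c μ : ℂˣ) :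
    ∃ a' : Fin (k - 1) × Fin (l - 1) → Polynomial ℂ, (∀ p, (a' p).coeff 0 = 0) ∧
      ∀ p, dilate μ (a p) = Polynomial.C ((c ^ paramWeight k l p : ℂˣ) : ℂ) * a' p := by
  refine ⟨fun p => Polynomial.C (((c ^ paramWeight k l p)⁻¹ : ℂˣ) : ℂ) * dilate μ (a p),
    fun p => ?_, fun p => ?_⟩
  · have h1 : (dilate μ (a p)).coeff 0 = 0 := by
      obtain ⟨Q, hQ⟩ := Polynomial.X_dvd_iff.mpr (ha p)
      rw [hQ, map_mul, dilate, Polynomial.aeval_X, mul_assoc, Polynomial.coeff_C_mul,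
        Polynomial.coeff_X_mul_zero, mul_zero]
    rw [Polynomial.coeff_C_mul, h1, mul_zero]
  · rw [← mul_assoc, ← Polynomial.C_mul, ← Units.val_mul, mul_inv_cancel]
    simp

theorem C_unit_mul_C_inv (u : ℂˣ) : (C ((u⁻¹ : ℂˣ) : ℂ) * C (u : ℂ) : Poly3) = 1 := by
  rw [← C_mul, ← Units.val_mul, inv_mul_cancel, Units.val_one, C_1]

theorem coordEquiv_of_dvd_sub (hd : d ≠ 0) {a b : Fin (k - 1) × Fin (l - 1) → Polynomial ℂ}
    (ha : ∀ p, (a p).coeff 0 = 0) (hb : ∀ p, (b p).coeff 0 = 0) {c μ : ℂˣ}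
    (h : ∀ p, Polynomial.X ^ d ∣
      dilate μ (a p) - Polynomial.C ((c ^ paramWeight k l p : ℂˣ) : ℂ) * b p) :
    CoordEquiv d (versal k l a) (versal k l b) := by
  obtain ⟨a', ha', haa'⟩ := exists_scaled_params a ha c μ
  have hne : ∀ {a : Fin (k - 1) × Fin (l - 1) → Polynomial ℂ}, (∀ p, (a p).coeff 0 = 0) →
      ev0 (versal k l a) ≠ 0 := fun ha => by
    rw [ev0_versal ha]
    exact curvePoly_ne_zero
  have h1 := scaling_versal c μ haa'
  have hu0 := C_unit_mul_C_inv (c⁻¹ ^ (k * l))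
  have hev : ev0 (C ((c⁻¹ ^ (k * l) : ℂˣ) : ℂ) * versal k l a') ≠ 0 := by
    rw [map_mul]
    refine mul_ne_zero ?_ (hne ha')
    rw [← algebraMap_eq, AlgHom.commutes, algebraMap_eq, Ne, C_eq_zero]
    exact Units.ne_zero _
  have h2 : CoordEquiv d (versal k l a) (C ((c⁻¹ ^ (k * l) : ℂˣ) : ℂ) * versal k l a') := by
    rw [← h1]
    exact coordEquiv_apply hd _ μ (scaling_X0 _ _ _) (hne ha) (h1 ▸ hev)
  have h3 : CoordEquiv d (C ((c⁻¹ ^ (k * l) : ℂˣ) : ℂ) * versal k l a') (versal k l a') := by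
    refine coordEquiv_of_mem_centerIdeal hd hev (hne ha') ?_ ?_
    · exact mem_centerIdeal.mpr ⟨0, C ((c⁻¹ ^ (k * l) : ℂˣ) : ℂ), by ring⟩
    · refine mem_centerIdeal.mpr ⟨0, C (((c⁻¹ ^ (k * l))⁻¹ : ℂˣ) : ℂ), ?_⟩
      linear_combination (-versal k l a') * hu0
  have h4 : ∀ p, ∃ e, a' p - b p = Polynomial.X ^ d * e := by
    intro p
    obtain ⟨e, he⟩ := h p
    rw [haa', ← mul_sub] at he
    refine ⟨Polynomial.C (((c ^ paramWeight k l p)⁻¹ : ℂˣ) : ℂ) * e, ?_⟩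
    have h5 : Polynomial.C (((c ^ paramWeight k l p)⁻¹ : ℂˣ) : ℂ) *
        Polynomial.C ((c ^ paramWeight k l p : ℂˣ) : ℂ) = 1 := by
      rw [← Polynomial.C_mul, ← Units.val_mul, inv_mul_cancel, Units.val_one, Polynomial.C_1]
    linear_combination Polynomial.C (((c ^ paramWeight k l p)⁻¹ : ℂˣ) : ℂ) * he -
      (a' p - b p) * h5
  choose e he using h4
  have h6 := versal_eq_add a' b he
  refine (h2.trans h3).trans ?_
  rw [h6]
  exact (coordEquiv_add_X0_pow_mul hd (hne hb) _).symm

theorem curvePoly_prime (hk : 2 ≤ k) (hkl : Nat.Coprime k l) :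
    Prime (curvePoly ℂ k l) := by
  obtain ⟨ε, hε⟩ : ∃ ε : ℂ, ε ^ k = -1 := IsAlgClosed.exists_pow_nat_eq _ (by omega)
  have hiff : ∀ p, curvePoly ℂ k l ∣ p ↔ curveParam k l ε p = 0 := fun p =>
    ⟨fun ⟨q, hq⟩ => by rw [hq, map_mul, curveParam_curvePoly hε, zero_mul],
      curvePoly_dvd_of_curveParam_eq_zero (by omega) hkl hε⟩
  refine ⟨curvePoly_ne_zero, fun hu => ?_, fun p q hpq => ?_⟩
  · have := (hiff 1).mp hu.dvd
    rw [map_one] at this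
    exact one_ne_zero this
  · rw [hiff, map_mul, mul_eq_zero, ← hiff, ← hiff] at hpq
    exact hpq

/-- The automorphism of the plane `x = 0` induced by an automorphism which rescales `x`. -/
theorem exists_planeAutomorphism (Φ : Poly3 ≃ₐ[ℂ] Poly3) {μ : ℂˣ}
    (hx : Φ (X 0) = C (μ : ℂ) * X 0) : ∃ ψ : Poly2 ≃ₐ[ℂ] Poly2, ∀ p, ψ (ev0 p) = ev0 (Φ p) := by
  have hx' : Φ.symm (X 0) = C ((μ⁻¹ : ℂˣ) : ℂ) * X 0 := by
    rw [AlgEquiv.symm_apply_eq, map_mul, hx, ← mul_assoc, ← algebraMap_eq, AlgEquiv.commutes,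
      ← map_mul]
    simp
  have key : ∀ {Φ : Poly3 ≃ₐ[ℂ] Poly3} {μ : ℂˣ}, Φ (X 0) = C (μ : ℂ) * X 0 → ∀ p,
      ev0 (Φ (emb (ev0 p))) = ev0 (Φ p) := by
    intro Φ μ hx p
    obtain ⟨q, hq⟩ := exists_eq_emb_add p
    conv_rhs => rw [hq, map_add, map_mul, hx]
    simp
  refine ⟨AlgEquiv.ofAlgHom ((ev0.comp Φ.toAlgHom).comp emb)
    ((ev0.comp Φ.symm.toAlgHom).comp emb) ?_ ?_, fun p => key hx p⟩
  · refine AlgHom.ext fun p => ?_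
    change ev0 (Φ (emb (ev0 (Φ.symm (emb p))))) = p
    rw [key hx, Φ.apply_symm_apply, ev0_emb]
  · refine AlgHom.ext fun p => ?_
    change ev0 (Φ.symm (emb (ev0 (Φ (emb p))))) = p
    rw [key hx', Φ.symm_apply_apply, ev0_emb]

theorem exists_dvd_sub_of_coordEquiv (hd : 2 ≤ d) (hk : 2 ≤ k) (hl : 2 ≤ l)
    (hkl : Nat.Coprime k l) {a b : Fin (k - 1) × Fin (l - 1) → Polynomial ℂ}
    (ha : ∀ p, (a p).coeff 0 = 0) (hb : ∀ p, (b p).coeff 0 = 0)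
    (h : CoordEquiv d (versal k l a) (versal k l b)) :
    ∃ c μ : ℂˣ, ∀ p, Polynomial.X ^ d ∣
      dilate μ (a p) - Polynomial.C ((c ^ paramWeight k l p : ℂˣ) : ℂ) * b p := by
  obtain ⟨φ⟩ := h
  have hd0 : d ≠ 0 := by omega
  obtain ⟨Φ, μ, hx, hΦ⟩ := exists_automorphism hd hk hl hkl (ev0_versal ha) (ev0_versal hb) φ
  obtain ⟨ψ, hψ⟩ := exists_planeAutomorphism Φ hx
  have hev0C : ∀ c, ev0 (C c) = C c := fun c => by rw [← algebraMap_eq, AlgHom.commutes]; rfl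
  obtain ⟨e, hψr⟩ : ∃ e : ℂˣ, ψ (curvePoly ℂ k l) = C (e : ℂ) * curvePoly ℂ k l := by
    obtain ⟨A, B, hAB⟩ := mem_centerIdeal.mp hΦ
    have h1 : ψ (curvePoly ℂ k l) = ev0 B * curvePoly ℂ k l := by
      rw [← ev0_versal ha, hψ, hAB, map_add, map_mul, map_mul, map_pow, ev0_X0, zero_pow hd0,
        mul_zero, zero_add, ev0_versal hb, ev0_versal ha]
    have hprime := curvePoly_prime hk hkl
    have hirr : Irreducible (ev0 B * curvePoly ℂ k l) := by
      rw [← h1]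
      exact (MulEquiv.irreducible_iff ψ).mpr hprime.irreducible
    obtain ⟨e, he, heB⟩ := MvPolynomial.isUnit_iff_eq_C_of_isReduced.mp
      ((hirr.isUnit_or_isUnit rfl).resolve_right hprime.not_isUnit)
    obtain ⟨e, rfl⟩ := he
    exact ⟨e, by rw [h1, heB]⟩
  obtain ⟨s, hsz, hst⟩ := exists_eq_C_pow_mul_X hk hl hkl ψ hψr
  refine ⟨s⁻¹, μ, ?_⟩
  obtain ⟨a', ha', haa'⟩ := exists_scaled_params a ha s⁻¹ μ
  have hS := scaling_versal s⁻¹ μ haa'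
  rw [inv_inv] at hS
  set S := scaling μ (s ^ l) (s ^ k) with hSdef
  have hCS : ∀ c, S.symm (C c) = C c := fun c => by rw [← algebraMap_eq, AlgEquiv.commutes]
  have hCΦ : ∀ c, Φ (C c) = C c := fun c => by rw [← algebraMap_eq, AlgEquiv.commutes]
  have hSsymm : ∀ (u : ℂˣ) (i : Fin 3), S (X i) = C (u : ℂ) * X i →
      S.symm (X i) = C ((u⁻¹ : ℂˣ) : ℂ) * X i := by
    intro u i hu
    rw [AlgEquiv.symm_apply_eq, map_mul, hu, ← mul_assoc, ← algebraMap_eq, AlgEquiv.commutes,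
      ← map_mul]
    simp
  set Θ : Poly3 ≃ₐ[ℂ] Poly3 := S.symm.trans Φ with hΘ
  have hΘa : ∀ p, Θ p = Φ (S.symm p) := fun p => rfl
  have hΘ0 : Θ (X 0) = X 0 := by
    rw [hΘa, hSsymm μ 0 (scaling_X0 _ _ _), map_mul, hCΦ, hx, ← mul_assoc, C_unit_mul_C_inv, one_mul]
  have hev : ∀ i, ev0 (Θ (X i)) = ev0 (X i) := by
    have hinv : ∀ u : ℂˣ, (C ((u⁻¹ : ℂˣ) : ℂ) * C (u : ℂ) : Poly2) = 1 := fun u => by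
      rw [← C_mul, ← Units.val_mul, inv_mul_cancel, Units.val_one, C_1]
    intro i
    fin_cases i
    · exact congrArg ev0 hΘ0
    · change ev0 (Θ (X 1)) = ev0 (X 1)
      rw [hΘa, hSsymm _ 1 (scaling_X1 _ _ _), map_mul, hCΦ, map_mul, ← hψ, ev0_X1, hsz, hev0C,
        ← mul_assoc, ← Units.val_pow_eq_pow_val, hinv, one_mul]
    · change ev0 (Θ (X 2)) = ev0 (X 2)
      rw [hΘa, hSsymm _ 2 (scaling_X2 _ _ _), map_mul, hCΦ, map_mul, ← hψ, ev0_X2, hst, hev0C,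
        ← mul_assoc, ← Units.val_pow_eq_pow_val, hinv, one_mul]
  have hspecial : IsSpecial d 1 Θ.toAlgHom := by
    refine ⟨hΘ0, fun i => ?_, ?_⟩
    · rw [pow_one, ← ev0_eq_zero_iff, map_sub, sub_eq_zero]
      exact hev i
    · obtain ⟨c, hc⟩ := exists_bracket_eq_C Θ (μ := 1) (by simpa using hΘ0)
      have h1 := congrArg ev0 hc
      rw [ev0_bracket, hev, hev, hev0C, ev0_X1, ev0_X2] at h1
      have h2 : planeBracket (X 0 : Poly2) (X 1) = 1 := by simp [planeBracket, pderiv_X]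
      rw [h2, ← C_1, C_inj] at h1
      change _ ∣ bracket (Θ (X 1)) (Θ (X 2)) - 1
      rw [hc, ← h1, C_1, sub_self]
      exact dvd_zero _
  have hmem : Θ.toAlgHom (versal k l a') ∈ centerIdeal d (versal k l b) := by
    have h1 : versal k l a' = C (((s ^ (k * l))⁻¹ : ℂˣ) : ℂ) * S (versal k l a) := by
      rw [hS, ← mul_assoc, C_unit_mul_C_inv, one_mul]
    change Φ (S.symm (versal k l a')) ∈ _
    rw [h1, map_mul, hCS, S.symm_apply_apply, map_mul]
    exact Ideal.mul_mem_left _ _ hΦ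
  intro p
  rw [haa', ← mul_sub]
  exact (dvd_sub_of_mem_centerIdeal hk hl hkl ha' hb hd0 hspecial hmem p).mul_left _

end Classification

section Schemes

open MvPolynomial

variable {d k l : ℕ}

/-- The ring homomorphism underlying a morphism of hypersurfaces. -/
noncomputable def coordMap {f f' : Poly3} (g : hypersurface d f ⟶ hypersurface d f') :
    CommRingCat.of (CoordinateRing d f') ⟶ CommRingCat.of (CoordinateRing d f) :=
  Spec.preimage g.left

theorem map_coordMap {f f' : Poly3} (g : hypersurface d f ⟶ hypersurface d f') :
    Spec.map (coordMap g) = g.left := Spec.map_preimage _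

theorem algebraMap_comp_coordMap {f f' : Poly3} (g : hypersurface d f ⟶ hypersurface d f') :
    CommRingCat.ofHom (algebraMap ℂ (CoordinateRing d f')) ≫ coordMap g =
      CommRingCat.ofHom (algebraMap ℂ (CoordinateRing d f)) := by
  apply Spec.map_injective
  rw [Spec.map_comp, map_coordMap]
  exact Over.w g

theorem coordMap_comp_coordMap {f f' : Poly3} (g : hypersurface d f ⟶ hypersurface d f')
    (g' : hypersurface d f' ⟶ hypersurface d f) (h : g ≫ g' = 𝟙 _) :
    coordMap g' ≫ coordMap g = 𝟙 _ := by
  apply Spec.map_injective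
  rw [Spec.map_comp, map_coordMap, map_coordMap, Spec.map_id]
  exact congrArg CommaMorphism.left h

/-- Hypersurfaces are isomorphic if and only if their coordinate rings are. -/
theorem nonempty_hypersurface_iso_iff {f f' : Poly3} :
    Nonempty (hypersurface d f ≅ hypersurface d f') ↔ CoordEquiv d f f' := by
  constructor
  · rintro ⟨e⟩
    refine ⟨AlgEquiv.ofAlgHom (AlgHom.mk (coordMap e.inv).hom fun c => ?_)
      (AlgHom.mk (coordMap e.hom).hom fun c => ?_) ?_ ?_⟩
    · exact congrArg (fun g => g.hom c) (algebraMap_comp_coordMap e.inv)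
    · exact congrArg (fun g => g.hom c) (algebraMap_comp_coordMap e.hom)
    · exact AlgHom.ext fun p => congrArg (fun g => g.hom p) (coordMap_comp_coordMap e.inv e.hom e.inv_hom_id)
    · exact AlgHom.ext fun p => congrArg (fun g => g.hom p) (coordMap_comp_coordMap e.hom e.inv e.hom_inv_id)
  · rintro ⟨φ⟩
    refine ⟨Over.isoMk (Scheme.Spec.mapIso φ.toRingEquiv.toCommRingCatIso.symm.op) ?_⟩
    change Spec.map _ ≫ Spec.map _ = Spec.map _
    rw [← Spec.map_comp]
    congr 1
    ext c
    exact φ.symm.commutes c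

theorem pullbackPoly_eq_versal (α : ParamRing k l →ₐ[ℂ] Polynomial ℂ) :
    pullbackPoly k l α = versal k l fun p => α (X p) := by
  simp only [pullbackPoly, flatten, versalPoly, versal, curvePoly, map_add, map_sum, map_mul,
    map_pow, map_X, map_C]
  simp

theorem isPointed_iff (α : ParamRing k l →ₐ[ℂ] Polynomial ℂ) :
    IsPointed α ↔ ∀ p, (α (X p)).coeff 0 = 0 := by
  simp only [IsPointed, Ideal.mem_span_singleton]
  constructor
  · exact fun h p => Polynomial.X_dvd_iff.mp (h _ (Ideal.subset_span ⟨p, rfl⟩))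
  · intro h b hb
    have h1 : originIdeal k l ≤ (Ideal.span {(Polynomial.X : Polynomial ℂ)}).comap α := by
      refine Ideal.span_le.mpr ?_
      rintro _ ⟨p, rfl⟩
      exact Ideal.mem_span_singleton.mpr (Polynomial.X_dvd_iff.mpr (h p))
    exact Ideal.mem_span_singleton.mp (h1 hb)

theorem truncate_comp_eq_iff (α β : ParamRing k l →ₐ[ℂ] Polynomial ℂ) (c μ : ℂˣ) :
    (dilateTruncated d μ).comp ((truncate d).comp α) =
        ((truncate d).comp β).comp (weightScaling k l c) ↔
      ∀ p, Polynomial.X ^ d ∣ dilate μ (α (X p)) -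
        Polynomial.C ((c ^ paramWeight k l p : ℂˣ) : ℂ) * β (X p) := by
  have h : ∀ p, ((dilateTruncated d μ).comp ((truncate d).comp α) (X p) =
      ((truncate d).comp β).comp (weightScaling k l c) (X p)) ↔
      Polynomial.X ^ d ∣ dilate μ (α (X p)) -
        Polynomial.C ((c ^ paramWeight k l p : ℂˣ) : ℂ) * β (X p) := by
    intro p
    have h1 : β (weightScaling k l c (X p)) =
        Polynomial.C ((c ^ paramWeight k l p : ℂˣ) : ℂ) * β (X p) := by
      rw [weightScaling, aeval_X, map_mul, ← algebraMap_eq, AlgHom.commutes,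
        Polynomial.algebraMap_eq]
      rfl
    rw [← h1, ← Ideal.mem_span_singleton, ← Ideal.Quotient.eq]
    rfl
  constructor
  · exact fun heq p => (h p).mp (by rw [heq])
  · exact fun hp => MvPolynomial.algHom_ext fun p => (h p).mpr (hp p)

end Schemes

end KRThreefold

open KRThreefold in
theorem mainTheorem2 (d k ℓ : ℕ) (hd : 2 ≤ d) (hk : 2 ≤ k) (hℓ : 2 ≤ ℓ)
    (hcop : Nat.Coprime k ℓ) :
    (∀ g : MvPolynomial (Fin 3) ℂ,
      ∃ α : ParamRing k ℓ →ₐ[ℂ] Polynomial ℂ,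
        IsPointed α ∧ Nonempty (threefold d k ℓ g ≅ versalThreefold d α)) ∧
    (∀ α β : ParamRing k ℓ →ₐ[ℂ] Polynomial ℂ, IsPointed α → IsPointed β →
      (Nonempty (versalThreefold d α ≅ versalThreefold d β) ↔
        ∃ c μ : ℂˣ,
          (dilateTruncated d μ).comp ((truncate d).comp α) =
            ((truncate d).comp β).comp (weightScaling k ℓ c))) := by
  have hd0 : d ≠ 0 := by omega
  constructor
  · intro g
    obtain ⟨a, ha, hga⟩ := exists_coordEquiv_versal hd0 hk hℓ
      (f := emb (curvePoly ℂ k ℓ) + MvPolynomial.X 0 * g) (by simp)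
    refine ⟨MvPolynomial.aeval a, (isPointed_iff _).mpr fun p => by simpa using ha p, ?_⟩
    refine nonempty_hypersurface_iso_iff.mpr ?_
    rw [pullbackPoly_eq_versal]
    simp only [MvPolynomial.aeval_X]
    exact hga
  · intro α β hα hβ
    rw [isPointed_iff] at hα hβ
    simp only [truncate_comp_eq_iff]
    refine nonempty_hypersurface_iso_iff.trans ?_
    rw [pullbackPoly_eq_versal, pullbackPoly_eq_versal]
    exact ⟨exists_dvd_sub_of_coordEquiv hd hk hℓ hcop hα hβ,
      fun ⟨_, _, h⟩ => coordEquiv_of_dvd_sub hd0 hα hβ h⟩
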